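/- Let $K$ be an infinite field. Let $V_\infty$ be the $K$-vector space with basis $x_i$ ($i\in\mathbb Z\setminus\{0\}$), and for $n,p\ge 0$ put $V_{n,p}=\langle x_{-n},\dots,x_{-1},x_1,\dots,x_p\rangle$. The infinite wedge $W=\varinjlim_{n,p}\bigwedge^pV_{n,p}$ is the direct limit along the maps $\bigwedge^pV_{n,p}\to\bigwedge^pV_{n+1,p}$ induced by inclusion and the maps $\bigwedge^pV_{n,p}\to\bigwedge^{p+1}V_{n,p+1}$, $\omega\mapsto\omega\wedge x_{p+1}$. Let $G_{n,p}=\mathrm{GL}(V_{n,p})$, embedded in $\mathrm{GL}(V_\infty)$ by fixing all $x_i\notin V_{n,p}$, and let $G_\infty=\bigcup_{n,p}G_{n,p}$, which acts on $W$ and contragrediently on the dual $W^*$ (the dual infinite wedge). The elements of the symmetric algebra $\mathrm{Sym}(W)$ are regarded as polynomial functions on $W^*$, and $W^*$ carries the Zariski topology, in which the closed sets are the common zero sets of collections of such polynomials. For $r\ge 0$ let $\mathrm{Pf}_{r+1}\in\mathrm{Sym}(W)$ be the Pfaffian of the $(2r+2)\times(2r+2)$ matrix with entries $x_i\wedge x_j\in\bigwedge^2V_{2r,2}$,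 $i,j\in\{-2r,\dots,-1,1,2\}$. For $s\ge0$ let $\mathrm{Pf}^\star_{s+1}\in\mathrm{Sym}(W)$ be the Pfaffian of the skew-symmetric matrix with rows and columns indexed by $\{-2,-1,1,\dots,2s\}$ whose $(i,j)$ entry, for $i\neq j$, is $\pm x_J\in\bigwedge^{2s}V_{2,2s}$, where $x_J$ is the wedge product, in increasing order, of the $x_k$ with $k\in\{-2,-1,1,\dots,2s\}\setminus\{i,j\}$, and the sign is such that $(\pm x_J)\wedge x_i\wedge x_j=x_{-2}\wedge x_{-1}\wedge x_1\wedge\dots\wedge x_{2s}$. (Pfaffians are taken in their division-free form, as signed sums over perfect matchings.) Define the Pfaffian variety $$Y^{r,s}_\infty=\{\omega\in W^*\mid \mathrm{Pf}_{r+1}(g\omega)=\mathrm{Pf}^\star_{s+1}(g\omega)=0\ \text{ for all } g\in G_\infty\}.$$ **Theorem 6.1.** For all integers $r,s\ge0$, the variety $Y^{r,s}_\infty$ (with the induced topology) is $G_\infty$-Noetherian, that is, every descending chain of closed $G_\infty$-stable subsets of $Y^{r,s}_\infty$ stabilises. In other words, every $G_\infty$-stable closed subset $Z$ of $Y^{r,s}_\infty$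 is cut out by finitely many $G_\infty$-orbits of polynomial equations: there is a finite set $F\subseteq\mathrm{Sym}(W)$ with $Z=\{\omega\in W^*\mid f(g\omega)=0 \text{ for all } f\in F,\ g\in G_\infty\}$. -/

import Mathlib

noncomputable section

namespace InfWedge

universe u

/-- The index set `-ℕ ∪ ℕ` (`ℕ = {1, 2, …}`): the nonzero integers. -/
abbrev Idx : Type := {i : ℤ // i ≠ 0}

/-- The countable-dimensional space with basis `x_i`, `i` a nonzero integer. -/
abbrev VInf (K : Type u) [Field K] : Type u := Idx →₀ K

/-- The positive index `k + 1`. -/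
def posIdx (k : ℕ) : Idx := ⟨(k : ℤ) + 1, by omega⟩

/-- The indices of `V_{n,p}`, where `q = (n, p)`: the `i ≠ 0` with `-n ≤ i ≤ p`. -/
def range (q : ℕ × ℕ) : Set Idx := {i | -(q.1 : ℤ) ≤ i.1 ∧ i.1 ≤ (q.2 : ℤ)}

theorem range_mono {q q' : ℕ × ℕ} (h : q ≤ q') : range q ⊆ range q' := by
  rintro i ⟨h1, h2⟩
  have a := h.1
  have b := h.2
  exact ⟨by omega, by omega⟩

variable (K : Type u) [Field K]

/-- The basis vector `x_i` of `V_∞`. -/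
def basisVec (i : Idx) : VInf K := Finsupp.single i 1

/-- The subspace `V_{n,p} = ⟨x_{-n}, …, x_{-1}, x_1, …, x_p⟩` of `V_∞`, with `q = (n, p)`. -/
def VSub (q : ℕ × ℕ) : Submodule K (VInf K) := Submodule.span K (basisVec K '' range q)

/-- The basis vector `x_i`, regarded as an element of the exterior algebra of `V_∞`. -/
def x (i : Idx) : ExteriorAlgebra K (VInf K) := ExteriorAlgebra.ι K (basisVec K i)

/-- The exterior power `⋀^p V_{n,p}`, with `q = (n, p)`, as a subspace of the exterior algebra of
`V_∞`: the span of the products of `p` vectors of `V_{n,p}`. -/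
def Stage (q : ℕ × ℕ) : Submodule K (ExteriorAlgebra K (VInf K)) :=
  Submodule.map (ExteriorAlgebra.ι K) (VSub K q) ^ q.2

/-- `Stage` is the image of Mathlib's `p`-th exterior power of `V_{n,p}` under the map of exterior
algebras induced by the inclusion of `V_{n,p}` in `V_∞` (which is injective). -/
theorem stage_eq_map_exteriorPower (q : ℕ × ℕ) :
    Stage K q = Submodule.map (ExteriorAlgebra.map (VSub K q).subtype).toLinearMap
      (⋀[K]^q.2 (VSub K q)) := by
  rw [Stage, Submodule.map_pow]
  congr 1
  ext w
  simp [Submodule.mem_map]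

/-- The product `x_{a+1} ∧ x_{a+2} ∧ ⋯ ∧ x_{a+m}`. -/
def tail (a m : ℕ) : ExteriorAlgebra K (VInf K) :=
  ((List.range' a m).map fun k => x K (posIdx k)).prod

theorem tail_mul_tail (a m m' : ℕ) : tail K a m * tail K (a + m) m' = tail K a (m + m') := by
  rw [tail, tail, tail, ← List.prod_append, ← List.map_append, List.range'_append_1]

theorem VSub_mono {q q' : ℕ × ℕ} (h : q ≤ q') : VSub K q ≤ VSub K q' :=
  Submodule.span_mono (Set.image_mono (range_mono h))

theorem list_prod_mem (q : ℕ × ℕ) (l : List Idx) (hl : ∀ i ∈ l, i ∈ range q) :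
    (l.map (x K)).prod ∈ Submodule.map (ExteriorAlgebra.ι K) (VSub K q) ^ l.length := by
  induction l with
  | nil => simp [Submodule.one_le.mp le_rfl]
  | cons i l ih =>
    rw [List.map_cons, List.prod_cons, List.length_cons, pow_succ']
    refine Submodule.mul_mem_mul ?_ (ih fun j hj => hl j (List.mem_cons_of_mem _ hj))
    exact Submodule.mem_map_of_mem
      (Submodule.subset_span (Set.mem_image_of_mem _ (hl i List.mem_cons_self)))

theorem mul_tail_mem {q q' : ℕ × ℕ} (h : q ≤ q') {w : ExteriorAlgebra K (VInf K)}
    (hw : w ∈ Stage K q) : w * tail K q.2 (q'.2 - q.2) ∈ Stage K q' := by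
  have hp : q'.2 = q.2 + (q'.2 - q.2) := (Nat.add_sub_cancel' h.2).symm
  rw [Stage, hp, pow_add]
  rw [← hp]
  refine Submodule.mul_mem_mul
    (pow_le_pow_left' (Submodule.map_mono (VSub_mono K h)) q.2 hw) ?_
  have := list_prod_mem K q' ((List.range' q.2 (q'.2 - q.2)).map posIdx) (by
    intro i hi
    obtain ⟨k, hk, rfl⟩ := List.mem_map.1 hi
    rw [List.mem_range'_1] at hk
    refine ⟨?_, ?_⟩ <;> simp only [posIdx] <;> omega)
  simpa [tail, Function.comp_def] using this

/-- The map `⋀^p V_{n,p} → ⋀^{p'} V_{n',p'}` for `n ≤ n'`, `p ≤ p'`: the composition of the maps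
induced by inclusions `V_{n,p} → V_{n+1,p}` and of the maps `ω ↦ ω ∧ x_{p+1}`. -/
def trans (q q' : ℕ × ℕ) (h : q ≤ q') : Stage K q →ₗ[K] Stage K q' :=
  (LinearMap.mulRight K (tail K q.2 (q'.2 - q.2))).restrict fun _ hw => mul_tail_mem K h hw

theorem coe_trans (q q' : ℕ × ℕ) (h : q ≤ q') (w : Stage K q) :
    (trans K q q' h w : ExteriorAlgebra K (VInf K)) = w * tail K q.2 (q'.2 - q.2) := rfl

theorem trans_trans (q q' q'' : ℕ × ℕ) (h : q ≤ q') (h' : q' ≤ q'') (w : Stage K q) :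
    trans K q' q'' h' (trans K q q' h w) = trans K q q'' (h.trans h') w := by
  apply Subtype.ext
  have a := h.2
  have b := h'.2
  have e : tail K q.2 (q'.2 - q.2) * tail K q'.2 (q''.2 - q'.2) = tail K q.2 (q''.2 - q.2) := by
    have := tail_mul_tail K q.2 (q'.2 - q.2) (q''.2 - q'.2)
    rwa [show q.2 + (q'.2 - q.2) = q'.2 by omega,
      show q'.2 - q.2 + (q''.2 - q'.2) = q''.2 - q.2 by omega] at this
  rw [coe_trans, coe_trans, coe_trans, mul_assoc, e]

/-- The (charge-zero) infinite wedge: the direct limit of the spaces `⋀^p V_{n,p}`. -/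
abbrev InfiniteWedge : Type u :=
  Module.DirectLimit (fun q : ℕ × ℕ => Stage K q) (trans K)

/-- The canonical map from `⋀^p V_{n,p}` to the infinite wedge, with `q = (n, p)`. -/
def toWedge (q : ℕ × ℕ) : Stage K q →ₗ[K] InfiniteWedge K :=
  Module.DirectLimit.of K (ℕ × ℕ) (fun q : ℕ × ℕ => Stage K q) (trans K) q

theorem toWedge_trans (q q' : ℕ × ℕ) (h : q ≤ q') (w : Stage K q) :
    toWedge K q' (trans K q q' h w) = toWedge K q w :=
  Module.DirectLimit.of_f

/-- The group `G_{n,p} = GL(V_{n,p})`, with `q = (n, p)`, embedded in `GL(V_∞)` by fixing the basis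
vectors that do not lie in `V_{n,p}`. -/
def GSub (q : ℕ × ℕ) : Subgroup (VInf K ≃ₗ[K] VInf K) where
  carrier := {g | (VSub K q).map (g : VInf K →ₗ[K] VInf K) = VSub K q ∧
    ∀ i ∉ range q, g (basisVec K i) = basisVec K i}
  one_mem' := ⟨Submodule.map_id _, fun _ _ => rfl⟩
  mul_mem' := by
    rintro a b ⟨ha, ha'⟩ ⟨hb, hb'⟩
    refine ⟨?_, fun i hi => ?_⟩
    · have : ((a * b : VInf K ≃ₗ[K] VInf K) : VInf K →ₗ[K] VInf K)
          = (a : VInf K →ₗ[K] VInf K) ∘ₗ (b : VInf K →ₗ[K] VInf K) := rfl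
      rw [this, Submodule.map_comp, hb, ha]
    · rw [LinearEquiv.mul_apply, hb' i hi, ha' i hi]
  inv_mem' := by
    rintro a ⟨ha, ha'⟩
    refine ⟨?_, fun i hi => ?_⟩
    · have : ((a⁻¹ : VInf K ≃ₗ[K] VInf K) : VInf K →ₗ[K] VInf K)
          ∘ₗ (a : VInf K →ₗ[K] VInf K) = LinearMap.id := by
        ext1 i
        exact LinearMap.ext fun c => a.symm_apply_apply _
      conv_lhs => rw [← ha]
      rw [← Submodule.map_comp, this, Submodule.map_id]
    · conv_lhs => rw [← ha' i hi]
      exact a.symm_apply_apply _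

theorem GSub_mono {q q' : ℕ × ℕ} (h : q ≤ q') : GSub K q ≤ GSub K q' := by
  rintro g ⟨hg, hg'⟩
  refine ⟨?_, fun i hi => hg' i fun hi' => hi (range_mono h hi')⟩
  have e : VSub K q' = VSub K q ⊔ Submodule.span K (basisVec K '' (range q' \ range q)) := by
    rw [VSub, VSub, ← Submodule.span_union, ← Set.image_union,
      Set.union_sdiff_cancel (range_mono h)]
  rw [e, Submodule.map_sup, hg, Submodule.map_span, Set.image_image]
  congr 2
  exact Set.image_congr fun i hi => hg' i hi.2

/-- The group `G_∞`, the union of the groups `G_{n,p} = GL(V_{n,p})`. -/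
def GInf : Subgroup (VInf K ≃ₗ[K] VInf K) where
  carrier := {g | ∃ q, g ∈ GSub K q}
  one_mem' := ⟨0, one_mem _⟩
  mul_mem' := by
    rintro a b ⟨q, ha⟩ ⟨q', hb⟩
    exact ⟨q ⊔ q', mul_mem (GSub_mono K le_sup_left ha) (GSub_mono K le_sup_right hb)⟩
  inv_mem' := by
    rintro a ⟨q, ha⟩
    exact ⟨q, inv_mem ha⟩

/-- The linear endomorphism of the exterior algebra of `V_∞` induced by `g`. -/
def extMap (g : VInf K ≃ₗ[K] VInf K) : ExteriorAlgebra K (VInf K) →ₐ[K] ExteriorAlgebra K (VInf K) :=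
  ExteriorAlgebra.map (g : VInf K →ₗ[K] VInf K)

theorem extMap_one (w : ExteriorAlgebra K (VInf K)) : extMap K 1 w = w := by
  have : extMap K 1 = AlgHom.id K _ := ExteriorAlgebra.map_id
  rw [this]; rfl

theorem extMap_mul (g h : VInf K ≃ₗ[K] VInf K) (w : ExteriorAlgebra K (VInf K)) :
    extMap K (g * h) w = extMap K g (extMap K h w) := by
  have : extMap K (g * h) = (extMap K g).comp (extMap K h) :=
    (ExteriorAlgebra.map_comp_map _ _).symm
  rw [this]; rfl

theorem extMap_mem {q : ℕ × ℕ} {g : VInf K ≃ₗ[K] VInf K} (hg : g ∈ GSub K q)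
    {w : ExteriorAlgebra K (VInf K)} (hw : w ∈ Stage K q) : extMap K g w ∈ Stage K q := by
  have e : Submodule.map (extMap K g).toLinearMap (Stage K q) = Stage K q := by
    rw [Stage, Submodule.map_pow, ← Submodule.map_comp, extMap, ExteriorAlgebra.map_comp_ι,
      Submodule.map_comp, hg.1]
  rw [← e]
  exact Submodule.mem_map_of_mem hw

theorem extMap_tail {q : ℕ × ℕ} {g : VInf K ≃ₗ[K] VInf K} (hg : g ∈ GSub K q) (a m : ℕ)
    (ha : q.2 ≤ a) : extMap K g (tail K a m) = tail K a m := by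
  rw [tail, map_list_prod, List.map_map]
  congr 1
  refine List.map_congr_left fun k hk => ?_
  rw [List.mem_range'_1] at hk
  have hi : posIdx k ∉ range q := by
    rintro ⟨_, h2⟩
    simp only [posIdx] at h2
    omega
  have := hg.2 _ hi
  simp only [Function.comp_apply, x, extMap, ExteriorAlgebra.map_apply_ι]
  exact congrArg _ this

/-- The action of `g ∈ G_{n,p}` on `⋀^p V_{n,p}`, i.e. the `p`-th exterior power of `g`. -/
def actStage (q : ℕ × ℕ) (g : VInf K ≃ₗ[K] VInf K) (hg : g ∈ GSub K q) :
    Stage K q →ₗ[K] Stage K q :=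
  (extMap K g).toLinearMap.restrict fun _ hw => extMap_mem K hg hw

theorem actStage_trans (q q' : ℕ × ℕ) (h : q ≤ q') (g : VInf K ≃ₗ[K] VInf K) (hg : g ∈ GSub K q)
    (w : Stage K q) : actStage K q' g (GSub_mono K h hg) (trans K q q' h w)
      = trans K q q' h (actStage K q g hg w) := by
  apply Subtype.ext
  change extMap K g (w * tail K q.2 (q'.2 - q.2)) = extMap K g w * tail K q.2 (q'.2 - q.2)
  rw [map_mul, extMap_tail K hg _ _ le_rfl]

/-- To act with `g` on `w ∈ ⋀^p V_{n,p}`, see both at a common level `Q` and act there. -/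
def actAt (q Q : ℕ × ℕ) (h : q ≤ Q) (g : VInf K ≃ₗ[K] VInf K) (hg : g ∈ GSub K Q) :
    Stage K q →ₗ[K] InfiniteWedge K :=
  toWedge K Q ∘ₗ actStage K Q g hg ∘ₗ trans K q Q h

theorem actAt_eq (q Q Q' : ℕ × ℕ) (h : q ≤ Q) (h' : q ≤ Q') (g : VInf K ≃ₗ[K] VInf K)
    (hg : g ∈ GSub K Q) (hg' : g ∈ GSub K Q') (w : Stage K q) :
    actAt K q Q h g hg w = actAt K q Q' h' g hg' w := by
  have key : ∀ (P P' : ℕ × ℕ) (hP : q ≤ P) (hPP : P ≤ P') (h1 : g ∈ GSub K P),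
      actAt K q P' (hP.trans hPP) g (GSub_mono K hPP h1) w = actAt K q P hP g h1 w := by
    intro P P' hP hPP h1
    change toWedge K P' (actStage K P' g (GSub_mono K hPP h1) (trans K q P' _ w))
      = toWedge K P (actStage K P g h1 (trans K q P hP w))
    rw [← trans_trans K q P P' hP hPP, actStage_trans K P P' hPP g h1, toWedge_trans]
  rw [← key Q (Q ⊔ Q') h le_sup_left hg, ← key Q' (Q ⊔ Q') h' le_sup_right hg']

/-- A level at which the element `g` of `G_∞` lives. -/
def level (g : GInf K) : ℕ × ℕ := Classical.choose g.2

theorem level_spec (g : GInf K) : (g : VInf K ≃ₗ[K] VInf K) ∈ GSub K (level K g) :=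
  Classical.choose_spec g.2

/-- The action of `g ∈ G_∞` on the infinite wedge. -/
def actWedge (g : GInf K) : InfiniteWedge K →ₗ[K] InfiniteWedge K :=
  Module.DirectLimit.lift K (ℕ × ℕ) (fun q : ℕ × ℕ => Stage K q) (trans K)
    (fun q => actAt K q (q ⊔ level K g) le_sup_left g
      (GSub_mono K le_sup_right (level_spec K g)))
    (by
      intro q q' h w
      have e : actAt K q (q' ⊔ level K g) (h.trans le_sup_left) g
          (GSub_mono K le_sup_right (level_spec K g)) w
          = actAt K q' (q' ⊔ level K g) le_sup_left g
          (GSub_mono K le_sup_right (level_spec K g)) (trans K q q' h w) := by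
        simp only [actAt, LinearMap.comp_apply, trans_trans]
      rw [← e]
      exact actAt_eq K _ _ _ _ _ _ _ _ _)

/-- On `⋀^p V_{n,p}`, an element of `G_{n,p} = GL(V_{n,p})` acts by its `p`-th exterior power. -/
theorem actWedge_toWedge (g : GInf K) (q : ℕ × ℕ) (hg : (g : VInf K ≃ₗ[K] VInf K) ∈ GSub K q)
    (w : Stage K q) : actWedge K g (toWedge K q w) = toWedge K q (actStage K q g hg w) := by
  have h1 : actWedge K g (toWedge K q w) = actAt K q (q ⊔ level K g) le_sup_left g
      (GSub_mono K le_sup_right (level_spec K g)) w := Module.DirectLimit.lift_of _ _ _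
  rw [h1, actAt_eq K q (q ⊔ level K g) q le_sup_left le_rfl g _ hg]
  change toWedge K q (actStage K q g hg (trans K q q le_rfl w)) = _
  congr 2
  apply Subtype.ext
  rw [coe_trans]
  simp [tail]

theorem exists_toWedge (Q : ℕ × ℕ) (z : InfiniteWedge K) :
    ∃ q, Q ≤ q ∧ ∃ w : Stage K q, z = toWedge K q w := by
  obtain ⟨q, w, rfl⟩ := Module.DirectLimit.exists_of z
  exact ⟨q ⊔ Q, le_sup_right, trans K q (q ⊔ Q) le_sup_left w, (toWedge_trans K _ _ _ w).symm⟩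

theorem actWedge_one (z : InfiniteWedge K) : actWedge K 1 z = z := by
  obtain ⟨q, -, w, rfl⟩ := exists_toWedge K 0 z
  rw [actWedge_toWedge K 1 q (one_mem _)]
  congr 1
  exact Subtype.ext (extMap_one K _)

theorem actWedge_mul (g h : GInf K) (z : InfiniteWedge K) :
    actWedge K (g * h) z = actWedge K g (actWedge K h z) := by
  obtain ⟨q, hq, w, rfl⟩ := exists_toWedge K (level K g ⊔ level K h) z
  have hg := GSub_mono K (le_sup_left.trans hq) (level_spec K g)
  have hh := GSub_mono K (le_sup_right.trans hq) (level_spec K h)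
  rw [actWedge_toWedge K h q hh, actWedge_toWedge K g q hg,
    actWedge_toWedge K (g * h) q (mul_mem hg hh)]
  congr 1
  exact Subtype.ext (extMap_mul K _ _ _)

/-- The dual infinite wedge: the full algebraic dual of the infinite wedge. -/
def DualWedge : Type u := Module.Dual K (InfiniteWedge K)

/-- `G_∞` acts on the dual infinite wedge by the contragredient action
`(g • ω)(z) = ω(g⁻¹ z)`. -/
instance : MulAction (GInf K) (DualWedge K) where
  smul g ω := LinearMap.comp (show InfiniteWedge K →ₗ[K] K from ω) (actWedge K g⁻¹)
  one_smul ω := by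
    refine LinearMap.ext fun z => ?_
    change (show InfiniteWedge K →ₗ[K] K from ω) (actWedge K 1⁻¹ z) = _
    rw [inv_one, actWedge_one]
  mul_smul g h ω := by
    refine LinearMap.ext fun z => ?_
    change (show InfiniteWedge K →ₗ[K] K from ω) (actWedge K (g * h)⁻¹ z)
      = (show InfiniteWedge K →ₗ[K] K from ω) (actWedge K h⁻¹ (actWedge K g⁻¹ z))
    rw [mul_inv_rev, actWedge_mul]

/-- The coordinate ring of the dual infinite wedge: the symmetric algebra on the infinite wedge,
that is, the polynomial ring in the standard basis vectors `x_I` of the infinite wedge. -/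
abbrev CoordRing : Type u := SymmetricAlgebra K (InfiniteWedge K)

/-- The value of the polynomial `f` at the point `ω` of the dual infinite wedge. -/
def eval (f : CoordRing K) (ω : DualWedge K) : K :=
  SymmetricAlgebra.lift (show InfiniteWedge K →ₗ[K] K from ω) f

/-- The common zero set of a set of polynomials on the dual infinite wedge. -/
def zeroLocus (S : Set (CoordRing K)) : Set (DualWedge K) := {ω | ∀ f ∈ S, eval K f ω = 0}

/-- The Zariski topology on the dual infinite wedge: the closed sets are the common zero sets of
collections of polynomials. -/
instance : TopologicalSpace (DualWedge K) :=
  TopologicalSpace.ofClosed (Set.range (zeroLocus K))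
    ⟨{1}, by ext ω; simp [zeroLocus, eval]⟩
    (by
      intro A hA
      refine ⟨{f | ∀ ω ∈ ⋂₀ A, eval K f ω = 0}, ?_⟩
      ext ω
      constructor
      · intro h Z hZ
        obtain ⟨S, rfl⟩ := hA hZ
        exact fun f hf => h f fun ω' h' => h' _ hZ f hf
      · exact fun h f hf => hf ω h)
    (by
      rintro _ ⟨S, rfl⟩ _ ⟨T, rfl⟩
      refine ⟨{h | ∃ f ∈ S, ∃ g ∈ T, h = f * g}, ?_⟩
      ext ω
      constructor
      · intro h
        by_contra hn
        simp only [Set.mem_union, not_or, zeroLocus, Set.mem_ofPred_eq, not_forall] at hn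
        obtain ⟨⟨f, hf, hf'⟩, g, hg, hg'⟩ := hn
        have := h _ ⟨f, hf, g, hg, rfl⟩
        rw [eval, map_mul] at this
        exact (mul_ne_zero hf' hg') this
      · rintro (h | h) _ ⟨f, hf, g, hg, rfl⟩
        · have := h f hf
          rw [eval] at this ⊢
          rw [map_mul, this, zero_mul]
        · have := h g hg
          rw [eval] at this ⊢
          rw [map_mul, this, mul_zero])

theorem isClosed_iff (Z : Set (DualWedge K)) : IsClosed Z ↔ ∃ S, Z = zeroLocus K S := by
  rw [← isOpen_compl_iff]
  change Zᶜᶜ ∈ Set.range (zeroLocus K) ↔ _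
  rw [compl_compl]
  exact exists_congr fun S => eq_comm

/-- `G_∞` acts on the dual infinite wedge by homeomorphisms. -/
instance : ContinuousConstSMul (GInf K) (DualWedge K) where
  continuous_const_smul g := by
    refine continuous_iff_isClosed.2 fun Z hZ => ?_
    obtain ⟨S, rfl⟩ := (isClosed_iff K Z).1 hZ
    let φ : CoordRing K →ₐ[K] CoordRing K :=
      SymmetricAlgebra.lift (SymmetricAlgebra.ι K (InfiniteWedge K) ∘ₗ actWedge K g⁻¹)
    have hφ : ∀ f ω, eval K f (g • ω) = eval K (φ f) ω := by
      intro f ω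
      have : SymmetricAlgebra.lift (show InfiniteWedge K →ₗ[K] K from g • ω)
          = (SymmetricAlgebra.lift (show InfiniteWedge K →ₗ[K] K from ω)).comp φ := by
        refine SymmetricAlgebra.algHom_ext (LinearMap.ext fun z => ?_)
        change SymmetricAlgebra.lift _ (SymmetricAlgebra.ι K _ z) =
          SymmetricAlgebra.lift _ (SymmetricAlgebra.lift _ (SymmetricAlgebra.ι K _ z))
        rw [SymmetricAlgebra.lift_ι_apply, SymmetricAlgebra.lift_ι_apply, LinearMap.comp_apply,
          SymmetricAlgebra.lift_ι_apply]
        rfl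
      rw [eval, this]
      rfl
    refine (isClosed_iff K _).2 ⟨φ '' S, ?_⟩
    ext ω
    simp [zeroLocus, hφ]

variable {K}

/-- The Pfaffian of a skew-symmetric matrix of size `2 m`, in its division-free form: the signed
sum over all perfect matchings `{σ 0, σ 1}, {σ 2, σ 3}, …` of the index set, each of them written
once, with `σ (2 i) < σ (2 i + 1)` and `σ 0 < σ 2 < σ 4 < ⋯`. -/
def pfaffian {R : Type u} [CommRing R] (m : ℕ) (A : Matrix (Fin (2 * m)) (Fin (2 * m)) R) : R :=
  ∑ σ : Equiv.Perm (Fin (2 * m)) with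
      (∀ i : Fin m, σ ⟨2 * i, by omega⟩ < σ ⟨2 * i + 1, by omega⟩) ∧
      (∀ i j : Fin m, i < j → σ ⟨2 * i, by omega⟩ < σ ⟨2 * j, by omega⟩),
    ((Equiv.Perm.sign σ : ℤˣ) : ℤ) •
      ∏ i : Fin m, A (σ ⟨2 * i, by omega⟩) (σ ⟨2 * i + 1, by omega⟩)

/-- The increasing enumeration `-n, …, -1, 1, 2, …` of the indices that are at least `-n`. -/
def enum (n : ℕ) (a : ℕ) : Idx :=
  if h : a < n then ⟨(a : ℤ) - n, by omega⟩ else ⟨(a : ℤ) - n + 1, by omega⟩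

theorem enum_mem (n p a : ℕ) (h : a < n + p) : enum n a ∈ range (n, p) := by
  unfold enum
  split_ifs <;> constructor <;> simp only <;> omega

variable (K)

/-- The coordinate `x_a ∧ x_b` in `⋀^2 V_{n,2}`, where `a`, `b` are positions in the list
`-n, …, -1, 1, 2`. -/
def pairElt (n : ℕ) (a b : Fin (n + 2)) : Stage K (n, 2) :=
  ⟨x K (enum n a) * x K (enum n b), by
    have := list_prod_mem K (n, 2) [enum n a, enum n b] (by
      intro i hi
      simp only [List.mem_cons, List.not_mem_nil, or_false] at hi
      rcases hi with rfl | rfl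
      exacts [enum_mem _ _ _ a.2, enum_mem _ _ _ b.2])
    simpa [Stage] using this⟩

/-- The polynomial `Pf_{r+1}` on the dual infinite wedge: the Pfaffian of the matrix
`(x_i ∧ x_j)` with `i, j ∈ {-2r, …, -1, 1, 2}`. -/
def Pf (r : ℕ) : CoordRing K :=
  pfaffian (r + 1) fun a b =>
    SymmetricAlgebra.ι K (InfiniteWedge K) (toWedge K (2 * r, 2) (pairElt K (2 * r) a b))

/-- The list of all positions in `-2, -1, 1, …, p` other than `a` and `b`, increasingly. -/
def complList (p : ℕ) (a b : Fin (p + 2)) : List (Fin (p + 2)) :=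
  (List.finRange (p + 2)).filter fun c => c ≠ a ∧ c ≠ b

theorem length_complList (p : ℕ) (a b : Fin (p + 2)) (h : a ≠ b) :
    (complList p a b).length = p := by
  have hn : (complList p a b).Nodup := (List.nodup_finRange _).filter _
  rw [← List.toFinset_card_of_nodup hn]
  have : (complList p a b).toFinset = (Finset.univ \ {a, b} : Finset (Fin (p + 2))) := by
    ext c
    simp [complList]
  rw [this, Finset.card_sdiff_of_subset (Finset.subset_univ _), Finset.card_pair h]
  simp

/-- The basis vector `x_J` of `⋀^p V_{2,p}`, where `J` is obtained from `{-2, -1, 1, …, p}` by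
removing the elements at the distinct positions `a` and `b`. -/
def complElt (p : ℕ) (a b : Fin (p + 2)) (h : a ≠ b) : Stage K (2, p) :=
  ⟨((complList p a b).map fun c : Fin (p + 2) => x K (enum 2 c)).prod, by
    have := list_prod_mem K (2, p) ((complList p a b).map fun c : Fin (p + 2) => enum 2 c) (by
      intro i hi
      obtain ⟨c, -, rfl⟩ := List.mem_map.1 hi
      exact enum_mem _ _ _ (by omega))
    rw [List.length_map, length_complList p a b h, List.map_map] at this
    exact this⟩

/-- The entry `(a, b)` of the skew-symmetric matrix of linear functions on `⋀^p V_{2,p}^*`, with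
`p` even, that gives the coordinates of the Hodge dual: `0` if `a = b`, and otherwise `± x_J` with
`J` the complement of `a` and `b`, where the sign is such that the entry satisfies
`(entry a b) ∧ x_a ∧ x_b = x_{-2} ∧ x_{-1} ∧ x_1 ∧ ⋯ ∧ x_p`. -/
def hodgeEntry (p : ℕ) (a b : Fin (p + 2)) : Stage K (2, p) :=
  if h : a = b then 0
  else (if a < b then (-1 : K) ^ ((a : ℕ) + b + 1) else (-1 : K) ^ ((a : ℕ) + b)) •
    complElt K p a b h

/-- The dual Pfaffian `Pf*_{s+1}` on the dual infinite wedge: the pullback of the Pfaffian on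
`⋀^2 V_{2s,2}^*` to `⋀^{2s} V_{2,2s}^*` under a Hodge dual. -/
def PfDual (s : ℕ) : CoordRing K :=
  pfaffian (s + 1) fun a b =>
    SymmetricAlgebra.ι K (InfiniteWedge K) (toWedge K (2, 2 * s) (hodgeEntry K (2 * s) a b))

/-- The Pfaffian variety `Y_∞^{r,s}`: the points at which all polynomials in the `G_∞`-orbits of
`Pf_{r+1}` and `Pf*_{s+1}` vanish, together with the action of `G_∞` on it. It carries the topology
induced by the Zariski topology of the dual infinite wedge. -/
def pfaffianVariety (r s : ℕ) : SubMulAction (GInf K) (DualWedge K) where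
  carrier := {ω | ∀ g : GInf K, eval K (Pf K r) (g • ω) = 0 ∧ eval K (PfDual K s) (g • ω) = 0}
  smul_mem' := by
    intro h ω hω g
    rw [← mul_smul]
    exact hω (g * h)

instance (r s : ℕ) : ContinuousConstSMul (GInf K) (pfaffianVariety K r s) where
  continuous_const_smul g :=
    Continuous.subtype_mk ((continuous_const_smul g).comp continuous_subtype_val) _

/-- A topological space `X` on which a group `G` acts by homeomorphisms is `G`-Noetherian if every
descending chain of closed, `G`-stable subsets stabilises. -/
def IsEquivariantlyNoetherian (G : Type*) (X : Type*) [Group G] [TopologicalSpace X]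
    [MulAction G X] [ContinuousConstSMul G X] : Prop :=
  ∀ Z : ℕ → Set X, Antitone Z → (∀ k, IsClosed (Z k)) → (∀ k, ∀ g : G, ∀ y ∈ Z k, g • y ∈ Z k) →
    ∃ N, ∀ k, N ≤ k → Z k = Z N

end InfWedge

end

/-! The proof is a double induction on `r` and `s`. If `r = 0` or `s = 0`, a Pfaffian of a `2 × 2`
matrix is a single coordinate, and its orbit forces all coordinates to vanish, so the variety has at
most one point. In the inductive step, `Y^{r+1,s+1}` is covered by `Y^{r,s+1}`, `Y^{r+1,s}` and the
points with a translate in `chart K r s`, where `Pf K r` and `PfDual K s` are both nonzero. One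
translate serves both Pfaffians, because the group elements along a line are dense in it and a
nonzero polynomial over an infinite field has only finitely many zeros (`exists_common_translate`).
Noetherianity passes to unions and to saturations under the group, so only the chart matters
(`noethOn_chart`).

On the chart, expanding the vanishing larger Pfaffian along its last entry expresses that entry
times the invertible smaller Pfaffian through the other entries. With the two last vectors taken to
be two distant negative basis vectors, this removes coordinates that contain two of them
(`mem_of_distantNeg`); the dual Pfaffian removes coordinates that omit two distant positive indices
(`mem_of_distantGaps`). Since the remaining factors of a wedge product cannot be chosen freely in
the standard Pfaffian, the relation is used along lines, and coefficients are compared by induction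
over subsets (`mem_of_pfaffian_relations`). Hence all coordinates are fractions of those with at
most one distant negative index and at most one distant gap (`coordOn_mem`). These form finitely
many infinite matrices, rows, columns and constants (`nearTuple`), on which transvections between
distant indices act by elementary row and column operations.

It remains to see that such tuples are Noetherian up to row and column operations
(`noethOn_tupleClosed`). By a limit argument, closed sets stable under elementary operations are
stable under arbitrary pairs of endomorphisms (`tupleClosed_of_elementary`). If the rows or the
columns are dependent, or if a nontrivial combination of the matrices has bounded rank, the tuple
comes from a smaller type: in the last case one matrix is traded for finitely many rows, columns and
constants. Otherwise the tuple can be specialised to any prescribed finite blocks with the same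
constants (`exists_specialization`, which rests on a theorem on locally linearly dependent
operators), so membership in the closed sets is decided by the constants, and Hilbert's basis
theorem applies (`chain_generic_stabilises`). -/

noncomputable section

namespace InfWedge

/-! ### Closed sets cut out by an algebra of functions -/

section Closed

variable {K : Type*} [Field K] {X Y : Type*}

/-- A set is closed with respect to an algebra of functions if it is a common zero set. -/
def IsZClosed (O : Subalgebra K (X → K)) (C : Set X) : Prop :=
  ∀ x ∉ C, ∃ f ∈ O, (∀ y ∈ C, f y = 0) ∧ f x ≠ 0

theorem IsZClosed.iInter {O : Subalgebra K (X → K)} {ι : Sort*} {C : ι → Set X}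
    (h : ∀ i, IsZClosed O (C i)) : IsZClosed O (⋂ i, C i) := by
  intro x hx
  simp only [Set.mem_iInter, not_forall] at hx
  obtain ⟨i, hi⟩ := hx
  obtain ⟨f, hf, h0, h1⟩ := h i x hi
  exact ⟨f, hf, fun y hy => h0 y (Set.mem_iInter.1 hy i), h1⟩

theorem IsZClosed.preimage {O : Subalgebra K (X → K)} {O' : Subalgebra K (Y → K)} {C : Set Y}
    (h : IsZClosed O' C) (φ : X → Y) (hφ : ∀ f ∈ O', f ∘ φ ∈ O) : IsZClosed O (φ ⁻¹' C) := by
  intro x hx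
  obtain ⟨f, hf, h0, h1⟩ := h (φ x) hx
  exact ⟨f ∘ φ, hφ f hf, fun y hy => h0 _ hy, h1⟩

theorem comp_mem_of_adjoin {S : Set (Y → K)} {O : Subalgebra K (X → K)} (φ : X → Y)
    (h : ∀ f ∈ S, f ∘ φ ∈ O) : ∀ f ∈ Algebra.adjoin K S, f ∘ φ ∈ O := by
  intro f hf
  induction hf using Algebra.adjoin_induction with
  | mem f hf => exact h f hf
  | algebraMap r => exact O.algebraMap_mem r
  | add f g _ _ hf hg => exact O.add_mem hf hg
  | mul f g _ _ hf hg => exact O.mul_mem hf hg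

/-- The traces on `S` of the sets satisfying `CC` satisfy the descending chain condition. -/
def NoethOn (CC : Set X → Prop) (S : Set X) : Prop :=
  ∀ Z : ℕ → Set X, Antitone Z → (∀ k, CC (Z k)) → ∃ N, ∀ k, N ≤ k → Z k ∩ S = Z N ∩ S

theorem NoethOn.mono {CC : Set X → Prop} {S T : Set X} (h : NoethOn CC T) (hST : S ⊆ T) :
    NoethOn CC S := by
  intro Z hZ hC
  obtain ⟨N, hN⟩ := h Z hZ hC
  refine ⟨N, fun k hk => ?_⟩
  rw [← Set.inter_eq_self_of_subset_right hST, ← Set.inter_assoc, ← Set.inter_assoc, hN k hk]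

theorem NoethOn.empty {CC : Set X → Prop} : NoethOn CC ∅ :=
  fun _ _ _ => ⟨0, fun _ _ => by simp⟩

theorem NoethOn.union {CC : Set X → Prop} {S T : Set X} (hS : NoethOn CC S) (hT : NoethOn CC T) :
    NoethOn CC (S ∪ T) := by
  intro Z hZ hC
  obtain ⟨N, hN⟩ := hS Z hZ hC
  obtain ⟨N', hN'⟩ := hT Z hZ hC
  refine ⟨max N N', fun k hk => ?_⟩
  rw [Set.inter_union_distrib_left, Set.inter_union_distrib_left,
    hN k (le_trans (le_max_left _ _) hk), hN' k (le_trans (le_max_right _ _) hk),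
    hN _ (le_max_left _ _), hN' _ (le_max_right _ _)]

theorem NoethOn.iUnion {CC : Set X → Prop} {ι : Type*} [Finite ι] {S : ι → Set X}
    (hS : ∀ i, NoethOn CC (S i)) : NoethOn CC (⋃ i, S i) := by
  intro Z hZ hC
  choose N hN using fun i => hS i Z hZ hC
  obtain ⟨B, hB⟩ := (Set.finite_range N).bddAbove
  have hB' : ∀ i, N i ≤ B := fun i => hB ⟨i, rfl⟩
  refine ⟨B, fun k hk => ?_⟩
  rw [Set.inter_iUnion, Set.inter_iUnion]
  exact Set.iUnion_congr fun i => by rw [hN i k ((hB' i).trans hk), hN i B (hB' i)]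

/-- The sets `C'` attached to the members of a chain need not form a chain. Intersecting the first
`k` of them restores monotonicity without changing the trace on `T`. -/
theorem NoethOn.of_map {CX : Set X → Prop} {CY : Set Y → Prop} {S : Set X} {T : Set Y}
    (h : NoethOn CX S) (hCX : ∀ s : ℕ → Set X, (∀ i, CX (s i)) → CX (⋂ i, s i))
    (ρ : Y → X) (hρ : ∀ y ∈ T, ρ y ∈ S)
    (hC : ∀ C, CY C → ∃ C', CX C' ∧ ∀ y ∈ T, (y ∈ C ↔ ρ y ∈ C')) : NoethOn CY T := by
  intro Z hZ hCZ
  choose D hD hD' using fun k => hC (Z k) (hCZ k)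
  obtain ⟨N, hN⟩ := h (fun k => ⋂ i, D (min i k))
    (fun k l hkl x hx => by
      simp only [Set.mem_iInter] at hx ⊢
      intro i
      have := hx (min i k)
      rwa [min_assoc, min_eq_left hkl] at this)
    (fun k => hCX _ fun i => hD _)
  have key : ∀ k, ∀ y ∈ T, (y ∈ Z k ↔ ρ y ∈ ⋂ i, D (min i k)) := by
    intro k y hy
    rw [Set.mem_iInter]
    constructor
    · intro h i
      exact (hD' _ y hy).1 (hZ (min_le_right i k) h)
    · intro h
      have := h k
      rw [min_self] at this
      exact (hD' _ y hy).2 this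
  refine ⟨N, fun k hk => Set.ext fun y => ?_⟩
  simp only [Set.mem_inter_iff]
  refine and_congr_left fun hy => ?_
  rw [key k y hy, key N y hy]
  have := Set.ext_iff.1 (hN k hk) (ρ y)
  simp only [Set.mem_inter_iff, hρ y hy, and_true] at this
  exact this

/-- The image of a Noetherian set. -/
theorem NoethOn.image {CX : Set X → Prop} {CY : Set Y → Prop} {S : Set X}
    (h : NoethOn CX S) (hCX : ∀ s : ℕ → Set X, (∀ i, CX (s i)) → CX (⋂ i, s i))
    (φ : X → Y) (hφ : ∀ C, CY C → CX (φ ⁻¹' C)) : NoethOn CY (φ '' S) := by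
  classical
  have hc : ∀ y : φ '' S, ∃ x ∈ S, φ x = y := fun y => y.2
  choose g hg hg' using hc
  by_cases hS : Nonempty X
  · refine h.of_map hCX (fun y => if hy : y ∈ φ '' S then g ⟨y, hy⟩ else hS.some)
      (fun y hy => by simpa only [dif_pos hy] using hg ⟨y, hy⟩) fun C hC => ⟨_, hφ C hC, ?_⟩
    intro y hy
    simp only [dif_pos hy, Set.mem_preimage, hg' ⟨y, hy⟩]
  · have : φ '' S = ∅ := by
      rw [not_nonempty_iff] at hS
      simp [Set.eq_empty_of_isEmpty S]
    rw [this]; exact NoethOn.empty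

/-- Hilbert's basis theorem. -/
theorem noethOn_of_isNoetherianRing (O : Subalgebra K (X → K)) [IsNoetherianRing O] (S : Set X) :
    NoethOn (IsZClosed O) S := by
  suffices h : NoethOn (IsZClosed O) Set.univ from h.mono (Set.subset_univ _)
  intro Z hZ hC
  -- The vanishing ideals of the members of the chain.
  let I : ℕ →o Ideal O :=
    { toFun := fun k =>
        { carrier := {f | ∀ x ∈ Z k, f.1 x = 0}
          zero_mem' := fun _ _ => rfl
          add_mem' := fun {f g} hf hg x hx => by
            simp only [Subalgebra.coe_add, Pi.add_apply, hf x hx, hg x hx, add_zero]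
          smul_mem' := fun c f hf x hx => by
            simp only [smul_eq_mul, Subalgebra.coe_mul, Pi.mul_apply, hf x hx, mul_zero] }
      monotone' := fun k l hkl f hf x hx => hf x (hZ hkl hx) }
  obtain ⟨N, hN⟩ := monotone_stabilizes_iff_noetherian.2 (inferInstance : IsNoetherian O O) I
  refine ⟨N, fun k hk => ?_⟩
  rw [Set.inter_univ, Set.inter_univ]
  refine Set.Subset.antisymm (hZ hk) fun x hx => ?_
  by_contra hx'
  obtain ⟨f, hf, h0, h1⟩ := hC k x hx'
  have hfI : (⟨f, hf⟩ : O) ∈ I k := h0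
  rw [← hN k hk] at hfI
  exact h1 (hfI x hx)

instance isNoetherianRing_adjoin_finite {S : Set (X → K)} [hS : Finite S] :
    IsNoetherianRing (Algebra.adjoin K S) := by
  have : (Algebra.adjoin K S).FG := Subalgebra.fg_def.2 ⟨S, hS, rfl⟩
  have := Subalgebra.fg_iff_finiteType _ |>.1 this
  exact Algebra.FiniteType.isNoetherianRing K _

end Closed

/-! ### Linear algebra over an infinite field -/

section LinAlg

variable {K : Type*} [Field K] {V W : Type*} [AddCommGroup V] [Module K V] [AddCommGroup W]
  [Module K W]

/-- If `1 + t N` has a kernel, then `-t⁻¹` is an eigenvalue of `N`, and there are only finitely many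
of these. -/
theorem finite_not_injective_one_add_smul [FiniteDimensional K V] (N : V →ₗ[K] V) :
    {t : K | ¬ Function.Injective (1 + t • N : V →ₗ[K] V)}.Finite := by
  have h := (Module.End.finite_hasEigenvalue N).image (fun μ => -μ⁻¹)
  refine h.subset ?_
  intro t ht
  simp only [Set.mem_ofPred_eq] at ht
  rw [← LinearMap.ker_eq_bot, Submodule.eq_bot_iff] at ht
  push Not at ht
  obtain ⟨v, hv, hv0⟩ := ht
  have hv : v + t • N v = 0 := by simpa using hv
  have ht0 : t ≠ 0 := by
    rintro rfl
    simp at hv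
    exact hv0 hv
  refine ⟨-t⁻¹, ?_, by simp⟩
  refine Module.End.hasEigenvalue_of_hasEigenvector (x := v) ⟨?_, hv0⟩
  rw [Module.End.mem_eigenspace_iff]
  have : t • N v = -v := by
    rw [eq_neg_iff_add_eq_zero, add_comm]; exact hv
  rw [neg_smul, ← smul_neg, ← this, smul_smul, inv_mul_cancel₀ ht0, one_smul]

theorem exists_ne_zero_notMem [Infinite K] {s : Set K} (hs : s.Finite) : ∃ t, t ≠ 0 ∧ t ∉ s := by
  obtain ⟨t, ht⟩ := (hs.insert 0).exists_notMem
  exact ⟨t, fun h => ht (by simp [h]), fun h => ht (by simp [h])⟩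

/-- Otherwise a nonzero functional on `ι → K` kills the image, and its coefficients form a linear
relation among the `f i`. -/
theorem surjective_pi_of_linearIndependent {ι : Type*} [Fintype ι] {f : ι → Module.Dual K V}
    (h : LinearIndependent K f) (c : ι → K) : ∃ v, ∀ i, f i v = c i := by
  classical
  by_contra hc
  have hn : c ∉ LinearMap.range (LinearMap.pi f) := by
    rintro ⟨v, hv⟩
    exact hc ⟨v, fun i => congrFun hv i⟩
  obtain ⟨g, hg, hg'⟩ := Submodule.exists_le_ker_of_notMem hn
  have hsum : ∀ x : ι → K, g x = ∑ i, x i * g (Pi.single i 1) := fun x => by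
    conv_lhs => rw [pi_eq_sum_univ' x]
    simp
  have : ∑ i, g (Pi.single i 1) • f i = 0 := by
    ext v
    have h1 : g (LinearMap.pi f v) = 0 := hg' ⟨v, rfl⟩
    rw [hsum] at h1
    simpa [mul_comm] using h1
  have h0 := Fintype.linearIndependent_iff.1 h _ this
  apply hg
  rw [hsum]
  simp [h0]

theorem exists_dual_family {ι : Type*} [Finite ι] {f : ι → V} (h : LinearIndependent K f) :
    ∃ l : ι → Module.Dual K V, ∀ i j, l i (f j) = Finsupp.single j (1 : K) i := by
  classical
  obtain ⟨g, hg⟩ := LinearMap.exists_extend (h.repr : Submodule.span K (Set.range f) →ₗ[K] (ι →₀ K))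
  refine ⟨fun i => Finsupp.lapply i ∘ₗ g, fun i j => ?_⟩
  have : g (f j) = h.repr ⟨f j, Submodule.subset_span ⟨j, rfl⟩⟩ :=
    LinearMap.congr_fun hg ⟨f j, Submodule.subset_span ⟨j, rfl⟩⟩
  simp only [LinearMap.comp_apply, this, Finsupp.lapply_apply]
  rw [h.repr_eq_single j _ rfl]

/-- Independence is an open condition. Applying a dual family `l` to a relation with coefficients
`a` gives `(1 + t G) a = 0` with `G i j = l i (g j)`, and `1 + t G` is injective for all but
finitely many `t`. -/
theorem exists_linearIndependent_add_smul [Infinite K] {ι : Type*} [Fintype ι] {f : ι → V}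
    (h : LinearIndependent K f) (g : ι → V) :
    ∃ t : K, t ≠ 0 ∧ LinearIndependent K (fun i => f i + t • g i) := by
  classical
  obtain ⟨l, hl⟩ := exists_dual_family h
  let G : (ι → K) →ₗ[K] (ι → K) := (Matrix.of fun i j => l i (g j)).mulVecLin
  obtain ⟨t, ht0, ht⟩ := exists_ne_zero_notMem (finite_not_injective_one_add_smul G)
  simp only [Set.mem_ofPred_eq, not_not] at ht
  refine ⟨t, ht0, Fintype.linearIndependent_iff.2 fun a ha => ?_⟩
  have : (1 + t • G) a = 0 := by
    ext i
    have h1 := congrArg (l i) ha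
    simp only [map_sum, map_smul, map_add, hl, map_zero, smul_eq_mul, mul_add,
      Finset.sum_add_distrib, Finsupp.single_apply] at h1
    simp only [mul_ite, mul_one, mul_zero, Finset.sum_ite_eq', Finset.mem_univ, if_true] at h1
    simp only [LinearMap.add_apply, Module.End.one_apply, LinearMap.smul_apply, Pi.add_apply,
      Pi.smul_apply, smul_eq_mul, Pi.zero_apply, G, Matrix.mulVecLin_apply, Matrix.mulVec,
      dotProduct, Matrix.of_apply, Finset.mul_sum]
    rw [← h1]
    congr 1
    exact Finset.sum_congr rfl fun j _ => by ring
  have h2 := ht (this.trans (map_zero (1 + t • G)).symm)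
  exact fun i => congrFun h2 i

/-- Locally linearly dependent operators: if `T_x y` (`x ∈ ι`) are dependent for all `y`, then a
nontrivial linear combination of the `T_x` has rank at most the number of operators. -/
theorem exists_combination_of_locally_dependent [Infinite K] {ι : Type*} [Fintype ι]
    (T : ι → V →ₗ[K] W) (hT : ∀ y, ¬ LinearIndependent K (fun x => T x y)) :
    ∃ c : ι → K, c ≠ 0 ∧ ∃ D : Submodule K W, FiniteDimensional K D ∧
      Module.finrank K D ≤ Fintype.card ι ∧ ∀ y, ∑ x, c x • T x y ∈ D := by
  classical
  -- Take a largest set `s` of operators that are independent at some vector `y0`. Adding a further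
  -- operator then produces a dependent family at every vector.
  let good : Finset ι → Prop := fun s => ∃ y, LinearIndependent K (fun x : s => T x y)
  obtain ⟨s, hs, hmax⟩ : ∃ s, good s ∧ ∀ s', good s' → s'.card ≤ s.card := by
    have hne : (Finset.univ.filter good).Nonempty :=
      ⟨∅, by
        simp only [Finset.mem_filter, Finset.mem_univ, true_and, good]
        exact ⟨0, linearIndependent_empty_type⟩⟩
    obtain ⟨s, hs, h⟩ := Finset.exists_max_image _ Finset.card hne
    exact ⟨s, (Finset.mem_filter.1 hs).2, fun s' hs' => h s' (by simp [hs'])⟩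
  obtain ⟨y0, hy0⟩ := hs
  obtain ⟨x0, hx0⟩ : ∃ x0, x0 ∉ s := by
    by_contra h
    push Not at h
    refine hT y0 ?_
    have := hy0.comp (fun x : ι => (⟨x, h x⟩ : s)) (fun a b hab => by simpa using hab)
    exact this
  let D : Submodule K W := Submodule.span K (Set.range fun x : s => T x y0)
  have hins : ∀ y, ¬ LinearIndependent K
      (fun o : Option s => Option.casesOn' o (T x0 y) (fun x => T x y)) := by
    intro y hy
    have hg : good (insert x0 s) := by
      refine ⟨y, ?_⟩
      have := hy.comp (fun x : (insert x0 s : Finset ι) =>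
        if h : x.1 ∈ s then some (⟨x.1, h⟩ : s) else none) (by
          rintro ⟨a, ha⟩ ⟨b, hb⟩ hab
          simp only [Finset.mem_insert] at ha hb
          by_cases h1 : a ∈ s <;> by_cases h2 : b ∈ s <;> simp [h1, h2] at hab ⊢
          · exact hab
          · rw [ha.resolve_right h1, hb.resolve_right h2])
      convert this using 1
      ext ⟨a, ha⟩
      by_cases h1 : a ∈ s
      · simp [h1]
      · simp only [Finset.mem_insert, h1, or_false] at ha
        simp [ha, hx0]
    have := hmax _ hg
    rw [Finset.card_insert_of_notMem hx0] at this
    omega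
  have hmem : T x0 y0 ∈ D := by
    by_contra h
    exact hins y0 (linearIndependent_option'.2 ⟨hy0, h⟩)
  obtain ⟨c, hc⟩ := (Submodule.mem_span_range_iff_exists_fun K).1 hmem
  -- The combination that vanishes at `y0`; its image turns out to lie in the span `D` of the `T x
  -- y0`.
  let N : V →ₗ[K] W := T x0 - ∑ x : s, c x • T x
  have hN0 : N y0 = 0 := by
    simp only [N, LinearMap.sub_apply, LinearMap.sum_apply, LinearMap.smul_apply, hc, sub_self]
  -- If `N z` were outside `D`, then it would be independent of the `T x (y0 + t z)` for some `t ≠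
  -- 0`. By maximality of `s`, `T x0 (y0 + t z)` lies in their span, hence so does `N (y0 + t z) = t
  -- N z`, a contradiction.
  have hN : ∀ z, N z ∈ D := by
    intro z
    by_contra hz
    have hli : LinearIndependent K
        (fun o : Option s => Option.casesOn' o (N z) (fun x => T x y0)) :=
      linearIndependent_option'.2 ⟨hy0, hz⟩
    obtain ⟨t, ht0, ht⟩ := exists_linearIndependent_add_smul hli
      (fun o : Option s => Option.casesOn' o 0 (fun x => T x z))
    have h1 := (linearIndependent_option' (v := fun x : s => T x (y0 + t • z)) (x := N z)).1 (by
      convert ht using 1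
      ext o
      cases o <;> simp)
    refine hins (y0 + t • z) (linearIndependent_option'.2 ⟨h1.1, fun hm => h1.2 ?_⟩)
    have h2 : N (y0 + t • z) ∈ Submodule.span K (Set.range fun x : s => T x (y0 + t • z)) := by
      simp only [N, LinearMap.sub_apply, LinearMap.sum_apply, LinearMap.smul_apply]
      exact Submodule.sub_mem _ hm (Submodule.sum_mem _ fun x _ =>
        Submodule.smul_mem _ _ (Submodule.subset_span ⟨x, rfl⟩))
    rw [map_add, hN0, zero_add, map_smul] at h2
    exact (Submodule.smul_mem_iff _ ht0).1 h2
  refine ⟨fun x => if h : x ∈ s then - c ⟨x, h⟩ else if x = x0 then 1 else 0, ?_, D,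
    FiniteDimensional.span_of_finite K (Set.finite_range _), ?_, ?_⟩
  · intro h
    have := congrFun h x0
    simp [hx0] at this
  · calc Module.finrank K D ≤ Fintype.card s := finrank_range_le_card _
      _ ≤ Fintype.card ι := by
        rw [Fintype.card_coe]; exact Finset.card_le_univ s
  · intro y
    convert hN y using 1
    have hsplit : ∑ x, (if h : x ∈ s then - c ⟨x, h⟩ else if x = x0 then 1 else 0) • T x y
        = ∑ x ∈ insert x0 s,
          (if h : x ∈ s then - c ⟨x, h⟩ else if x = x0 then 1 else 0) • T x y := by
      refine (Finset.sum_subset (Finset.subset_univ _) fun x _ hx => ?_).symm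
      simp only [Finset.mem_insert, not_or] at hx
      simp [hx.1, hx.2]
    rw [hsplit, Finset.sum_insert hx0, ← Finset.sum_coe_sort s]
    simp [hx0, N, sub_eq_add_neg, ← Finset.sum_neg_distrib]

end LinAlg

end InfWedge
end

noncomputable section

namespace InfWedge

/-! ### Tuples of infinite matrices -/

universe u

section Tuples

variable (K : Type u) [Field K]

/-- The countable-dimensional space. -/
abbrev Vec : Type u := ℕ →₀ K

/-- Tuples of bilinear forms, two kinds of linear forms, and constants. -/
abbrev TupleSpace (ι β α γ : Type) : Type u :=
  (ι → Vec K →ₗ[K] Vec K →ₗ[K] K) × (β → Module.Dual K (Vec K)) × (α → Module.Dual K (Vec K)) ×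
    (γ → K)

variable {K}

/-- The standard basis vectors. -/
def std (a : ℕ) : Vec K := Finsupp.single a 1

variable (K) in
/-- The matrix entries, as functions on tuples of matrices. -/
def tupleCoords (ι β α γ : Type) : Set (TupleSpace K ι β α γ → K) :=
  Set.range (fun (i : ι × ℕ × ℕ) m => m.1 i.1 (std i.2.1) (std i.2.2)) ∪
  Set.range (fun (i : β × ℕ) m => m.2.1 i.1 (std i.2)) ∪
  Set.range (fun (i : α × ℕ) m => m.2.2.1 i.1 (std i.2)) ∪
  Set.range (fun (i : γ) m => m.2.2.2 i)

variable (K) in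
/-- The polynomial functions on tuples of matrices. -/
def tuplePoly (ι β α γ : Type) : Subalgebra K (TupleSpace K ι β α γ → K) :=
  Algebra.adjoin K (tupleCoords K ι β α γ)

variable {ι β α γ : Type}

theorem coord_mat_mem (x : ι) (a b : ℕ) :
    (fun m : TupleSpace K ι β α γ => m.1 x (std a) (std b)) ∈ tuplePoly K ι β α γ :=
  Algebra.subset_adjoin (Or.inl (Or.inl (Or.inl ⟨(x, a, b), rfl⟩)))

theorem coord_row_mem (x : β) (a : ℕ) :
    (fun m : TupleSpace K ι β α γ => m.2.1 x (std a)) ∈ tuplePoly K ι β α γ :=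
  Algebra.subset_adjoin (Or.inl (Or.inl (Or.inr ⟨(x, a), rfl⟩)))

theorem coord_col_mem (x : α) (a : ℕ) :
    (fun m : TupleSpace K ι β α γ => m.2.2.1 x (std a)) ∈ tuplePoly K ι β α γ :=
  Algebra.subset_adjoin (Or.inl (Or.inr ⟨(x, a), rfl⟩))

theorem coord_const_mem (x : γ) :
    (fun m : TupleSpace K ι β α γ => m.2.2.2 x) ∈ tuplePoly K ι β α γ :=
  Algebra.subset_adjoin (Or.inr ⟨x, rfl⟩)

theorem forall_tupleCoords {p : (TupleSpace K ι β α γ → K) → Prop}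
    (h1 : ∀ x a b, p fun m => m.1 x (std a) (std b)) (h2 : ∀ x a, p fun m => m.2.1 x (std a))
    (h3 : ∀ x a, p fun m => m.2.2.1 x (std a)) (h4 : ∀ x, p fun m => m.2.2.2 x) :
    ∀ f ∈ tupleCoords K ι β α γ, p f := by
  rintro f (((⟨i, rfl⟩ | ⟨i, rfl⟩) | ⟨i, rfl⟩) | ⟨i, rfl⟩)
  exacts [h1 _ _ _, h2 _ _, h3 _ _, h4 _]

/-- The action of pairs of endomorphisms by precomposition. -/
def tupleAct (P Q : Module.End K (Vec K)) (m : TupleSpace K ι β α γ) : TupleSpace K ι β α γ :=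
  (fun x => (m.1 x).compl₁₂ P Q, fun x => m.2.1 x ∘ₗ P, fun x => m.2.2.1 x ∘ₗ Q, m.2.2.2)

/-- Closed sets that are stable under all pairs of endomorphisms. -/
def TupleClosed (C : Set (TupleSpace K ι β α γ)) : Prop :=
  IsZClosed (tuplePoly K ι β α γ) C ∧ ∀ P Q, ∀ m ∈ C, tupleAct P Q m ∈ C

theorem TupleClosed.iInter (s : ℕ → Set (TupleSpace K ι β α γ)) (h : ∀ i, TupleClosed (s i)) :
    TupleClosed (⋂ i, s i) :=
  ⟨IsZClosed.iInter fun i => (h i).1, fun P Q _ hm =>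
    Set.mem_iInter.2 fun i => (h i).2 P Q _ (Set.mem_iInter.1 hm i)⟩

/-- Two tuples have the same upper left `n × n` blocks. -/
def AgreeUpTo (n : ℕ) (m m' : TupleSpace K ι β α γ) : Prop :=
  (∀ x, ∀ a < n, ∀ b < n, m.1 x (std a) (std b) = m'.1 x (std a) (std b)) ∧
  (∀ x, ∀ a < n, m.2.1 x (std a) = m'.2.1 x (std a)) ∧
  (∀ x, ∀ a < n, m.2.2.1 x (std a) = m'.2.2.1 x (std a)) ∧ m.2.2.2 = m'.2.2.2

theorem AgreeUpTo.mono {n n' : ℕ} (h : n ≤ n') {m m' : TupleSpace K ι β α γ}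
    (hm : AgreeUpTo n' m m') : AgreeUpTo n m m' :=
  ⟨fun x a ha b hb => hm.1 x a (by omega) b (by omega), fun x a ha => hm.2.1 x a (by omega),
    fun x a ha => hm.2.2.1 x a (by omega), hm.2.2.2⟩

/-- The function only involves the upper left `n × n` blocks. -/
def DependsUpTo (n : ℕ) (f : TupleSpace K ι β α γ → K) : Prop :=
  ∀ m m', AgreeUpTo n m m' → f m = f m'

theorem DependsUpTo.mono {n n' : ℕ} (h : n ≤ n') {f : TupleSpace K ι β α γ → K}
    (hf : DependsUpTo n f) : DependsUpTo n' f := fun m m' hm => hf m m' (hm.mono h)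

theorem exists_dependsUpTo {f : TupleSpace K ι β α γ → K} (hf : f ∈ tuplePoly K ι β α γ) :
    ∃ n, DependsUpTo n f := by
  induction hf using Algebra.adjoin_induction with
  | mem f hf =>
    refine forall_tupleCoords (p := fun f => ∃ n, DependsUpTo n f) ?_ ?_ ?_ ?_ f hf
    · exact fun x a b => ⟨max a b + 1, fun m m' h => h.1 x a (by omega) b (by omega)⟩
    · exact fun x a => ⟨a + 1, fun m m' h => h.2.1 x a (by omega)⟩
    · exact fun x a => ⟨a + 1, fun m m' h => h.2.2.1 x a (by omega)⟩
    · exact fun x => ⟨0, fun m m' h => congrFun h.2.2.2 x⟩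
  | algebraMap r => exact ⟨0, fun _ _ _ => rfl⟩
  | add f g _ _ hf hg =>
    obtain ⟨n, hn⟩ := hf
    obtain ⟨n', hn'⟩ := hg
    refine ⟨max n n', fun m m' h => ?_⟩
    simp only [Pi.add_apply, hn m m' (h.mono (le_max_left _ _)),
      hn' m m' (h.mono (le_max_right _ _))]
  | mul f g _ _ hf hg =>
    obtain ⟨n, hn⟩ := hf
    obtain ⟨n', hn'⟩ := hg
    refine ⟨max n n', fun m m' h => ?_⟩
    simp only [Pi.mul_apply, hn m m' (h.mono (le_max_left _ _)),
      hn' m m' (h.mono (le_max_right _ _))]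

open Polynomial in
theorem exists_polynomial_line {f : TupleSpace K ι β α γ → K} (hf : f ∈ tuplePoly K ι β α γ)
    (m m' : TupleSpace K ι β α γ) : ∃ p : K[X], ∀ t, f (m + t • m') = p.eval t := by
  induction hf using Algebra.adjoin_induction with
  | mem f hf =>
    refine forall_tupleCoords
      (p := fun f => ∃ p : K[X], ∀ t, f (m + t • m') = p.eval t) ?_ ?_ ?_ ?_ f hf
    · exact fun x a b => ⟨C (m.1 x (std a) (std b)) + X * C (m'.1 x (std a) (std b)),
        fun t => by simp only [Polynomial.eval_add, Polynomial.eval_mul, Polynomial.eval_C, Polynomial.eval_X]; rfl⟩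
    · exact fun x a => ⟨C (m.2.1 x (std a)) + X * C (m'.2.1 x (std a)), fun t => by simp only [Polynomial.eval_add, Polynomial.eval_mul, Polynomial.eval_C, Polynomial.eval_X]; rfl⟩
    · exact fun x a => ⟨C (m.2.2.1 x (std a)) + X * C (m'.2.2.1 x (std a)), fun t => by simp only [Polynomial.eval_add, Polynomial.eval_mul, Polynomial.eval_C, Polynomial.eval_X]; rfl⟩
    · exact fun x => ⟨C (m.2.2.2 x) + X * C (m'.2.2.2 x), fun t => by simp only [Polynomial.eval_add, Polynomial.eval_mul, Polynomial.eval_C, Polynomial.eval_X]; rfl⟩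
  | algebraMap r => exact ⟨C r, fun t => by simp⟩
  | add f g _ _ hf hg =>
    obtain ⟨p, hp⟩ := hf
    obtain ⟨q, hq⟩ := hg
    exact ⟨p + q, fun t => by simp [hp, hq]⟩
  | mul f g _ _ hf hg =>
    obtain ⟨p, hp⟩ := hf
    obtain ⟨q, hq⟩ := hg
    exact ⟨p * q, fun t => by simp [hp, hq]⟩

theorem polynomial_eval_eq_zero [Infinite K] {p : Polynomial K} {s : Set K}
    (hs : s.Finite) (h : ∀ t, t ∉ s → p.eval t = 0) (t : K) : p.eval t = 0 := by
  have : p = 0 := Polynomial.eq_zero_of_infinite_isRoot p (hs.infinite_compl.mono fun t ht => h t ht)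
  simp [this]

/-! ### Specialising generic tuples -/

theorem finrank_sup_le {W : Type*} [AddCommGroup W] [Module K W] (D D' : Submodule K W)
    [FiniteDimensional K D] [FiniteDimensional K D'] :
    Module.finrank K ↥(D ⊔ D') ≤ Module.finrank K D + Module.finrank K D' :=
  Submodule.finrank_add_le_finrank_add_finrank D D'

/-- If no nontrivial linear combination of the `T x` has small rank, then some vector in the
intersection of the kernels of the `v y` has independent images under the `T x`, modulo `D`. -/
theorem exists_independent_images [Infinite K] [Fintype ι] [Fintype α] {V W : Type*} [AddCommGroup V] [Module K V] [AddCommGroup W]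
    [Module K W] {W' : Type*} [AddCommGroup W'] [Module K W'] (π : W →ₗ[K] W')
    (hπ : Function.Surjective π) (T : ι → V →ₗ[K] W) (v : α → Module.Dual K (V))
    (hv : LinearIndependent K v) (D : Submodule K W) [FiniteDimensional K D] (hD : LinearMap.ker π = D) (R : ℕ)
    (hR : Module.finrank K D + Fintype.card ι + Fintype.card α ≤ R)
    (hT : ∀ c : ι → K, c ≠ 0 → ∀ D : Submodule K W, FiniteDimensional K D →
      Module.finrank K D ≤ R → ∃ q, ∑ x, c x • T x q ∉ D) :
    ∃ y, (∀ i, v i y = 0) ∧ LinearIndependent K (fun x => π (T x y)) := by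
  classical
  by_contra hcon
  push Not at hcon
  obtain ⟨Y, hY⟩ : ∃ Y : Submodule K (V), ∀ y, y ∈ Y ↔ ∀ i, v i y = 0 :=
    ⟨⨅ i, LinearMap.ker (v i), fun y => by simp⟩
  let T' : ι → Y →ₗ[K] W' := fun x => π ∘ₗ T x ∘ₗ Y.subtype
  have hdep : ∀ y : Y, ¬ LinearIndependent K (fun x => T' x y) :=
    fun y => hcon y.1 ((hY y.1).1 y.2)
  obtain ⟨c, hc, E, hE, hE', hmem⟩ := exists_combination_of_locally_dependent T' hdep
  obtain ⟨σ, hσ⟩ := π.exists_rightInverse_of_surjective (LinearMap.range_eq_top.2 hπ)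
  choose z hz using fun j => surjective_pi_of_linearIndependent hv (Pi.single j 1)
  let S : V →ₗ[K] W := ∑ x, c x • T x
  have hS : ∀ q, S q = ∑ x, c x • T x q := fun q => by simp [S]
  let F : Submodule K W := Submodule.span K (Set.range fun j => S (z j))
  have hF : FiniteDimensional K F := FiniteDimensional.span_of_finite K (Set.finite_range _)
  -- Suppose the images are always dependent. Then some combination `S` maps the common kernel `Y`
  -- of the `v i` into `E` modulo `D`. Lifting `E` by `σ` and adding the images `F` of a complement
  -- of `Y`, spanned by the `z j`, bounds the rank of `S` on the whole space.
  obtain ⟨q, hq⟩ := hT c hc ((D ⊔ E.map σ) ⊔ F) inferInstance (by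
    refine (finrank_sup_le _ _).trans ?_
    have h1 := finrank_sup_le D (E.map σ)
    have h2 := Submodule.finrank_map_le σ E
    have h3 : Module.finrank K F ≤ Fintype.card α := finrank_range_le_card _
    omega)
  apply hq
  rw [← hS]
  let y : V := q - ∑ j, v j q • z j
  have hy : y ∈ Y := by
    rw [hY]
    intro i
    simp [y, hz, Pi.single_apply]
  have h1 : S y ∈ D ⊔ E.map σ := by
    have h2 : π (S y) ∈ E := by
      have := hmem ⟨y, hy⟩
      simpa [hS, T'] using this
    have h3 : S y = (S y - σ (π (S y))) + σ (π (S y)) := by abel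
    rw [h3]
    refine Submodule.add_mem_sup ?_ (Submodule.mem_map_of_mem h2)
    rw [← hD, LinearMap.mem_ker, map_sub, sub_eq_zero]
    exact (LinearMap.congr_fun hσ _).symm
  have h4 : S q = S y + ∑ j, v j q • S (z j) := by simp [y]
  rw [h4]
  exact Submodule.add_mem_sup h1 (Submodule.sum_mem _ fun j _ =>
    Submodule.smul_mem _ _ (Submodule.subset_span ⟨j, rfl⟩))

theorem linearIndependent_of_eq {J W : Type*} [AddCommGroup W] [Module K W] {f g : J → W}
    (hf : LinearIndependent K f) (h : g = f) : LinearIndependent K g := h ▸ hf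

/-- The vectors `q b` are chosen greedily. The prescribed values of the `v y` are attained by some
`q0`; adding a vector of the common kernel of the `v y` keeps them and makes the new images
independent of all previous ones. The rank bound covers the span of the previous images, the images
of `q0`, and the losses in `exists_independent_images`. -/
theorem exists_independent_columns [Infinite K] [Fintype ι] [Fintype β] [Fintype α] (n : ℕ)
    {W : Type*} [AddCommGroup W] [Module K W]
    (T : ι → Vec K →ₗ[K] W) (u : β → W) (v : α → Module.Dual K (Vec K))
    (hu : LinearIndependent K u) (hv : LinearIndependent K v)
    (hT : ∀ c : ι → K, c ≠ 0 → ∀ D : Submodule K W, FiniteDimensional K D →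
      Module.finrank K D ≤
        Fintype.card β + Fintype.card ι * n + Fintype.card ι + Fintype.card ι + Fintype.card α →
      ∃ q, ∑ x, c x • T x q ∉ D)
    (v' : α → ℕ → K) (k : ℕ) (hk : k ≤ n) :
    ∃ q : ℕ → Vec K, (∀ b < k, ∀ y, v y (q b) = v' y b) ∧
      LinearIndependent K (Sum.elim u fun i : ι × Fin k => T i.1 (q i.2)) := by
  classical
  induction k with
  | zero =>
    refine ⟨0, by simp, ?_⟩
    have := hu.comp (fun i : β ⊕ ι × Fin 0 => Sum.elim id (fun j => j.2.elim0) i) (by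
      rintro (a | a) (b | b) h
      · simpa using h
      · exact b.2.elim0
      · exact a.2.elim0
      · exact a.2.elim0)
    convert this using 1
    ext (i | i)
    · rfl
    · exact i.2.elim0
  | succ k ih =>
    obtain ⟨q, hq, hli⟩ := ih (by omega)
    obtain ⟨q0, hq0⟩ := surjective_pi_of_linearIndependent hv (fun y => v' y k)
    -- `D0` is spanned by what was already chosen and `D1` by the images of `q0`. Modulo both, `q0 +
    -- y` and `y` have the same images.
    let D0 : Submodule K W :=
      Submodule.span K (Set.range (Sum.elim u fun i : ι × Fin k => T i.1 (q i.2)))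
    let D1 : Submodule K W := Submodule.span K (Set.range fun x => T x q0)
    have h0 : FiniteDimensional K D0 := FiniteDimensional.span_of_finite K (Set.finite_range _)
    have h1 : FiniteDimensional K D1 := FiniteDimensional.span_of_finite K (Set.finite_range _)
    have h2 := finrank_sup_le D0 D1
    have h3 : Module.finrank K D0 ≤ _ := finrank_range_le_card _
    have h4 : Module.finrank K D1 ≤ _ := finrank_range_le_card _
    have h5 : Fintype.card ι * k ≤ Fintype.card ι * n := Nat.mul_le_mul_left _ (by omega)
    simp only [Fintype.card_sum, Fintype.card_prod, Fintype.card_fin] at h3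
    obtain ⟨y, hy, hyli⟩ := exists_independent_images (D0 ⊔ D1).mkQ
      (Submodule.mkQ_surjective _) T v hv (D0 ⊔ D1) (Submodule.ker_mkQ _) _ (by omega) hT
    refine ⟨Function.update q k (q0 + y), ?_, ?_⟩
    · intro b hb i
      rcases Nat.lt_succ_iff_lt_or_eq.1 hb with hb | rfl
      · rw [Function.update_of_ne (by omega), hq b hb]
      · rw [Function.update_self, map_add, hq0, hy, add_zero]
    · let f : β ⊕ ι × Fin k → ↥(D0 ⊔ D1) := fun i =>
        ⟨Sum.elim u (fun i : ι × Fin k => T i.1 (q i.2)) i,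
          Submodule.mem_sup_left (Submodule.subset_span ⟨i, rfl⟩)⟩
      have hf : LinearIndependent K f := LinearIndependent.of_comp (D0 ⊔ D1).subtype hli
      have hg := hf.sumElim_of_quotient (fun x => T x (q0 + y)) (by
        refine linearIndependent_of_eq hyli (funext fun x => ?_)
        simp only [Function.comp_apply, map_add, ← Submodule.mkQ_apply]
        rw [add_eq_right, Submodule.mkQ_apply, Submodule.Quotient.mk_eq_zero]
        exact Submodule.mem_sup_right (Submodule.subset_span ⟨x, rfl⟩))
      have := hg.comp (fun i : β ⊕ ι × Fin (k + 1) => Sum.elim (fun y => Sum.inl (Sum.inl y))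
        (fun j => if h : j.2.1 < k then Sum.inl (Sum.inr (j.1, ⟨j.2.1, h⟩)) else Sum.inr j.1) i) (by
          rintro (a | ⟨a, a'⟩) (b | ⟨b, b'⟩) hab
          · simpa using hab
          · by_cases h : b'.1 < k <;> simp [h] at hab
          · by_cases h : a'.1 < k <;> simp [h] at hab
          · by_cases h : a'.1 < k <;> by_cases h' : b'.1 < k <;> simp [h, h'] at hab ⊢
            · exact ⟨hab.1, Fin.ext hab.2⟩
            · exact ⟨hab, Fin.ext (by omega)⟩)
      refine linearIndependent_of_eq this (funext ?_)
      rintro (i | ⟨x, i⟩)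
      · rfl
      · by_cases h : i.1 < k
        · simp [h, f, Function.update_of_ne (show (i : ℕ) ≠ k by omega)]
        · have : (i : ℕ) = k := by omega
          simp [this]

/-- A bound on the ranks of the matrices in non-generic tuples. -/
def rankBound (ι β α : Type) [Fintype ι] [Fintype β] [Fintype α] (n : ℕ) : ℕ :=
  Fintype.card β + Fintype.card ι * n + Fintype.card ι + Fintype.card ι + Fintype.card α

/-- Generic tuples specialise to arbitrary tuples. -/
theorem exists_specialization [Infinite K] [Fintype ι] [Fintype β] [Fintype α] (n : ℕ)
    (m m' : TupleSpace K ι β α γ) (hu : LinearIndependent K m.2.1)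
    (hv : LinearIndependent K m.2.2.1)
    (hA : ∀ c : ι → K, c ≠ 0 → ∀ D : Submodule K (Module.Dual K (Vec K)), FiniteDimensional K D →
      Module.finrank K D ≤ rankBound ι β α n → ∃ q, ∑ x, c x • (m.1 x).flip q ∉ D)
    (hc : m.2.2.2 = m'.2.2.2) :
    ∃ P Q, AgreeUpTo n (tupleAct P Q m) m' := by
  obtain ⟨q, hq, hli⟩ := exists_independent_columns n (fun x => (m.1 x).flip) m.2.1 m.2.2.1 hu hv hA
    (fun y b => m'.2.2.1 y (std b)) n le_rfl
  -- The columns are fixed first. The row forms and the forms `m.1 x · (q b)` are then independent,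
  -- so each new row vector `p a` can be given all prescribed values at once.
  choose p hp using fun a : ℕ => surjective_pi_of_linearIndependent hli
    (Sum.elim (fun x => m'.2.1 x (std a)) fun i => m'.1 i.1 (std a) (std i.2))
  refine ⟨Finsupp.linearCombination K p, Finsupp.linearCombination K q, ?_, ?_, ?_, hc⟩
  · intro x a _ b hb
    have := hp a (Sum.inr (x, ⟨b, hb⟩))
    simpa [tupleAct, std] using this
  · intro x a _
    have := hp a (Sum.inl x)
    simpa [tupleAct, std] using this
  · intro x a ha
    have := hq a ha x
    simpa [tupleAct, std] using this

end Tuples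

end InfWedge
end

noncomputable section

namespace InfWedge

/-! ### Noetherianity of tuples of matrices -/

universe u

section Tuples

variable {K : Type u} [Field K] {ι β α γ ι' β' α' γ' : Type}

theorem tuple_ext_std {W : Type*} [AddCommGroup W] [Module K W] {f g : Vec K →ₗ[K] W}
    (h : ∀ a, f (std a) = g (std a)) : f = g := by
  ext a
  simpa [std] using h a

/-- Equivariant polynomial maps pull back closed stable sets to closed stable sets. -/
theorem TupleClosed.preimage {C : Set (TupleSpace K ι β α γ)} (hC : TupleClosed C)
    (φ : TupleSpace K ι' β' α' γ' → TupleSpace K ι β α γ)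
    (hφ : ∀ f ∈ tupleCoords K ι β α γ, f ∘ φ ∈ tuplePoly K ι' β' α' γ')
    (he : ∀ P Q m, φ (tupleAct P Q m) = tupleAct P Q (φ m)) : TupleClosed (φ ⁻¹' C) :=
  ⟨hC.1.preimage φ (comp_mem_of_adjoin φ hφ), fun P Q m hm => by
    rw [Set.mem_preimage, he]; exact hC.2 P Q _ hm⟩

theorem NoethOn.of_range {S : Set (TupleSpace K ι β α γ)}
    (h : NoethOn (TupleClosed (K := K) (ι := ι') (β := β') (α := α') (γ := γ')) Set.univ)
    (φ : TupleSpace K ι' β' α' γ' → TupleSpace K ι β α γ)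
    (hφ : ∀ f ∈ tupleCoords K ι β α γ, f ∘ φ ∈ tuplePoly K ι' β' α' γ')
    (he : ∀ P Q m, φ (tupleAct P Q m) = tupleAct P Q (φ m)) (hS : S ⊆ Set.range φ) :
    NoethOn (TupleClosed (K := K)) S := by
  have := h.image TupleClosed.iInter φ (CY := TupleClosed (K := K)) fun C hC => hC.preimage φ hφ he
  rw [Set.image_univ] at this
  exact this.mono hS

open Classical in
/-- Insert a linear combination of the row vectors as a further row vector. -/
def insertRow [Fintype β] (x : β) (m : TupleSpace K ι {y // y ≠ x} α (γ ⊕ {y // y ≠ x})) :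
    TupleSpace K ι β α γ :=
  (m.1, fun y => if h : y ≠ x then m.2.1 ⟨y, h⟩ else ∑ z, m.2.2.2 (Sum.inr z) • m.2.1 z, m.2.2.1,
    fun c => m.2.2.2 (Sum.inl c))

open Classical in
/-- Insert a linear combination of the column vectors as a further column vector. -/
def insertCol [Fintype α] (x : α) (m : TupleSpace K ι β {y // y ≠ x} (γ ⊕ {y // y ≠ x})) :
    TupleSpace K ι β α γ :=
  (m.1, m.2.1, fun y => if h : y ≠ x then m.2.2.1 ⟨y, h⟩ else
    ∑ z, m.2.2.2 (Sum.inr z) • m.2.2.1 z, fun c => m.2.2.2 (Sum.inl c))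

open Classical in
/-- Insert a linear combination of the matrices plus a matrix of rank at most `R` as a further
matrix. -/
def insertMat [Fintype ι] (x : ι) (R : ℕ)
    (m : TupleSpace K {y // y ≠ x} (β ⊕ Fin R) (α ⊕ Fin R) (γ ⊕ {y // y ≠ x})) :
    TupleSpace K ι β α γ :=
  (fun y => if h : y ≠ x then m.1 ⟨y, h⟩ else ∑ z, m.2.2.2 (Sum.inr z) • m.1 z +
      ∑ l, (m.2.1 (Sum.inr l)).smulRight (m.2.2.1 (Sum.inr l)),
    fun y => m.2.1 (Sum.inl y), fun y => m.2.2.1 (Sum.inl y), fun c => m.2.2.2 (Sum.inl c))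

theorem sum_fun_mem {X J : Type*} [Fintype J] {O : Subalgebra K (X → K)} {f : J → X → K}
    (h : ∀ z, f z ∈ O) : (fun m => ∑ z, f z m) ∈ O := by
  have := O.sum_mem (t := Finset.univ) fun z _ => h z
  convert this using 1
  ext m
  simp

theorem insertRow_comp_mem [Fintype β] (x : β) : ∀ f ∈ tupleCoords K ι β α γ,
    f ∘ insertRow x ∈ tuplePoly K ι {y // y ≠ x} α (γ ⊕ {y // y ≠ x}) := by
  classical
  refine forall_tupleCoords ?_ ?_ ?_ ?_
  · exact fun y a b => coord_mat_mem y a b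
  · intro y a
    by_cases h : y ≠ x
    · convert coord_row_mem (⟨y, h⟩ : {y // y ≠ x}) a using 1
      ext m
      simp [insertRow, h]
    · obtain rfl := not_not.1 h
      convert sum_fun_mem fun z : {z : β // z ≠ y} => Subalgebra.mul_mem
        (tuplePoly K ι {z : β // z ≠ y} α (γ ⊕ {z : β // z ≠ y})) (coord_const_mem (Sum.inr z))
          (coord_row_mem z a) using 1
      ext m
      simp [insertRow, Finset.sum_apply]
  · exact fun y a => coord_col_mem y a
  · exact fun y => coord_const_mem (Sum.inl y)

theorem insertCol_comp_mem [Fintype α] (x : α) : ∀ f ∈ tupleCoords K ι β α γ,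
    f ∘ insertCol x ∈ tuplePoly K ι β {y // y ≠ x} (γ ⊕ {y // y ≠ x}) := by
  classical
  refine forall_tupleCoords ?_ ?_ ?_ ?_
  · exact fun y a b => coord_mat_mem y a b
  · exact fun y a => coord_row_mem y a
  · intro y a
    by_cases h : y ≠ x
    · convert coord_col_mem (⟨y, h⟩ : {y // y ≠ x}) a using 1
      ext m
      simp [insertCol, h]
    · obtain rfl := not_not.1 h
      convert sum_fun_mem fun z : {z : α // z ≠ y} => Subalgebra.mul_mem
        (tuplePoly K ι β {z : α // z ≠ y} (γ ⊕ {z : α // z ≠ y})) (coord_const_mem (Sum.inr z))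
          (coord_col_mem z a) using 1
      ext m
      simp [insertCol, Finset.sum_apply]
  · exact fun y => coord_const_mem (Sum.inl y)

theorem insertMat_comp_mem [Fintype ι] (x : ι) (R : ℕ) : ∀ f ∈ tupleCoords K ι β α γ,
    f ∘ insertMat x R ∈
      tuplePoly K {y // y ≠ x} (β ⊕ Fin R) (α ⊕ Fin R) (γ ⊕ {y // y ≠ x}) := by
  classical
  refine forall_tupleCoords ?_ ?_ ?_ ?_
  · intro y a b
    by_cases h : y ≠ x
    · convert coord_mat_mem (⟨y, h⟩ : {y // y ≠ x}) a b using 1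
      ext m
      simp [insertMat, h]
    · obtain rfl := not_not.1 h
      convert Subalgebra.add_mem
        (tuplePoly K {z : ι // z ≠ y} (β ⊕ Fin R) (α ⊕ Fin R) (γ ⊕ {z : ι // z ≠ y}))
        (sum_fun_mem fun z : {z : ι // z ≠ y} =>
          Subalgebra.mul_mem _ (coord_const_mem (Sum.inr z)) (coord_mat_mem z a b))
        (sum_fun_mem fun l : Fin R =>
          Subalgebra.mul_mem _ (coord_row_mem (Sum.inr l) a) (coord_col_mem (Sum.inr l) b)) using 1
      ext m
      simp [insertMat, Finset.sum_apply]
  · exact fun y a => coord_row_mem (Sum.inl y) a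
  · exact fun y a => coord_col_mem (Sum.inl y) a
  · exact fun y => coord_const_mem (Sum.inl y)

theorem insertRow_act [Fintype β] (x : β) (P Q : Module.End K (Vec K))
    (m : TupleSpace K ι {y // y ≠ x} α (γ ⊕ {y // y ≠ x})) :
    (insertRow x (tupleAct P Q m) : TupleSpace K ι β α γ) = tupleAct P Q (insertRow x m) := by
  refine Prod.ext rfl (Prod.ext (funext fun y => ?_) rfl)
  by_cases h : y ≠ x
  · simp [insertRow, tupleAct, h]
  · obtain rfl := not_not.1 h
    ext; simp [insertRow, tupleAct]

theorem insertCol_act [Fintype α] (x : α) (P Q : Module.End K (Vec K))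
    (m : TupleSpace K ι β {y // y ≠ x} (γ ⊕ {y // y ≠ x})) :
    (insertCol x (tupleAct P Q m) : TupleSpace K ι β α γ) = tupleAct P Q (insertCol x m) := by
  refine Prod.ext rfl (Prod.ext rfl (Prod.ext (funext fun y => ?_) rfl))
  by_cases h : y ≠ x
  · simp [insertCol, tupleAct, h]
  · obtain rfl := not_not.1 h
    ext; simp [insertCol, tupleAct]

theorem insertMat_act [Fintype ι] (x : ι) (R : ℕ) (P Q : Module.End K (Vec K))
    (m : TupleSpace K {y // y ≠ x} (β ⊕ Fin R) (α ⊕ Fin R) (γ ⊕ {y // y ≠ x})) :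
    (insertMat x R (tupleAct P Q m) : TupleSpace K ι β α γ) = tupleAct P Q (insertMat x R m) := by
  refine Prod.ext (funext fun y => ?_) rfl
  by_cases h : y ≠ x
  · simp [insertMat, tupleAct, h]
  · obtain rfl := not_not.1 h
    ext; simp [insertMat, tupleAct]

theorem exists_eq_sum_of_not_linearIndependent {V : Type*} [AddCommGroup V] [Module K V]
    [Fintype β] [DecidableEq β] {f : β → V} (h : ¬ LinearIndependent K f) :
    ∃ x, ∃ c : {y // y ≠ x} → K, f x = ∑ z, c z • f z := by
  rw [Fintype.not_linearIndependent_iff] at h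
  obtain ⟨g, hg, x, hx⟩ := h
  refine ⟨x, fun z => -(g x)⁻¹ * g z, ?_⟩
  rw [Fintype.sum_eq_add_sum_subtype_ne _ x, add_eq_zero_iff_eq_neg] at hg
  simp only [mul_smul, neg_smul, ← Finset.smul_sum, Finset.sum_neg_distrib]
  rw [← smul_neg, ← hg, smul_smul, inv_mul_cancel₀ hx, one_smul]

/-- The coefficients of a linear relation become additional constants, so a dependent tuple comes
from one with a row fewer. -/
theorem subset_range_insertRow [Fintype β] :
    {m : TupleSpace K ι β α γ | ¬ LinearIndependent K m.2.1} ⊆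
      ⋃ x : β, Set.range (insertRow (K := K) (ι := ι) (α := α) (γ := γ) x) := by
  classical
  intro m hm
  obtain ⟨x, c, hc⟩ := exists_eq_sum_of_not_linearIndependent hm
  refine Set.mem_iUnion.2 ⟨x, (m.1, fun y => m.2.1 y, m.2.2.1, Sum.elim m.2.2.2 c), ?_⟩
  refine Prod.ext rfl (Prod.ext (funext fun y => ?_) rfl)
  by_cases h : y = x
  · subst h; simp [insertRow, hc]
  · simp [insertRow, h]

theorem subset_range_insertCol [Fintype α] :
    {m : TupleSpace K ι β α γ | ¬ LinearIndependent K m.2.2.1} ⊆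
      ⋃ x : α, Set.range (insertCol (K := K) (ι := ι) (β := β) (γ := γ) x) := by
  classical
  intro m hm
  obtain ⟨x, c, hc⟩ := exists_eq_sum_of_not_linearIndependent hm
  refine Set.mem_iUnion.2 ⟨x, (m.1, m.2.1, fun y => m.2.2.1 y, Sum.elim m.2.2.2 c), ?_⟩
  refine Prod.ext rfl (Prod.ext rfl (Prod.ext (funext fun y => ?_) rfl))
  by_cases h : y = x
  · subst h; simp [insertCol, hc]
  · simp [insertCol, h]

/-- A map into a finite-dimensional space is a sum of maps of rank one, by taking coordinates in a
basis. -/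
theorem exists_eq_sum_of_mem {V W : Type*} [AddCommGroup V] [Module K V] [AddCommGroup W]
    [Module K W] (S : V →ₗ[K] W) (D : Submodule K W) [FiniteDimensional K D] (h : ∀ q, S q ∈ D) :
    ∃ (b : Fin (Module.finrank K D) → W) (s : Fin (Module.finrank K D) → Module.Dual K V),
      ∀ q, S q = ∑ l, s l q • b l := by
  let b := Module.finBasis K D
  let S' : V →ₗ[K] D := LinearMap.codRestrict D S h
  refine ⟨fun l => b l, fun l => b.coord l ∘ₗ S', fun q => ?_⟩
  have := congrArg Subtype.val (b.sum_repr (S' q))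
  simp only [Submodule.coe_sum, Submodule.coe_smul] at this
  exact this.symm

theorem subset_range_insertMat [Fintype ι] (R : ℕ) :
    {m : TupleSpace K ι β α γ | ∃ c : ι → K, c ≠ 0 ∧
      ∃ D : Submodule K (Module.Dual K (Vec K)), FiniteDimensional K D ∧
      Module.finrank K D ≤ R ∧ ∀ q, ∑ x, c x • (m.1 x).flip q ∈ D} ⊆
      ⋃ x : ι × Fin (R + 1), Set.range
        (insertMat (K := K) (β := β) (α := α) (γ := γ) x.1 x.2) := by
  classical
  rintro m ⟨c, hc, D, hD, hR, hm⟩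
  obtain ⟨x, hx⟩ := Function.ne_iff.1 hc
  obtain ⟨b, s, hbs⟩ := exists_eq_sum_of_mem (∑ x, c x • (m.1 x).flip) D fun q => by
    simpa using hm q
  -- The relation is solved for the matrix `x` with `c x ≠ 0`. The combination of small rank
  -- contributes one row and one column for each dimension of `D`.
  refine Set.mem_iUnion.2 ⟨(x, ⟨Module.finrank K D, by omega⟩), (fun y => m.1 y,
    Sum.elim m.2.1 b, Sum.elim m.2.2.1 fun l => (c x)⁻¹ • s l,
    Sum.elim m.2.2.2 fun z => -(c x)⁻¹ * c z), ?_⟩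
  refine Prod.ext (funext fun y => ?_) rfl
  by_cases h : y = x
  · subst h
    refine LinearMap.ext fun p => LinearMap.ext fun q => ?_
    have h1 := congrArg (fun f : Module.Dual K (Vec K) => f p) (hbs q)
    simp only [LinearMap.sum_apply, LinearMap.smul_apply, LinearMap.flip_apply,
      smul_eq_mul] at h1
    rw [Fintype.sum_eq_add_sum_subtype_ne _ y] at h1
    have h2 : m.1 y p q = (c y)⁻¹ * (∑ l, s l q * b l p - ∑ z : {z // z ≠ y}, c z * m.1 z p q) := by
      rw [← h1, add_sub_cancel_right, inv_mul_cancel_left₀ hx]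
    rw [h2]
    simp only [insertMat, ne_eq, not_true_eq_false, dite_false, Sum.elim_inr,
      LinearMap.add_apply, LinearMap.sum_apply, LinearMap.smul_apply, smul_eq_mul,
      LinearMap.smulRight_apply,
      mul_sub, Finset.mul_sum]
    rw [add_comm, sub_eq_add_neg, ← Finset.sum_neg_distrib]
    congr 1
    · exact Finset.sum_congr rfl fun l _ => by ring
    · exact Finset.sum_congr rfl fun l _ => by ring
  · simp [insertMat, h]

/-- Generic tuples in a chain of closed stable sets are eventually constant. -/
theorem chain_generic_stabilises [Infinite K] [Fintype ι] [Fintype β] [Fintype α] [Finite γ]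
    (Z : ℕ → Set (TupleSpace K ι β α γ)) (hZ : Antitone Z) (hC : ∀ k, TupleClosed (Z k)) :
    ∃ N R, ∀ k, N ≤ k → ∀ m ∈ Z N, LinearIndependent K m.2.1 → LinearIndependent K m.2.2.1 →
      (∀ c : ι → K, c ≠ 0 → ∀ D : Submodule K (Module.Dual K (Vec K)), FiniteDimensional K D →
        Module.finrank K D ≤ R → ∃ q, ∑ x, c x • (m.1 x).flip q ∉ D) → m ∈ Z k := by
  let O : Subalgebra K ((γ → K) → K) := Algebra.adjoin K (Set.range fun i c => c i)
  let emb : TupleSpace K ι β α γ → (γ → K) → TupleSpace K ι β α γ :=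
    fun m c => (m.1, m.2.1, m.2.2.1, c)
  have hemb : ∀ m, ∀ f ∈ tuplePoly K ι β α γ, f ∘ emb m ∈ O := by
    intro m
    refine comp_mem_of_adjoin _ (forall_tupleCoords ?_ ?_ ?_ ?_)
    · exact fun x a b => O.algebraMap_mem (m.1 x (std a) (std b))
    · exact fun x a => O.algebraMap_mem (m.2.1 x (std a))
    · exact fun x a => O.algebraMap_mem (m.2.2.1 x (std a))
    · exact fun x => Algebra.subset_adjoin ⟨x, rfl⟩
  have hN : ∀ S, NoethOn (IsZClosed O) S := fun S => noethOn_of_isNoetherianRing O S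
  -- The constants over which the whole fibre lies in `Z k` form a descending chain of closed sets
  -- in a finite-dimensional space.
  obtain ⟨N, hN1⟩ := hN Set.univ (fun k => ⋂ m, emb m ⁻¹' Z k)
    (fun k l hkl => Set.iInter_mono fun m => Set.preimage_mono (hZ hkl))
    (fun k => IsZClosed.iInter fun m => (hC k).1.preimage _ (hemb m))
  let I : ℕ → Set (TupleSpace K ι β α γ → K) := fun n =>
    {f | f ∈ tuplePoly K ι β α γ ∧ (∀ m ∈ Z N, f m = 0) ∧ DependsUpTo n f}
  -- Likewise for the constants over whose fibre all equations of `Z N` involving only the `n × n`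
  -- blocks vanish. Some finite `n` therefore accounts for all equations of `Z N`.
  obtain ⟨n, hn⟩ := hN Set.univ (fun n => ⋂ m, ⋂ f : I n, {c | f.1 (emb m c) = 0})
    (fun k l hkl c hc => by
      simp only [Set.mem_iInter] at hc ⊢
      exact fun m f => hc m ⟨f.1, f.2.1, f.2.2.1, f.2.2.2.mono hkl⟩)
    (fun k => IsZClosed.iInter fun m => IsZClosed.iInter fun f x hx =>
      ⟨f.1 ∘ emb m, hemb m _ f.2.1, fun y hy => hy, hx⟩)
  refine ⟨N, rankBound ι β α n, fun k hk m hm hu hv hA => ?_⟩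
  -- A generic `m` in `Z N` specialises, within `Z N`, to the `n × n` blocks of every tuple with the
  -- same constants. So the equations of size `n`, and then all equations of `Z N`, vanish on the
  -- fibre over its constants.
  have h1 : m.2.2.2 ∈ ⋂ m, ⋂ f : I n, {c | f.1 (emb m c) = 0} := by
    simp only [Set.mem_iInter]
    intro m' f
    obtain ⟨P, Q, hPQ⟩ := exists_specialization n m (emb m' m.2.2.2) hu hv hA rfl
    change f.1 _ = 0
    rw [← f.2.2.2 _ _ hPQ]
    exact f.2.2.1 _ ((hC N).2 P Q m hm)
  have h2 : m.2.2.2 ∈ ⋂ m, emb m ⁻¹' Z N := by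
    simp only [Set.mem_iInter]
    intro m'
    by_contra hcon
    obtain ⟨f, hf, hf0, hf1⟩ := (hC N).1 _ hcon
    obtain ⟨n', hn'⟩ := exists_dependsUpTo hf
    have h3 := hn (max n n') (le_max_left _ _)
    simp only [Set.inter_univ] at h3
    rw [← h3] at h1
    simp only [Set.mem_iInter] at h1
    exact hf1 (h1 m' ⟨f, hf, hf0, hn'.mono (le_max_right _ _)⟩)
  have h4 := hN1 k hk
  simp only [Set.inter_univ] at h4
  rw [← h4] at h2
  simp only [Set.mem_iInter] at h2
  exact h2 m

/-- Tuples of matrices, vectors and constants are Noetherian modulo row and column operations. -/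
theorem noethOn_tupleClosed [Infinite K] (n : ℕ) : ∀ (ι β α γ : Type) [Fintype ι] [Fintype β]
    [Fintype α] [Finite γ], Fintype.card ι = n →
    NoethOn (TupleClosed (K := K) (ι := ι) (β := β) (α := α) (γ := γ)) Set.univ := by
  classical
  induction n using Nat.strong_induction_on with
  | _ n ihn =>
  -- The induction is lexicographic: first on the number of matrices, then on the number of vectors.
  -- Removing a matrix may add many vectors, and any finite number of constants is allowed
  -- throughout.
  suffices h : ∀ k, ∀ (ι β α γ : Type) [Fintype ι] [Fintype β]
      [Fintype α] [Finite γ], Fintype.card ι = n → Fintype.card β + Fintype.card α = k →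
      NoethOn (TupleClosed (K := K) (ι := ι) (β := β) (α := α) (γ := γ)) Set.univ from
    fun ι β α γ _ _ _ _ hι => h _ ι β α γ hι rfl
  intro k
  induction k using Nat.strong_induction_on with
  | _ k ihk =>
  intro ι β α γ _ _ _ _ hι hk
  have hcard : ∀ {δ : Type} [Fintype δ] (x : δ), Fintype.card {y // y ≠ x} + 1 = Fintype.card δ := by
    intro δ _ x
    have h1 : 0 < Fintype.card δ := Fintype.card_pos_iff.2 ⟨x⟩
    rw [Fintype.card_subtype_compl, Fintype.card_subtype_eq]
    omega
  have hrow : NoethOn (TupleClosed (K := K))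
      {m : TupleSpace K ι β α γ | ¬ LinearIndependent K m.2.1} :=
    (NoethOn.iUnion fun x => (ihk (k - 1) (by have := hcard x; omega) _ _ _ _ hι
      (by have := hcard x; omega)).of_range (insertRow x) (insertRow_comp_mem x) (insertRow_act x)
      subset_rfl).mono subset_range_insertRow
  have hcol : NoethOn (TupleClosed (K := K))
      {m : TupleSpace K ι β α γ | ¬ LinearIndependent K m.2.2.1} :=
    (NoethOn.iUnion fun x => (ihk (k - 1) (by have := hcard x; omega) _ _ _ _ hι
      (by have := hcard x; omega)).of_range (insertCol x) (insertCol_comp_mem x) (insertCol_act x)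
      subset_rfl).mono subset_range_insertCol
  have hmat := fun R => (NoethOn.iUnion fun x : ι × Fin (R + 1) =>
    (ihn (n - 1) (by have := hcard x.1; omega) _ _ _ _
      (by have := hcard x.1; omega)).of_range (insertMat x.1 x.2)
      (insertMat_comp_mem (K := K) (β := β) (α := α) (γ := γ) x.1 x.2)
      (insertMat_act x.1 x.2) subset_rfl).mono (subset_range_insertMat R)
  intro Z hZ hC
  obtain ⟨N, R, hN⟩ := chain_generic_stabilises Z hZ hC
  obtain ⟨N', hN'⟩ := (hrow.union (hcol.union (hmat R))) Z hZ hC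
  refine ⟨max N N', fun l hl => ?_⟩
  rw [Set.inter_univ, Set.inter_univ]
  refine Set.Subset.antisymm (hZ hl) fun m hm => ?_
  by_cases hbad : m ∈ {m : TupleSpace K ι β α γ | ¬ LinearIndependent K m.2.1} ∪
      ({m : TupleSpace K ι β α γ | ¬ LinearIndependent K m.2.2.1} ∪
      {m : TupleSpace K ι β α γ | ∃ c : ι → K, c ≠ 0 ∧
        ∃ D : Submodule K (Module.Dual K (Vec K)), FiniteDimensional K D ∧
        Module.finrank K D ≤ R ∧ ∀ q, ∑ x, c x • (m.1 x).flip q ∈ D})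
  · have h1 := hN' l (le_trans (le_max_right _ _) hl)
    have h2 := hN' (max N N') (le_max_right _ _)
    have h3 : m ∈ Z (max N N') ∩ _ := ⟨hm, hbad⟩
    rw [h2, ← h1] at h3
    exact h3.1
  · simp only [Set.mem_union, Set.mem_ofPred_eq, not_or, not_not] at hbad
    refine hN l (le_trans (le_max_left _ _) hl) m (hZ (le_max_left _ _) hm) hbad.1 hbad.2.1 ?_
    intro c hc D hD hR
    by_contra hcon
    push Not at hcon
    exact hbad.2.2 ⟨c, hc, D, hD, hR, hcon⟩

end Tuples

end InfWedge
end

noncomputable section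

namespace InfWedge

/-! ### Closed sets stable under elementary operations -/

universe u

section Elementary

variable {K : Type u} [Field K] {ι β α γ : Type}

/-- The endomorphism that sends the `i`-th basis vector `x_i` to `x_i + v` and fixes the others. -/
def shear (i : ℕ) (v : Vec K) : Module.End K (Vec K) := 1 + (Finsupp.lapply i).smulRight v

theorem shear_apply (i : ℕ) (v w : Vec K) : shear i v w = w + w i • v := rfl

theorem shear_std_self (i : ℕ) (v : Vec K) : shear i v (std i) = std i + v := by
  simp [shear_apply, std]

theorem shear_std_of_ne {i b : ℕ} (h : b ≠ i) (v : Vec K) : shear i v (std b) = std b := by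
  simp [shear_apply, std, h]

theorem shear_apply_of_eq_zero {i : ℕ} {w : Vec K} (h : w i = 0) (v : Vec K) :
    shear i v w = w := by
  simp [shear_apply, h]

theorem shear_add {i : ℕ} {v w : Vec K} (hw : w i = 0) :
    shear i (w + v) = shear i v * shear i w := by
  ext1 x
  ext1
  simp [shear_apply, hw, smul_add, add_assoc]

variable {T : Submonoid (Module.End K (Vec K))}

/-- Shears at the same index `i` compose by adding their vectors, provided these have no component
at `i`; so a general shear is a product of elementary ones. -/
theorem shear_mem (hT : ∀ i k, i ≠ k → ∀ t : K, shear i (t • std k) ∈ T) {i : ℕ} {v : Vec K}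
    (hv : v i = 0) : shear i v ∈ T := by
  have key : ∀ s : Finset ℕ, i ∉ s → shear i (∑ k ∈ s, v k • std k) ∈ T := by
    intro s
    induction s using Finset.induction_on with
    | empty =>
      intro _
      have : shear i (0 : Vec K) = 1 := by ext; simp [shear_apply]
      rw [Finset.sum_empty, this]; exact T.one_mem
    | insert k s hk ih =>
      intro hi
      rw [Finset.mem_insert, not_or] at hi
      rw [Finset.sum_insert hk, shear_add (by simp [std, Ne.symm hi.1])]
      exact T.mul_mem (ih hi.2) (hT i k hi.1 _)
  have hv' : v = ∑ k ∈ v.support, v k • std k := by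
    conv_lhs => rw [← v.sum_single, Finsupp.sum]
    exact Finset.sum_congr rfl fun k _ => by simp [std]
  rw [hv']
  exact key _ (by simpa using hv)

/-- The shears at the indices of `S` do not interfere, since the vectors `φ b` have no components in
`S`. Their product performs all of them simultaneously. -/
theorem exists_block_mem (hT : ∀ i k, i ≠ k → ∀ t : K, shear i (t • std k) ∈ T) (φ : ℕ → Vec K)
    (S : Finset ℕ) (hφ : ∀ b ∈ S, ∀ j ∈ S, φ b j = 0) :
    ∃ U ∈ T, (∀ b ∈ S, U (std b) = std b + φ b) ∧ ∀ v, (∀ j ∈ S, v j = 0) → U v = v := by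
  induction S using Finset.induction_on with
  | empty => exact ⟨1, T.one_mem, by simp, by simp⟩
  | insert s S hs ih =>
    obtain ⟨U, hU, h1, h2⟩ := ih fun b hb j hj =>
      hφ b (Finset.mem_insert_of_mem hb) j (Finset.mem_insert_of_mem hj)
    have h0 := hφ s (Finset.mem_insert_self _ _)
    refine ⟨U * shear s (φ s), T.mul_mem hU (shear_mem hT (h0 s (Finset.mem_insert_self _ _))),
      ?_, ?_⟩
    · intro b hb
      rw [Module.End.mul_apply]
      rcases Finset.mem_insert.1 hb with rfl | hb
      · rw [shear_std_self, map_add, h2 (φ b) fun j hj => h0 j (Finset.mem_insert_of_mem hj),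
          h2 (std b) fun j hj => ?_]
        have : b ≠ j := fun h => hs (h ▸ hj)
        simp [std, this]
      · have : b ≠ s := fun h => hs (h ▸ hb)
        rw [shear_std_of_ne this, h1 b hb]
    · intro v hv
      rw [Module.End.mul_apply, shear_apply_of_eq_zero (hv s (Finset.mem_insert_self _ _)),
        h2 v fun j hj => hv j (Finset.mem_insert_of_mem hj)]

/-- A monoid of endomorphisms that contains the elementary ones and satisfies a closedness
condition contains all endomorphisms. -/
theorem end_mem (hT : ∀ i k, i ≠ k → ∀ t : K, shear i (t • std k) ∈ T)
    (hcl : ∀ P : Module.End K (Vec K), (∀ n, ∃ N : Module.End K (Vec K), ∀ t : K, t ≠ 0 → ∃ S ∈ T,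
      ∀ a < n, S (std a) = (P + t • N) (std a)) → P ∈ T) (P : Module.End K (Vec K)) : P ∈ T := by
  refine hcl P fun n => ?_
  obtain ⟨L, hL⟩ : ∃ L, ∀ a < n, ∀ j, L ≤ j → P (std a) j = 0 := by
    refine ⟨(Finset.range n).sup fun a => (P (std a)).support.sup id + 1, fun a ha j hj => ?_⟩
    by_contra h
    have h1 : j ≤ (P (std a)).support.sup id :=
      Finset.le_sup (f := id) (Finsupp.mem_support_iff.2 h)
    have h2 := Finset.le_sup (f := fun a => (P (std a)).support.sup id + 1)
      (Finset.mem_range.2 ha)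
    omega
  -- The indices `M, …, M + n - 1` are used as scratch space: they avoid the first `n` basis vectors
  -- and the supports of their images under `P`.
  let M := max L n
  -- `U` sends `e_a` to `e_a + t e_{M+a}`, and `U'` sends `e_{M+a}` to `e_{M+a} + t⁻¹ (P e_a -
  -- e_a)`. The product sends `e_a` to `P e_a + t e_{M+a}`, which tends to `P e_a` as `t` tends to
  -- zero, without any invertibility of `P`.
  refine ⟨Finsupp.linearCombination K fun a => std (M + a), fun t ht => ?_⟩
  obtain ⟨U, hU, hU1, -⟩ := exists_block_mem hT (fun a => t • std (M + a)) (Finset.range n) (by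
    intro b _ j hj
    rw [Finset.mem_range] at hj
    have : M + b ≠ j := by omega
    simp [std, this])
  obtain ⟨U', hU', hU1', hU2'⟩ := exists_block_mem hT
    (fun a => t⁻¹ • (P (std (a - M)) - std (a - M))) (Finset.Ico M (M + n)) (by
    intro b hb j hj
    rw [Finset.mem_Ico] at hb hj
    have h1 : b - M ≠ j := by omega
    have h2 := hL (b - M) (by omega) j (by omega)
    simp [std, h1]
    exact Or.inr h2)
  refine ⟨U' * U, T.mul_mem hU' hU, fun a ha => ?_⟩
  rw [Module.End.mul_apply, hU1 a (Finset.mem_range.2 ha), map_add, map_smul,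
    hU1' (M + a) (Finset.mem_Ico.2 ⟨by omega, by omega⟩), Nat.add_sub_cancel_left,
    hU2' (std a) fun j hj => by
      rw [Finset.mem_Ico] at hj
      have : a ≠ j := by omega
      simp [std, this]]
  simp only [smul_add, smul_smul, mul_inv_cancel₀ ht, one_smul, LinearMap.add_apply,
    LinearMap.smul_apply, std, Finsupp.linearCombination_single]
  abel

/-- An equation of `C` sees only finitely many entries. Restricted to a suitable line it is a
polynomial in `t` that vanishes for `t ≠ 0`, and hence also at `0` because `K` is infinite. -/
theorem mem_of_line [Infinite K] {C : Set (TupleSpace K ι β α γ)}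
    (hC : IsZClosed (tuplePoly K ι β α γ) C) {m : TupleSpace K ι β α γ}
    (h : ∀ n, ∃ m', ∀ t : K, t ≠ 0 → ∃ m'' ∈ C, AgreeUpTo n m'' (m + t • m')) : m ∈ C := by
  by_contra hm
  obtain ⟨f, hf, h0, h1⟩ := hC m hm
  obtain ⟨n, hn⟩ := exists_dependsUpTo hf
  obtain ⟨m', hm'⟩ := h n
  obtain ⟨p, hp⟩ := exists_polynomial_line hf m m'
  apply h1
  have := hp 0
  rw [zero_smul, add_zero] at this
  rw [this]
  refine polynomial_eval_eq_zero (Set.finite_singleton 0) (fun t ht => ?_) 0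
  obtain ⟨m'', hm'', ha⟩ := hm' t ht
  rw [← hp, ← hn _ _ ha]
  exact h0 _ hm''

/-- A closed set that is stable under elementary row and column operations is stable under all
pairs of endomorphisms. -/
theorem tupleClosed_of_elementary [Infinite K] {C : Set (TupleSpace K ι β α γ)}
    (hC : IsZClosed (tuplePoly K ι β α γ) C)
    (hrow : ∀ i k, i ≠ k → ∀ t : K, ∀ m ∈ C, tupleAct (shear i (t • std k)) 1 m ∈ C)
    (hcol : ∀ i k, i ≠ k → ∀ t : K, ∀ m ∈ C, tupleAct 1 (shear i (t • std k)) m ∈ C) :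
    TupleClosed C := by
  refine ⟨hC, fun P Q m hm => ?_⟩
  let TP : Submonoid (Module.End K (Vec K)) :=
    { carrier := {P | ∀ m ∈ C, tupleAct P 1 m ∈ C}
      one_mem' := fun m hm => hm
      mul_mem' := fun {a b} ha hb m hm => hb _ (ha m hm) }
  let TQ : Submonoid (Module.End K (Vec K)) :=
    { carrier := {P | ∀ m ∈ C, tupleAct 1 P m ∈ C}
      one_mem' := fun m hm => hm
      mul_mem' := fun {a b} ha hb m hm => hb _ (ha m hm) }
  have hP : P ∈ TP := end_mem (T := TP) hrow (fun P hP m hm => mem_of_line hC fun n => by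
    obtain ⟨N, hN⟩ := hP n
    refine ⟨(fun x => (m.1 x).compl₁₂ N LinearMap.id, fun x => m.2.1 x ∘ₗ N, 0, 0), fun t ht => ?_⟩
    obtain ⟨S, hS, hS'⟩ := hN t ht
    refine ⟨_, hS m hm, ?_, ?_, ?_, ?_⟩
    · intro x a ha b hb
      simp [tupleAct, hS' a ha]
    · intro x a ha
      simp [tupleAct, hS' a ha]
    · intro x a ha
      simp [tupleAct]
    · simp [tupleAct]) P
  have hQ : Q ∈ TQ := end_mem (T := TQ) hcol (fun P hP m hm => mem_of_line hC fun n => by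
    obtain ⟨N, hN⟩ := hP n
    refine ⟨(fun x => (m.1 x).compl₁₂ LinearMap.id N, 0, fun x => m.2.2.1 x ∘ₗ N, 0), fun t ht => ?_⟩
    obtain ⟨S, hS, hS'⟩ := hN t ht
    refine ⟨_, hS m hm, ?_, ?_, ?_, ?_⟩
    · intro x a ha b hb
      simp [tupleAct, hS' b hb]
    · intro x a ha
      simp [tupleAct]
    · intro x a ha
      simp [tupleAct, hS' a ha]
    · simp [tupleAct]) Q
  exact hQ _ (hP m hm)

end Elementary

end InfWedge
end

noncomputable section

namespace InfWedge

/-! ### Pfaffians -/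

section Pfaffian

universe u

variable {R S : Type u} [CommRing R] [CommRing S]

/-- Only the entries above the diagonal occur in the sum, so skew-symmetry never has to be checked.
-/
theorem pfaffian_congr {m : ℕ} {A B : Matrix (Fin (2 * m)) (Fin (2 * m)) R}
    (h : ∀ a b, a < b → A a b = B a b) : pfaffian m A = pfaffian m B := by
  refine Finset.sum_congr rfl fun σ hσ => ?_
  rw [Finset.mem_filter] at hσ
  congr 1
  exact Finset.prod_congr rfl fun i _ => h _ _ (hσ.2.1 i)

theorem map_pfaffian (f : R →+* S) {m : ℕ} (A : Matrix (Fin (2 * m)) (Fin (2 * m)) R) :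
    f (pfaffian m A) = pfaffian m fun a b => f (A a b) := by
  simp only [pfaffian, map_sum, map_zsmul, map_prod]

theorem pfaffian_mem {k : Type*} [CommRing k] [Algebra k R] (O : Subalgebra k R) {m : ℕ}
    {A : Matrix (Fin (2 * m)) (Fin (2 * m)) R} (h : ∀ a b, a < b → A a b ∈ O) :
    pfaffian m A ∈ O := by
  refine O.sum_mem fun σ hσ => ?_
  rw [Finset.mem_filter] at hσ
  exact O.zsmul_mem (O.prod_mem fun i _ => h _ _ (hσ.2.1 i)) _

/-- The upper left block of size `2 m`. -/
def block {m : ℕ} (A : Matrix (Fin (2 * (m + 1))) (Fin (2 * (m + 1))) R) :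
    Matrix (Fin (2 * m)) (Fin (2 * m)) R :=
  fun a b => A (Fin.castLE (by omega) a) (Fin.castLE (by omega) b)

/-- The predicate cutting out the permutations over which the sum in `pfaffian` extends. -/
def IsMatching {m : ℕ} (σ : Equiv.Perm (Fin (2 * m))) : Prop :=
  (∀ i : Fin m, σ ⟨2 * i, by omega⟩ < σ ⟨2 * i + 1, by omega⟩) ∧
    (∀ i j : Fin m, i < j → σ ⟨2 * i, by omega⟩ < σ ⟨2 * j, by omega⟩)

/-- The permutation fixes the last two indices. -/
def FixesLast {m : ℕ} (σ : Equiv.Perm (Fin (2 * (m + 1)))) : Prop :=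
  (σ ⟨2 * m, by omega⟩ : ℕ) = 2 * m ∧ (σ ⟨2 * m + 1, by omega⟩ : ℕ) = 2 * m + 1

/-- The pairs of a matching are listed by increasing first elements, so the pair of the two largest
indices can only be the last one. -/
theorem fixesLast_of_pair {m : ℕ} {σ : Equiv.Perm (Fin (2 * (m + 1)))} (h : IsMatching σ)
    (i : Fin (m + 1)) (h1 : (σ ⟨2 * i, by omega⟩ : ℕ) = 2 * m)
    (h2 : (σ ⟨2 * i + 1, by omega⟩ : ℕ) = 2 * m + 1) : FixesLast σ := by
  have hi : (i : ℕ) = m := by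
    by_contra hne
    have h3 := h.2 i ⟨m, by omega⟩ (by rw [Fin.lt_def]; simp only; omega)
    have h4 := h.1 ⟨m, by omega⟩
    rw [Fin.lt_def] at h3 h4
    simp only at h3 h4
    omega
  constructor
  · simpa only [hi] using h1
  · simpa only [hi] using h2

/-- The embedding of the first `2 m` indices. -/
def initEmb (m : ℕ) : Fin (2 * m) ↪ Fin (2 * (m + 1)) := Fin.castLEEmb (by omega)

theorem exists_restrict {m : ℕ} {σ : Equiv.Perm (Fin (2 * (m + 1)))} (h : FixesLast σ) :
    ∃ τ : Equiv.Perm (Fin (2 * m)), τ.viaFintypeEmbedding (initEmb m) = σ := by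
  have hlt : ∀ a : Fin (2 * m), (σ (initEmb m a) : ℕ) < 2 * m := by
    intro a
    have h1 : σ (initEmb m a) ≠ σ ⟨2 * m, by omega⟩ := fun e => by
      have := congrArg Fin.val (σ.injective e)
      simp [initEmb] at this
      omega
    have h2 : σ (initEmb m a) ≠ σ ⟨2 * m + 1, by omega⟩ := fun e => by
      have := congrArg Fin.val (σ.injective e)
      simp [initEmb] at this
      omega
    rw [Ne, Fin.ext_iff, h.1] at h1
    rw [Ne, Fin.ext_iff, h.2] at h2
    omega
  have hinj : Function.Injective fun a : Fin (2 * m) => (⟨σ (initEmb m a), hlt a⟩ : Fin (2 * m)) := by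
    intro a b hab
    have := congrArg Fin.val hab
    exact (initEmb m).injective (σ.injective (Fin.ext this))
  refine ⟨Equiv.ofBijective _ (Finite.injective_iff_bijective.1 hinj), ?_⟩
  ext b
  by_cases hb : (b : ℕ) < 2 * m
  · have : b = initEmb m ⟨b, hb⟩ := rfl
    rw [this, Equiv.Perm.viaFintypeEmbedding_apply_image]
    rfl
  · rw [Equiv.Perm.viaFintypeEmbedding_apply_notMem_range]
    · have : (b : ℕ) = 2 * m ∨ (b : ℕ) = 2 * m + 1 := by omega
      rcases this with hb | hb
      · rw [show b = ⟨2 * m, by omega⟩ from Fin.ext hb, h.1]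
      · rw [show b = ⟨2 * m + 1, by omega⟩ from Fin.ext hb, h.2]
    · rintro ⟨a, rfl⟩
      exact hb a.2

theorem via_apply_lt {m : ℕ} (τ : Equiv.Perm (Fin (2 * m))) (k : ℕ) (hk : k < 2 * m) :
    τ.viaFintypeEmbedding (initEmb m) ⟨k, by omega⟩ = initEmb m (τ ⟨k, hk⟩) :=
  τ.viaFintypeEmbedding_apply_image (initEmb m) ⟨k, hk⟩

theorem via_apply_ge {m : ℕ} (τ : Equiv.Perm (Fin (2 * m))) (k : ℕ) (hk : 2 * m ≤ k)
    (hk' : k < 2 * (m + 1)) :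
    τ.viaFintypeEmbedding (initEmb m) ⟨k, hk'⟩ = ⟨k, hk'⟩ := by
  refine τ.viaFintypeEmbedding_apply_notMem_range (initEmb m) ?_
  rintro ⟨a, ha⟩
  have := congrArg Fin.val ha
  simp [initEmb] at this
  omega

theorem fixesLast_via {m : ℕ} (τ : Equiv.Perm (Fin (2 * m))) :
    FixesLast (τ.viaFintypeEmbedding (initEmb m)) :=
  ⟨by rw [via_apply_ge τ _ le_rfl], by rw [via_apply_ge τ _ (by omega)]⟩

theorem isMatching_via {m : ℕ} (τ : Equiv.Perm (Fin (2 * m))) :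
    IsMatching (τ.viaFintypeEmbedding (initEmb m)) ↔ IsMatching τ := by
  have hemb : ∀ a b, initEmb m a < initEmb m b ↔ a < b := fun a b => Iff.rfl
  constructor
  · intro h
    constructor
    · intro i
      have := h.1 ⟨i, by omega⟩
      rwa [via_apply_lt τ (2 * i) (by omega), via_apply_lt τ (2 * i + 1) (by omega), hemb] at this
    · intro i j hij
      have := h.2 ⟨i, by omega⟩ ⟨j, by omega⟩ hij
      rwa [via_apply_lt τ (2 * i) (by omega), via_apply_lt τ (2 * j) (by omega), hemb] at this
  · intro h
    constructor
    · intro i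
      by_cases hi : (i : ℕ) < m
      · rw [via_apply_lt τ (2 * i) (by omega), via_apply_lt τ (2 * i + 1) (by omega), hemb]
        exact h.1 ⟨i, hi⟩
      · rw [via_apply_ge τ (2 * i) (by omega), via_apply_ge τ (2 * i + 1) (by omega), Fin.lt_def]
        simp
    · intro i j hij
      rw [Fin.lt_def] at hij
      by_cases hj : (j : ℕ) < m
      · rw [via_apply_lt τ (2 * i) (by omega), via_apply_lt τ (2 * j) (by omega), hemb]
        exact h.2 ⟨i, by omega⟩ ⟨j, hj⟩ hij
      · rw [via_apply_lt τ (2 * i) (by omega), via_apply_ge τ (2 * j) (by omega), Fin.lt_def]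
        have : ((initEmb m) (τ ⟨2 * i, by omega⟩) : ℕ) < 2 * m := (τ _).2
        simp only
        omega

/-- The matrix with its last entry replaced by zero. -/
def zeroLast {m : ℕ} (A : Matrix (Fin (2 * (m + 1))) (Fin (2 * (m + 1))) R) :
    Matrix (Fin (2 * (m + 1))) (Fin (2 * (m + 1))) R :=
  fun a b => if (a : ℕ) = 2 * m ∧ (b : ℕ) = 2 * m + 1 then 0 else A a b

open Classical in
/-- Expansion of a Pfaffian with respect to its last entry. -/
theorem pfaffian_succ {m : ℕ} (A : Matrix (Fin (2 * (m + 1))) (Fin (2 * (m + 1))) R) :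
    pfaffian (m + 1) A = A ⟨2 * m, by omega⟩ ⟨2 * m + 1, by omega⟩ * pfaffian m (block A) +
      pfaffian (m + 1) (zeroLast A) := by
  have hpf : ∀ (n : ℕ) (B : Matrix (Fin (2 * n)) (Fin (2 * n)) R), pfaffian n B =
      ∑ σ : Equiv.Perm (Fin (2 * n)) with IsMatching σ, ((Equiv.Perm.sign σ : ℤˣ) : ℤ) •
        ∏ i : Fin n, B (σ ⟨2 * i, by omega⟩) (σ ⟨2 * i + 1, by omega⟩) := by
    intro n B
    unfold pfaffian IsMatching
    congr
  rw [hpf (m + 1) A, hpf (m + 1) (zeroLast A), hpf m]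
  -- The matchings are split according to whether they contain the pair of the two last indices.
  -- Those that do correspond to matchings of the upper left block, with the same sign; the others
  -- do not see the last entry.
  rw [← Finset.sum_filter_add_sum_filter_not _ FixesLast]
  rw [← Finset.sum_filter_add_sum_filter_not
    (Finset.univ.filter fun σ : Equiv.Perm (Fin (2 * (m + 1))) => IsMatching σ) FixesLast
    (fun σ => ((Equiv.Perm.sign σ : ℤˣ) : ℤ) • ∏ i : Fin (m + 1),
      zeroLast A (σ ⟨2 * i, by omega⟩) (σ ⟨2 * i + 1, by omega⟩))]
  have hz : ∑ σ ∈ (Finset.univ.filter fun σ : Equiv.Perm (Fin (2 * (m + 1))) =>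
      IsMatching σ) with FixesLast σ, (((Equiv.Perm.sign σ : ℤˣ) : ℤ) • ∏ i : Fin (m + 1),
      zeroLast A (σ ⟨2 * i, by omega⟩) (σ ⟨2 * i + 1, by omega⟩)) = 0 := by
    refine Finset.sum_eq_zero fun σ hσ => ?_
    rw [Finset.mem_filter] at hσ
    rw [Finset.prod_eq_zero (Finset.mem_univ (⟨m, by omega⟩ : Fin (m + 1))), smul_zero]
    exact if_pos hσ.2
  rw [hz, zero_add]
  congr 1
  · rw [Finset.mul_sum]
    symm
    refine Finset.sum_bij (fun τ _ => τ.viaFintypeEmbedding (initEmb m)) ?_ ?_ ?_ ?_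
    · intro τ hτ
      simp only [Finset.mem_filter, Finset.mem_univ, true_and] at hτ ⊢
      exact ⟨(isMatching_via τ).2 hτ, fixesLast_via τ⟩
    · intro τ _ τ' _ h
      ext a
      have := congrArg (fun σ => σ (initEmb m a)) h
      simp only [Equiv.Perm.viaFintypeEmbedding_apply_image] at this
      exact congrArg Fin.val ((initEmb m).injective this)
    · intro σ hσ
      simp only [Finset.mem_filter, Finset.mem_univ, true_and] at hσ
      obtain ⟨τ, rfl⟩ := exists_restrict hσ.2
      exact ⟨τ, by simpa using (isMatching_via τ).1 hσ.1, rfl⟩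
    · intro τ _
      rw [Equiv.Perm.viaFintypeEmbedding_sign, mul_smul_comm, Fin.prod_univ_castSucc,
        mul_comm (A _ _)]
      congr 2
      · refine Finset.prod_congr rfl fun i _ => ?_
        have h1 := via_apply_lt τ (2 * i) (by omega)
        have h2 := via_apply_lt τ (2 * i + 1) (by omega)
        simp only [Fin.val_castSucc]
        rw [h1, h2]
        rfl
      · simp only [Fin.val_last]
        rw [via_apply_ge τ (2 * m) le_rfl, via_apply_ge τ (2 * m + 1) (by omega)]
  · refine Finset.sum_congr rfl fun σ hσ => ?_
    simp only [Finset.mem_filter, Finset.mem_univ, true_and] at hσ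
    congr 1
    refine Finset.prod_congr rfl fun i _ => ?_
    rw [zeroLast, if_neg]
    rintro ⟨h1, h2⟩
    exact hσ.2 (fixesLast_of_pair hσ.1 i h1 h2)

open Polynomial

/-- The polynomials with coefficients in a subalgebra. -/
def coeffsIn {k : Type*} [CommRing k] [Algebra k R] (O : Subalgebra k R) : Subalgebra k R[X] where
  carrier := {p | ∀ d, p.coeff d ∈ O}
  mul_mem' := fun {p q} hp hq d => by
    rw [coeff_mul]
    exact O.sum_mem fun i _ => O.mul_mem (hp _) (hq _)
  add_mem' := fun {p q} hp hq d => by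
    rw [coeff_add]
    exact O.add_mem (hp _) (hq _)
  algebraMap_mem' := fun r d => by
    rw [IsScalarTower.algebraMap_apply k R R[X], Polynomial.algebraMap_eq, coeff_C]
    split_ifs
    exacts [O.algebraMap_mem r, O.zero_mem]

/-- If the Pfaffian of a matrix of polynomials vanishes, then the coefficients of its last entry
can be expressed in terms of those of the other entries after multiplication with the constant
coefficient of the Pfaffian of the upper left block. -/
theorem coeff_last_mul_mem {k : Type*} [CommRing k] [Algebra k R] (O : Subalgebra k R) {m : ℕ}
    (A : Matrix (Fin (2 * (m + 1))) (Fin (2 * (m + 1))) R[X]) (hA : pfaffian (m + 1) A = 0)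
    (hO : ∀ a b : Fin (2 * (m + 1)), a < b → ¬ ((a : ℕ) = 2 * m ∧ (b : ℕ) = 2 * m + 1) → A a b ∈ coeffsIn O)
    (d : ℕ) (hd : ∀ e < d, (A ⟨2 * m, by omega⟩ ⟨2 * m + 1, by omega⟩).coeff e ∈ O) :
    (A ⟨2 * m, by omega⟩ ⟨2 * m + 1, by omega⟩).coeff d * (pfaffian m (block A)).coeff 0 ∈ O := by
  classical
  rw [pfaffian_succ] at hA
  have h1 := pfaffian_mem (coeffsIn O) (m := m + 1)
    (A := zeroLast A)
    (fun a b hab => by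
      unfold zeroLast
      split_ifs with h
      · exact Subalgebra.zero_mem _
      · exact hO a b hab h) d
  have h2 : ∀ e, (pfaffian m (block A)).coeff e ∈ O := pfaffian_mem (coeffsIn O) fun a b hab =>
    hO _ _ hab fun h => by simp at h; omega
  have h3 := congrArg (fun p => coeff p d) hA
  simp only [coeff_add, coeff_zero, coeff_mul] at h3
  -- In degree `d`, the only term with the unknown coefficient of the last entry is its product with
  -- the constant coefficient of the block Pfaffian; all other terms involve coefficients of lower
  -- degree.
  rw [Finset.Nat.sum_antidiagonal_eq_sum_range_succ_mk, Finset.sum_range_succ, Nat.sub_self,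
    add_assoc] at h3
  rw [add_comm, add_assoc] at h3
  rw [eq_neg_of_add_eq_zero_left h3]
  refine O.neg_mem (O.add_mem h1 (O.sum_mem fun e he => ?_))
  exact O.mul_mem (hd e (Finset.mem_range.1 he)) (h2 _)

end Pfaffian

end InfWedge
end

noncomputable section

namespace InfWedge

/-! ### Semi-infinite wedge products -/

universe u

section Wedge

variable {K : Type u} [Field K]

/-- The underlying linear form of a point of the dual infinite wedge. -/
def linForm (ω : DualWedge K) : InfiniteWedge K →ₗ[K] K := ω

theorem eval_ι (z : InfiniteWedge K) (ω : DualWedge K) :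
    eval K (SymmetricAlgebra.ι K _ z) ω = linForm ω z :=
  SymmetricAlgebra.lift_ι_apply _ _

theorem linForm_smul (g : GInf K) (ω : DualWedge K) (z : InfiniteWedge K) :
    linForm (g • ω) z = linForm ω (actWedge K g⁻¹ z) := rfl

/-- The sequence `x_1, x_2, …`. -/
def basisSeq (k : ℕ) : VInf K := basisVec K (posIdx k)

/-- The sequence ends in `x_{p+1}, x_{p+2}, …`, and its first `p` entries lie in `V_{p,p}`. -/
def Tail (w : ℕ → VInf K) (p : ℕ) : Prop :=
  (∀ k, p ≤ k → w k = basisSeq k) ∧ ∀ k < p, w k ∈ VSub K (p, p)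

/-- The sequence eventually agrees with `x_1, x_2, …`. -/
def IsStd (w : ℕ → VInf K) : Prop := ∃ p, ∀ k, p ≤ k → w k = basisSeq k

theorem basisVec_mem {i : Idx} {q : ℕ × ℕ} (h : i ∈ range q) : basisVec K i ∈ VSub K q :=
  Submodule.subset_span ⟨i, h, rfl⟩

theorem posIdx_mem {k p n : ℕ} (h : k < p) : posIdx k ∈ range (n, p) := by
  constructor <;> simp only [posIdx] <;> omega

theorem posIdx_notMem {k p n : ℕ} (h : p ≤ k) : posIdx k ∉ range (n, p) := by
  rintro ⟨_, h2⟩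
  simp only [posIdx] at h2
  omega

theorem posIdx_injective : Function.Injective posIdx := by
  intro a b h
  have := congrArg Subtype.val h
  simp only [posIdx] at this
  omega

theorem Tail.mono {w : ℕ → VInf K} {p p' : ℕ} (h : Tail w p) (hp : p ≤ p') : Tail w p' := by
  refine ⟨fun k hk => h.1 k (hp.trans hk), fun k hk => ?_⟩
  by_cases hkp : k < p
  · exact VSub_mono K (Prod.mk_le_mk.2 ⟨hp, hp⟩) (h.2 k hkp)
  · rw [h.1 k (by omega)]
    exact basisVec_mem (posIdx_mem hk)

theorem exists_mem_VSub (v : VInf K) : ∃ p, v ∈ VSub K (p, p) := by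
  induction v using Finsupp.induction_linear with
  | zero => exact ⟨0, Submodule.zero_mem _⟩
  | add u v hu hv =>
    obtain ⟨p, hp⟩ := hu
    obtain ⟨p', hp'⟩ := hv
    exact ⟨max p p', Submodule.add_mem _
      (VSub_mono K (Prod.mk_le_mk.2 ⟨le_max_left _ _, le_max_left _ _⟩) hp)
      (VSub_mono K (Prod.mk_le_mk.2 ⟨le_max_right _ _, le_max_right _ _⟩) hp')⟩
  | single i c =>
    refine ⟨i.1.natAbs, ?_⟩
    have : (Finsupp.single i c : VInf K) = c • basisVec K i := by simp [basisVec]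
    rw [this]
    refine Submodule.smul_mem _ _ (basisVec_mem ?_)
    constructor <;> simp only <;> omega

theorem IsStd.exists_tail {w : ℕ → VInf K} (h : IsStd w) (P : ℕ) : ∃ p, P ≤ p ∧ Tail w p := by
  obtain ⟨p, hp⟩ := h
  choose q hq using fun k => exists_mem_VSub (w k)
  refine ⟨max P (max p ((Finset.range p).sup q)), le_max_left _ _, ?_⟩
  refine ⟨fun k hk => hp k (by omega), fun k hk => ?_⟩
  by_cases hkp : k < p
  · have : q k ≤ (Finset.range p).sup q := Finset.le_sup (Finset.mem_range.2 hkp)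
    exact VSub_mono K (Prod.mk_le_mk.2 ⟨by omega, by omega⟩) (hq k)
  · rw [hp k (by omega)]
    exact basisVec_mem (posIdx_mem hk)

/-- The product of the first `p` entries of a sequence. -/
def initProd (p : ℕ) (w : ℕ → VInf K) : ExteriorAlgebra K (VInf K) :=
  ExteriorAlgebra.ιMulti K p fun i : Fin p => w i

theorem initProd_succ (p : ℕ) (w : ℕ → VInf K) :
    initProd (p + 1) w = initProd p w * ExteriorAlgebra.ι K (w p) := by
  rw [initProd, initProd, ExteriorAlgebra.ιMulti_apply, ExteriorAlgebra.ιMulti_apply,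
    List.ofFn_succ', List.concat_eq_append, List.prod_append]
  simp

theorem ofFn_prod_mem {A : Type*} [Ring A] [Algebra K A] (S : Submodule K A) (n : ℕ)
    (f : Fin n → A) (hf : ∀ i, f i ∈ S) : (List.ofFn f).prod ∈ S ^ n := by
  induction n with
  | zero => simp [Submodule.one_le.mp le_rfl]
  | succ n ih =>
    rw [List.ofFn_succ, List.prod_cons, pow_succ']
    exact Submodule.mul_mem_mul (hf 0) (ih _ fun i => hf i.succ)

theorem initProd_mem {p : ℕ} {w : ℕ → VInf K} (h : Tail w p) : initProd p w ∈ Stage K (p, p) := by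
  rw [initProd, ExteriorAlgebra.ιMulti_apply]
  exact ofFn_prod_mem _ p _ fun i => Submodule.mem_map_of_mem (h.2 i i.2)

/-- A linear form on the exterior algebra that extends `ω` on the `(p, p)`-th stage. -/
def extForm (ω : DualWedge K) (p : ℕ) : ExteriorAlgebra K (VInf K) →ₗ[K] K :=
  (LinearMap.exists_extend (linForm ω ∘ₗ toWedge K (p, p))).choose

theorem extForm_apply (ω : DualWedge K) (p : ℕ) (z : Stage K (p, p)) :
    extForm ω p z = linForm ω (toWedge K (p, p) z) :=
  LinearMap.congr_fun (LinearMap.exists_extend (linForm ω ∘ₗ toWedge K (p, p))).choose_spec z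

/-- The value of `ω` on the wedge product of the first `p` entries. -/
def wedgeAt (ω : DualWedge K) (p : ℕ) : (VInf K) [⋀^Fin p]→ₗ[K] K :=
  (extForm ω p).compAlternatingMap (ExteriorAlgebra.ιMulti K p)

theorem wedgeAt_apply (ω : DualWedge K) {p : ℕ} {w : ℕ → VInf K} (h : Tail w p) :
    wedgeAt ω p (fun i => w i) = linForm ω (toWedge K (p, p) ⟨initProd p w, initProd_mem h⟩) :=
  extForm_apply ω p ⟨initProd p w, initProd_mem h⟩

theorem wedgeAt_succ (ω : DualWedge K) {p : ℕ} {w : ℕ → VInf K} (h : Tail w p) :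
    wedgeAt ω (p + 1) (fun i => w i) = wedgeAt ω p fun i => w i := by
  have hle : ((p, p) : ℕ × ℕ) ≤ (p + 1, p + 1) := Prod.mk_le_mk.2 ⟨by omega, by omega⟩
  rw [wedgeAt_apply ω h, wedgeAt_apply ω (h.mono (Nat.le_succ p)), ← toWedge_trans K _ _ hle]
  congr 2
  apply Subtype.ext
  rw [coe_trans]
  simp only [initProd_succ, add_tsub_cancel_left, tail, h.1 p le_rfl]
  simp [x, basisSeq]

theorem wedgeAt_eq (ω : DualWedge K) {p p' : ℕ} {w : ℕ → VInf K} (h : Tail w p) (hp : p ≤ p') :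
    wedgeAt ω p' (fun i => w i) = wedgeAt ω p fun i => w i := by
  induction hp with
  | refl => rfl
  | step hm ih => rw [← ih]; exact wedgeAt_succ ω (h.mono hm)

open Classical in
/-- The value of `ω` on the semi-infinite wedge product `w_0 ∧ w_1 ∧ ⋯`. -/
def wedge (ω : DualWedge K) (w : ℕ → VInf K) : K :=
  if h : ∃ p, Tail w p then wedgeAt ω h.choose fun i => w i else 0

theorem wedge_eq (ω : DualWedge K) {p : ℕ} {w : ℕ → VInf K} (h : Tail w p) :
    wedge ω w = wedgeAt ω p fun i => w i := by
  have he : ∃ p, Tail w p := ⟨p, h⟩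
  rw [wedge, dif_pos he]
  rcases le_total p he.choose with h' | h'
  · exact wedgeAt_eq ω h h'
  · exact (wedgeAt_eq ω he.choose_spec h').symm

theorem wedge_eq_linForm (ω : DualWedge K) {p : ℕ} {w : ℕ → VInf K} (h : Tail w p) :
    wedge ω w = linForm ω (toWedge K (p, p) ⟨initProd p w, initProd_mem h⟩) := by
  rw [wedge_eq ω h, wedgeAt_apply ω h]

theorem IsStd.update {w : ℕ → VInf K} (h : IsStd w) (k : ℕ) (u : VInf K) :
    IsStd (Function.update w k u) := by
  obtain ⟨p, hp⟩ := h
  refine ⟨max p (k + 1), fun j hj => ?_⟩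
  rw [Function.update_of_ne (by omega), hp j (by omega)]

theorem restrict_update (w : ℕ → VInf K) (p k : ℕ) (hk : k < p) (u : VInf K) :
    (fun i : Fin p => Function.update w k u i)
      = Function.update (fun i : Fin p => w i) ⟨k, hk⟩ u := by
  ext1 i
  by_cases h : i = ⟨k, hk⟩
  · subst h; simp
  · have : (i : ℕ) ≠ k := fun e => h (Fin.ext e)
    simp [h, this]

theorem wedge_update_add_smul (ω : DualWedge K) {w : ℕ → VInf K} (h : IsStd w) (k : ℕ)
    (u v : VInf K) (t : K) : wedge ω (Function.update w k (u + t • v)) =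
      wedge ω (Function.update w k u) + t * wedge ω (Function.update w k v) := by
  obtain ⟨p1, -, h1⟩ := (h.update k (u + t • v)).exists_tail 0
  obtain ⟨p2, -, h2⟩ := (h.update k u).exists_tail 0
  obtain ⟨p3, -, h3⟩ := (h.update k v).exists_tail 0
  let p := max (max p1 p2) (max p3 (k + 1))
  have hk : k < p := by omega
  rw [wedge_eq ω (h1.mono (show p1 ≤ p by omega)), wedge_eq ω (h2.mono (show p2 ≤ p by omega)),
    wedge_eq ω (h3.mono (show p3 ≤ p by omega)), restrict_update _ _ _ hk,
    restrict_update _ _ _ hk, restrict_update _ _ _ hk, AlternatingMap.map_update_add,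
    AlternatingMap.map_update_smul, smul_eq_mul]

theorem wedge_eq_zero (ω : DualWedge K) {w : ℕ → VInf K} (h : IsStd w) {i j : ℕ} (hij : i ≠ j)
    (hw : w i = w j) : wedge ω w = 0 := by
  obtain ⟨p, hp, h'⟩ := h.exists_tail (max i j + 1)
  rw [wedge_eq ω h']
  exact (wedgeAt ω p).map_eq_zero_of_eq _ (i := ⟨i, by omega⟩) (j := ⟨j, by omega⟩) hw
    (by simpa using hij)

theorem IsStd.comp_perm {w : ℕ → VInf K} (h : IsStd w) {p : ℕ} (σ : Equiv.Perm (Fin p)) :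
    IsStd fun k => if hk : k < p then w (σ ⟨k, hk⟩) else w k := by
  obtain ⟨q, hq⟩ := h
  refine ⟨max p q, fun k hk => ?_⟩
  exact (dif_neg (by omega)).trans (hq k (by omega))

theorem wedge_comp_perm (ω : DualWedge K) {w : ℕ → VInf K} (h : IsStd w) {p : ℕ}
    (σ : Equiv.Perm (Fin p)) :
    wedge ω (fun k => if hk : k < p then w (σ ⟨k, hk⟩) else w k) =
      Equiv.Perm.sign σ • wedge ω w := by
  obtain ⟨p1, h0, h1⟩ := h.exists_tail p
  obtain ⟨p2, -, h2⟩ := (h.comp_perm σ).exists_tail 0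
  let q := max p1 p2
  have hpq : p ≤ q := by omega
  rw [wedge_eq ω (h1.mono (show p1 ≤ q by omega)), wedge_eq ω (h2.mono (show p2 ≤ q by omega))]
  let τ : Equiv.Perm (Fin q) := σ.viaFintypeEmbedding (Fin.castLEEmb hpq)
  have hτ : Equiv.Perm.sign τ = Equiv.Perm.sign σ := Equiv.Perm.viaFintypeEmbedding_sign _ _
  rw [← hτ, ← AlternatingMap.map_perm]
  congr 1
  ext1 i
  by_cases hi : (i : ℕ) < p
  · simp only [hi, dite_true, Function.comp_apply]
    have : τ i = Fin.castLEEmb hpq (σ ⟨i, hi⟩) :=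
      σ.viaFintypeEmbedding_apply_image (Fin.castLEEmb hpq) ⟨i, hi⟩
    rw [this]; rfl
  · simp only [hi, dite_false, Function.comp_apply]
    have : τ i = i := σ.viaFintypeEmbedding_apply_notMem_range (Fin.castLEEmb hpq) (by
      rintro ⟨a, rfl⟩
      exact hi a.2)
    rw [this]

theorem wedge_swap (ω : DualWedge K) {w : ℕ → VInf K} (h : IsStd w) {i j : ℕ} (hij : i ≠ j) :
    wedge ω (w ∘ Equiv.swap i j) = - wedge ω w := by
  obtain ⟨p1, h0, h1⟩ := h.exists_tail (max i j + 1)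
  have h2 : IsStd (w ∘ Equiv.swap i j) := by
    refine ⟨p1, fun k hk => ?_⟩
    rw [Function.comp_apply, Equiv.swap_apply_of_ne_of_ne (by omega) (by omega), h1.1 k hk]
  obtain ⟨p2, -, h2⟩ := h2.exists_tail 0
  let q := max p1 p2
  rw [wedge_eq ω (h1.mono (show p1 ≤ q by omega)), wedge_eq ω (h2.mono (show p2 ≤ q by omega))]
  rw [← AlternatingMap.map_swap (wedgeAt ω q) _
    (show (⟨i, by omega⟩ : Fin q) ≠ ⟨j, by omega⟩ by simpa using hij)]
  congr 1
  ext1 k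
  simp only [Function.comp_apply]
  congr 1
  rw [Equiv.swap_apply_def, Equiv.swap_apply_def]
  simp only [Fin.ext_iff]
  split_ifs <;> rfl

theorem IsStd.piecewise {w v : ℕ → VInf K} (h : IsStd w) (S : Finset ℕ) :
    IsStd fun k => if k ∈ S then v k else w k := by
  obtain ⟨p, hp⟩ := h
  refine ⟨max p (S.sup id + 1), fun k hk => ?_⟩
  have : k ∉ S := fun hS => by
    have := Finset.le_sup (f := id) hS
    simp only [id] at this
    omega
  exact (if_neg this).trans (hp k (by omega))

/-- Expansion of a wedge product in which some of the entries vary along lines. -/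
theorem wedge_expand (ω : DualWedge K) (S : Finset ℕ) (v : ℕ → VInf K) (t : K) :
    ∀ {w : ℕ → VInf K}, IsStd w → wedge ω (fun k => if k ∈ S then w k + t • v k else w k) =
      ∑ T ∈ S.powerset, t ^ T.card * wedge ω fun k => if k ∈ T then v k else w k := by
  induction S using Finset.induction_on with
  | empty => intro w _; simp
  | insert c S hc ih =>
    intro w hw
    have e1 : (fun k => if k ∈ insert c S then w k + t • v k else w k) =
        Function.update (fun k => if k ∈ S then w k + t • v k else w k) c (w c + t • v c) := by
      ext1 k
      by_cases h : k = c
      · subst h; simp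
      · simp [h]
    have e2 : Function.update (fun k => if k ∈ S then w k + t • v k else w k) c (w c) =
        fun k => if k ∈ S then w k + t • v k else w k := by
      ext1 k
      by_cases h : k = c
      · subst h; simp [hc]
      · simp [h]
    have e3 : Function.update (fun k => if k ∈ S then w k + t • v k else w k) c (v c) =
        fun k => if k ∈ S then Function.update w c (v c) k + t • v k
          else Function.update w c (v c) k := by
      ext1 k
      by_cases h : k = c
      · subst h; simp [hc]
      · simp [h]
    rw [e1, wedge_update_add_smul ω (hw.piecewise (v := fun k => w k + t • v k) S), e2, e3, ih hw,
      ih (hw.update c (v c)), Finset.sum_powerset_insert hc, Finset.mul_sum]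
    congr 1
    refine Finset.sum_congr rfl fun T hT => ?_
    have hcT : c ∉ T := fun h => hc (Finset.mem_powerset.1 hT h)
    rw [Finset.card_insert_of_notMem hcT, pow_succ', mul_assoc]
    congr 3
    ext1 k
    by_cases h : k = c
    · subst h; simp [hcT]
    · simp [h]

theorem exists_GSub_ge (g : GInf K) : ∃ P, ∀ p, P ≤ p → (g : VInf K ≃ₗ[K] VInf K) ∈ GSub K (p, p) :=
  ⟨max (level K g).1 (level K g).2, fun p hp => GSub_mono K
    (show level K g ≤ (p, p) from ⟨by simp only; omega, by simp only; omega⟩) (level_spec K g)⟩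

theorem Tail.map {w : ℕ → VInf K} {p : ℕ} (h : Tail w p) {g : VInf K ≃ₗ[K] VInf K}
    (hg : g ∈ GSub K (p, p)) : Tail (fun k => g (w k)) p := by
  refine ⟨fun k hk => ?_, fun k hk => ?_⟩
  · simp only [h.1 k hk]
    exact hg.2 _ (posIdx_notMem hk)
  · rw [← hg.1]
    exact Submodule.mem_map_of_mem (h.2 k hk)

theorem wedge_smul (g : GInf K) (ω : DualWedge K) {w : ℕ → VInf K} (h : IsStd w) :
    wedge (g • ω) w = wedge ω fun k => ((g⁻¹ : GInf K) : VInf K ≃ₗ[K] VInf K) (w k) := by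
  obtain ⟨P, hP⟩ := exists_GSub_ge g⁻¹
  obtain ⟨p, hp, h1⟩ := h.exists_tail P
  rw [wedge_eq_linForm _ h1, wedge_eq_linForm _ (h1.map (hP p hp)), linForm_smul,
    actWedge_toWedge K _ _ (hP p hp)]
  congr 2
  apply Subtype.ext
  change extMap K _ (initProd p w) = _
  rw [initProd, extMap, ExteriorAlgebra.map_apply_ιMulti]
  rfl

/-! ### Coordinates -/

/-- The sequence of indices eventually agrees with `1, 2, …`. -/
def IsStdIdx (I : ℕ → Idx) : Prop := ∃ p, ∀ k, p ≤ k → I k = posIdx k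

theorem IsStdIdx.isStd {I : ℕ → Idx} (h : IsStdIdx I) : IsStd fun k => basisVec K (I k) := by
  obtain ⟨p, hp⟩ := h
  exact ⟨p, fun k hk => congrArg (basisVec K) (hp k hk)⟩

/-- The coordinate of `ω` at `x_{I 0} ∧ x_{I 1} ∧ ⋯`. -/
def coord (I : ℕ → Idx) (ω : DualWedge K) : K := wedge ω fun k => basisVec K (I k)

-- Every element of the wedge comes from a stage `(p, p)`, which is spanned by products of `p` basis
-- vectors. Repeated and unordered indices are allowed, so no sorting is needed here.
open scoped Pointwise in
theorem linForm_mem_span (z : InfiniteWedge K) :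
    (fun ω : DualWedge K => linForm ω z) ∈
      Submodule.span K (coord (K := K) '' {I | IsStdIdx I}) := by
  let Φ : InfiniteWedge K →ₗ[K] (DualWedge K → K) :=
    { toFun := fun z ω => linForm ω z
      map_add' := fun a b => funext fun ω => map_add (linForm ω) a b
      map_smul' := fun c a => funext fun ω => map_smul (linForm ω) c a }
  change Φ z ∈ _
  obtain ⟨q, -, y, rfl⟩ := exists_toWedge K 0 z
  let p := max q.1 q.2
  have hqp : q ≤ (p, p) := ⟨le_max_left _ _, le_max_right _ _⟩
  rw [← toWedge_trans K q (p, p) hqp]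
  generalize trans K q (p, p) hqp y = y
  obtain ⟨y, hy⟩ := y
  have hy' : y ∈ Submodule.span K
      ((ExteriorAlgebra.ι K '' (basisVec K '' range (p, p))) ^ p) := by
    rw [← Submodule.span_pow]
    rwa [Stage, VSub, Submodule.map_span] at hy
  have hle : Submodule.span K ((ExteriorAlgebra.ι K '' (basisVec K '' range (p, p))) ^ p) =
      Stage K (p, p) := by
    rw [← Submodule.span_pow, Stage, VSub, Submodule.map_span]
  have key : ∀ y (hy : y ∈ Submodule.span K
      ((ExteriorAlgebra.ι K '' (basisVec K '' range (p, p))) ^ p)),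
      Φ (toWedge K (p, p) ⟨y, hle ▸ hy⟩) ∈
      Submodule.span K (coord (K := K) '' {I | IsStdIdx I}) := by
    intro y hy
    induction hy using Submodule.span_induction with
    | mem y hy =>
      obtain ⟨f, rfl⟩ := Set.mem_pow.1 hy
      have hf : ∀ i, ∃ j ∈ range (p, p), x K j = (f i : ExteriorAlgebra K (VInf K)) := by
        intro i
        obtain ⟨_, ⟨j, hj, rfl⟩, hj'⟩ := (f i).2
        exact ⟨j, hj, hj'⟩
      choose j hj hj' using hf
      let I : ℕ → Idx := fun k => if hk : k < p then j ⟨k, hk⟩ else posIdx k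
      have hI : IsStdIdx I := ⟨p, fun k hk => dif_neg (by omega)⟩
      have hT : Tail (fun k => basisVec K (I k)) p := by
        refine ⟨fun k hk => ?_, fun k hk => ?_⟩
        · simp only [I]; rw [dif_neg (by omega)]; rfl
        · simp only [I]; rw [dif_pos hk]; exact basisVec_mem (hj _)
      refine Submodule.subset_span ⟨I, hI, ?_⟩
      ext ω
      rw [coord, wedge_eq_linForm ω hT]
      change linForm ω _ = linForm ω _
      congr 2
      apply Subtype.ext
      simp only [initProd, ExteriorAlgebra.ιMulti_apply]
      congr 2
      ext1 i
      rw [← hj']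
      simp [I, x]
    | zero =>
      have : (⟨0, hle ▸ Submodule.zero_mem _⟩ : Stage K (p, p)) = 0 := rfl
      rw [this, map_zero, map_zero]; exact Submodule.zero_mem _
    | add a b ha hb iha ihb =>
      have : (⟨a + b, hle ▸ Submodule.add_mem _ ha hb⟩ : Stage K (p, p)) =
        ⟨a, hle ▸ ha⟩ + ⟨b, hle ▸ hb⟩ := rfl
      rw [this, map_add, map_add]; exact Submodule.add_mem _ iha ihb
    | smul c a ha iha =>
      have : (⟨c • a, hle ▸ Submodule.smul_mem _ c ha⟩ : Stage K (p, p)) =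
        c • ⟨a, hle ▸ ha⟩ := rfl
      rw [this, map_smul, map_smul]; exact Submodule.smul_mem _ _ iha
  exact key y hy'

theorem eval_mem_adjoin (f : CoordRing K) : (fun ω : DualWedge K => eval K f ω) ∈
    Algebra.adjoin K (coord (K := K) '' {I | IsStdIdx I}) := by
  induction f using SymmetricAlgebra.induction with
  | algebraMap r =>
    convert Subalgebra.algebraMap_mem _ r using 1
    ext ω
    simp [eval]
  | ι z =>
    have := linForm_mem_span z
    simp only [eval_ι]
    exact Algebra.span_le_adjoin K _ this
  | mul a b ha hb =>
    convert Subalgebra.mul_mem _ ha hb using 1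
    ext ω
    simp [eval]
  | add a b ha hb =>
    convert Subalgebra.add_mem _ ha hb using 1
    ext ω
    simp [eval]

end Wedge

end InfWedge
end

noncomputable section

namespace InfWedge

/-! ### The Pfaffians in terms of semi-infinite wedge products -/

universe u

section PfaffianRelations

variable {K : Type u} [Field K]

theorem initProd_add (w : ℕ → VInf K) (p m : ℕ) (h : ∀ k, p ≤ k → w k = basisSeq k) :
    initProd (p + m) w = initProd p w * tail K p m := by
  induction m with
  | zero => simp [tail]
  | succ m ih =>
    rw [← add_assoc, initProd_succ, ih, ← tail_mul_tail K p m 1, mul_assoc, h _ (by omega)]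
    simp [tail, x, basisSeq]

/-- The Pfaffians live in rectangular stages, while `wedge` is computed in square ones; multiplying
with a standard tail passes from one to the other. -/
theorem linForm_toWedge (ω : DualWedge K) (q : ℕ × ℕ) (z : Stage K q) {w : ℕ → VInf K}
    (hw : ∀ k, q.2 ≤ k → w k = basisSeq k) (hmem : ∀ k < q.2, w k ∈ VSub K q)
    (hz : (z : ExteriorAlgebra K (VInf K)) = initProd q.2 w) :
    linForm ω (toWedge K q z) = wedge ω w := by
  let p := max q.1 q.2
  have hqp : q ≤ (p, p) := ⟨le_max_left _ _, le_max_right _ _⟩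
  have hT : Tail w p := by
    refine ⟨fun k hk => hw k ((le_max_right _ _).trans hk), fun k hk => ?_⟩
    by_cases h : k < q.2
    · exact VSub_mono K hqp (hmem k h)
    · rw [hw k (by omega)]
      exact basisVec_mem (posIdx_mem hk)
  rw [wedge_eq_linForm ω hT, ← toWedge_trans K q (p, p) hqp]
  congr 2
  apply Subtype.ext
  rw [coe_trans, hz, ← initProd_add w _ _ hw]
  change initProd (q.2 + (p - q.2)) w = _
  rw [Nat.add_sub_cancel' (le_max_right _ _)]

/-- The sequence `u, v, w_2, w_3, …`. -/
def pairSeq {α : Type*} (u v : α) (w : ℕ → α) (k : ℕ) : α :=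
  if k = 0 then u else if k = 1 then v else w k

theorem IsStd.pairSeq {w : ℕ → VInf K} (h : IsStd w) (u v : VInf K) : IsStd (pairSeq u v w) := by
  obtain ⟨p, hp⟩ := h
  refine ⟨p + 2, fun k hk => ?_⟩
  simp only [InfWedge.pairSeq]
  rw [if_neg (by omega), if_neg (by omega), hp k (by omega)]

theorem isStd_basisSeq : IsStd (basisSeq (K := K)) := ⟨0, fun _ _ => rfl⟩

/-- The increasing enumeration of the natural numbers other than `a` and `b`, for `a < b`. -/
def skip (a b k : ℕ) : ℕ := if k < a then k else if k + 1 < b then k + 1 else k + 2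

theorem skip_strictMono (a b : ℕ) : StrictMono (skip a b) := by
  intro i j hij
  unfold skip
  split_ifs <;> omega

theorem skip_ne {a b : ℕ} (h : a < b) (k : ℕ) : skip a b k ≠ a ∧ skip a b k ≠ b := by
  unfold skip
  split_ifs <;> omega

theorem exists_skip {a b c : ℕ} (h : a < b) (ha : c ≠ a) (hb : c ≠ b) :
    ∃ k, skip a b k = c ∧ k ≤ c ∧ (b < c → k + 2 = c) := by
  rcases lt_or_ge c a with h1 | h1
  · exact ⟨c, if_pos h1, le_rfl, by omega⟩
  · rcases lt_or_ge c b with h2 | h2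
    · exact ⟨c - 1, by unfold skip; split_ifs <;> omega, by omega, by omega⟩
    · exact ⟨c - 2, by unfold skip; split_ifs <;> omega, by omega, by omega⟩

theorem skip_of_le {a b k : ℕ} (h : a < b) (hk : b ≤ k + 1) : skip a b k = k + 2 := by
  unfold skip
  split_ifs <;> omega

theorem enum_add (n k : ℕ) : enum n (k + n) = posIdx k := by
  unfold enum
  rw [dif_neg (by omega)]
  apply Subtype.ext
  simp only [posIdx]
  push_cast
  omega

/-- Both lists are strictly increasing and have the same members. -/
theorem complList_eq (p : ℕ) (a b : Fin (p + 2)) (h : a < b) :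
    complList p a b = List.ofFn fun i : Fin p => (⟨skip a b i, by
      have := i.2
      unfold skip
      split_ifs <;> omega⟩ : Fin (p + 2)) := by
  refine List.SortedLT.eq_of_mem_iff ?_ ?_ ?_
  · exact ((List.sortedLT_finRange _).pairwise.filter _).sortedLT
  · exact List.sortedLT_ofFn_iff.2 fun i j hij => skip_strictMono a b hij
  · intro c
    simp only [complList, List.mem_filter, List.mem_finRange, true_and, List.mem_ofFn,
      decide_eq_true_eq]
    constructor
    · rintro ⟨h1, h2⟩
      obtain ⟨k, hk, hkc, hk2⟩ := exists_skip (c := c) h (fun e => h1 (Fin.ext e))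
        (fun e => h2 (Fin.ext e))
      have hkp : k < p := by
        by_contra hcon
        have : skip a b k = k + 2 := skip_of_le h (by omega)
        omega
      exact ⟨⟨k, hkp⟩, Fin.ext hk⟩
    · rintro ⟨i, rfl⟩
      exact ⟨fun e => (skip_ne h i).1 (congrArg Fin.val e), fun e => (skip_ne h i).2 (congrArg Fin.val e)⟩

/-- The basis vectors `x_{-n}, …, x_{-1}, x_1, …`. -/
def enumSeq (n a : ℕ) : VInf K := basisVec K (enum n a)

theorem enumSeq_add (n k : ℕ) : enumSeq n (k + n) = basisSeq (K := K) k := by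
  rw [enumSeq, enum_add]; rfl

theorem isStd_skip {W : ℕ → VInf K} {L : ℕ} (hW : ∀ k, L ≤ k → W (k + 2) = basisSeq k) {a b : ℕ}
    (h : a < b) : IsStd fun k => W (skip a b k) :=
  ⟨max L b, fun k hk => by
    simp only
    rw [skip_of_le h (by omega), hW k (by omega)]⟩

/-- The Pfaffian of the matrix of the `φ (x_a) ∧ φ (x_b) ∧ φ (x_3) ∧ ⋯`. -/
def pfAt (r : ℕ) (ω : DualWedge K) (φ : VInf K → VInf K) : K :=
  pfaffian (r + 1) fun a b =>
    wedge ω fun k => φ (pairSeq (enumSeq (2 * r) a) (enumSeq (2 * r) b) basisSeq k)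

/-- The Pfaffian of the matrix of the signed wedge products of the `φ (x_k)`, `k ≠ a, b`. -/
def pfDualAt (s : ℕ) (ω : DualWedge K) (φ : VInf K → VInf K) : K :=
  pfaffian (s + 1) fun a b =>
    (-1) ^ ((a : ℕ) + b + 1) * wedge ω fun k => φ (enumSeq 2 (skip a b k))

theorem eval_pfaffian (ω : DualWedge K) {m : ℕ}
    (A : Matrix (Fin (2 * m)) (Fin (2 * m)) (CoordRing K)) :
    eval K (pfaffian m A) ω = pfaffian m fun a b => eval K (A a b) ω :=
  map_pfaffian (SymmetricAlgebra.lift (linForm ω)).toRingHom A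

theorem linForm_pairElt (ω : DualWedge K) (n : ℕ) (a b : Fin (n + 2)) :
    linForm ω (toWedge K (n, 2) (pairElt K n a b)) =
      wedge ω (pairSeq (enumSeq n a) (enumSeq n b) basisSeq) := by
  refine linForm_toWedge ω _ _ ?_ ?_ ?_
  · intro k (hk : 2 ≤ k)
    simp only [pairSeq]
    rw [if_neg (by omega), if_neg (by omega)]
  · intro k (hk : k < 2)
    simp only [pairSeq]
    split_ifs with h1 h2
    · exact basisVec_mem (enum_mem _ _ _ a.2)
    · exact basisVec_mem (enum_mem _ _ _ b.2)
    · omega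
  · simp [pairElt, initProd, ExteriorAlgebra.ιMulti_apply, pairSeq, enumSeq, x]
    rfl

theorem linForm_hodgeEntry (ω : DualWedge K) (p : ℕ) (a b : Fin (p + 2)) (h : a < b) :
    linForm ω (toWedge K (2, p) (hodgeEntry K p a b)) =
      (-1) ^ ((a : ℕ) + b + 1) * wedge ω fun k => enumSeq 2 (skip a b k) := by
  rw [hodgeEntry, dif_neg h.ne, if_pos h, map_smul, map_smul, smul_eq_mul]
  congr 1
  refine linForm_toWedge ω _ _ ?_ ?_ ?_
  · intro k (hk : p ≤ k)
    rw [skip_of_le h (by omega), enumSeq_add]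
  · intro k (hk : k < p)
    refine basisVec_mem (enum_mem _ _ _ ?_)
    unfold skip
    split_ifs <;> omega
  · simp only [complElt, complList_eq p a b h, List.map_ofFn, initProd,
      ExteriorAlgebra.ιMulti_apply]
    rfl

theorem eval_Pf (r : ℕ) (ω : DualWedge K) : eval K (Pf K r) ω = pfAt r ω id := by
  refine (eval_pfaffian ω _).trans (pfaffian_congr fun a b _ => ?_)
  rw [eval_ι, linForm_pairElt]
  rfl

theorem eval_PfDual (s : ℕ) (ω : DualWedge K) : eval K (PfDual K s) ω = pfDualAt s ω id := by
  refine (eval_pfaffian ω _).trans (pfaffian_congr fun a b h => ?_)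
  rw [eval_ι]
  exact linForm_hodgeEntry ω _ a b h

theorem isStd_enumSeq_skip {a b : ℕ} (h : a < b) :
    IsStd fun k => enumSeq (K := K) 2 (skip a b k) :=
  isStd_skip (L := 0) (fun k _ => enumSeq_add 2 k) h

/-- Translating by `g⁻¹` compensates for the contragredient action, so that `g` itself is applied to
the vectors. -/
theorem eval_Pf_smul (r : ℕ) (ω : DualWedge K) (g : GInf K) :
    eval K (Pf K r) (g⁻¹ • ω) = pfAt r ω (g : VInf K ≃ₗ[K] VInf K) := by
  rw [eval_Pf]
  refine pfaffian_congr fun a b _ => ?_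
  simp only [id]
  rw [wedge_smul _ _ (isStd_basisSeq.pairSeq _ _), inv_inv]

theorem eval_PfDual_smul (s : ℕ) (ω : DualWedge K) (g : GInf K) :
    eval K (PfDual K s) (g⁻¹ • ω) = pfDualAt s ω (g : VInf K ≃ₗ[K] VInf K) := by
  rw [eval_PfDual]
  refine pfaffian_congr fun a b h => ?_
  simp only [id]
  rw [wedge_smul _ _ (isStd_enumSeq_skip h), inv_inv]

/-! ### Density arguments -/

/-- The endomorphism has its image in `V_q` and kills the basis vectors that do not lie in `V_q`. -/
def IsFinitary (q : ℕ × ℕ) (N : VInf K →ₗ[K] VInf K) : Prop :=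
  (∀ v, N v ∈ VSub K q) ∧ ∀ i ∉ range q, N (basisVec K i) = 0

theorem finite_range_idx (q : ℕ × ℕ) : (range q).Finite := by
  refine Set.Finite.of_finite_image (f := Subtype.val) ?_ Subtype.val_injective.injOn
  refine (Set.finite_Icc (-(q.1 : ℤ)) q.2).subset ?_
  rintro _ ⟨i, hi, rfl⟩
  exact hi

instance (q : ℕ × ℕ) : FiniteDimensional K (VSub K q) :=
  FiniteDimensional.span_of_finite K ((finite_range_idx q).image _)

theorem finite_not_bijective_add_smul {V : Type*} [AddCommGroup V] [Module K V]
    [FiniteDimensional K V] (N : V →ₗ[K] V) :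
    ∃ s : Set K, s.Finite ∧ ∀ t ∉ s, Function.Bijective fun v => v + t • N v := by
  refine ⟨_, finite_not_injective_one_add_smul N, fun t ht => ?_⟩
  simp only [Set.mem_ofPred_eq, not_not] at ht
  exact ⟨ht, LinearMap.injective_iff_surjective.1 ht⟩

/-- Kernel vectors of `1 + t N` lie in the finite-dimensional space `V_q`, and a preimage of `y` can
be sought in `y + V_q`. So `1 + t N` is bijective as soon as it is so on `V_q`, which excludes
finitely many `t`. -/
theorem exists_group_element {q : ℕ × ℕ} {N : VInf K →ₗ[K] VInf K} (hN : IsFinitary q N) :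
    ∃ s : Set K, s.Finite ∧ ∀ t ∉ s, ∃ g : GInf K, ∀ v,
      (g : VInf K ≃ₗ[K] VInf K) v = v + t • N v := by
  let N' : VSub K q →ₗ[K] VSub K q := N.restrict fun v _ => hN.1 v
  obtain ⟨S, hS, hS'⟩ := finite_not_bijective_add_smul (V := ↥(VSub K q)) N'
  refine ⟨S, hS, fun t ht => ?_⟩
  obtain ⟨ht, hsurj'⟩ := hS' t ht
  let φ : VInf K →ₗ[K] VInf K := 1 + t • N
  have hφ : ∀ v, φ v = v + t • N v := fun v => rfl
  have hinj : Function.Injective φ := by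
    rw [← LinearMap.ker_eq_bot, Submodule.eq_bot_iff]
    intro v hv
    have h0 : v + t • N v = 0 := hv
    have hvm : v ∈ VSub K q := by
      rw [eq_neg_of_add_eq_zero_left h0]
      exact Submodule.neg_mem _ (Submodule.smul_mem _ _ (hN.1 v))
    have h1 : (⟨v, hvm⟩ : VSub K q) + t • N' ⟨v, hvm⟩ = 0 + t • N' 0 := by
      rw [map_zero, smul_zero, add_zero]
      exact Subtype.ext h0
    exact congrArg Subtype.val (ht h1)
  have hsurj : Function.Surjective φ := by
    intro y
    obtain ⟨z, hz⟩ := hsurj' ⟨-(t • N y), Submodule.neg_mem _ (Submodule.smul_mem _ _ (hN.1 y))⟩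
    have hz' : (z : VInf K) + t • N z = -(t • N y) := congrArg Subtype.val hz
    refine ⟨y + z, ?_⟩
    rw [hφ, map_add, smul_add]
    calc y + z + (t • N y + t • N z) = y + (t • N y + (z + t • N z)) := by abel
      _ = y := by rw [hz']; abel
  let g := LinearEquiv.ofBijective φ ⟨hinj, hsurj⟩
  have hg : ∀ v, g v = v + t • N v := fun v => rfl
  refine ⟨⟨g, q, ?_, fun i hi => ?_⟩, hg⟩
  · apply le_antisymm
    · rintro _ ⟨v, hv, rfl⟩
      exact Submodule.add_mem _ hv (Submodule.smul_mem _ _ (hN.1 v))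
    · intro v hv
      obtain ⟨z, hz⟩ := hsurj' ⟨v, hv⟩
      exact ⟨z, z.2, congrArg Subtype.val hz⟩
  · rw [hg, hN.2 i hi, smul_zero, add_zero]

/-- From position `max p q.2` on, the entries are standard basis vectors killed by `N`. So only
finitely many factors move with `t`, and the multilinear expansion is a polynomial. -/
theorem exists_polynomial_wedge (ω : DualWedge K) {q : ℕ × ℕ} {N : VInf K →ₗ[K] VInf K}
    (hN : IsFinitary q N) {w : ℕ → VInf K} (hw : IsStd w) :
    ∃ P : Polynomial K, ∀ t, wedge ω (fun k => w k + t • N (w k)) = P.eval t := by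
  obtain ⟨p, hp⟩ := hw
  have hw : IsStd w := ⟨p, hp⟩
  let S := Finset.range (max p q.2)
  refine ⟨∑ T ∈ S.powerset, Polynomial.X ^ T.card * Polynomial.C (wedge ω fun k =>
    if k ∈ T then N (w k) else w k), fun t => ?_⟩
  have : (fun k => w k + t • N (w k)) = fun k => if k ∈ S then w k + t • N (w k) else w k := by
    ext1 k
    split_ifs with hk
    · rfl
    · simp only [S, Finset.mem_range, not_lt] at hk
      rw [hp k (by omega), basisSeq, hN.2 _ (posIdx_notMem (n := q.1) (p := q.2) (by omega)),
        smul_zero, add_zero]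
  rw [this, wedge_expand ω S (fun k => N (w k)) t hw, Polynomial.eval_finsetSum]
  refine Finset.sum_congr rfl fun T _ => ?_
  rw [Polynomial.eval_mul, Polynomial.eval_pow, Polynomial.eval_X, Polynomial.eval_C]

theorem exists_polynomial_pfAt (r : ℕ) (ω : DualWedge K) {q : ℕ × ℕ} {N : VInf K →ₗ[K] VInf K}
    (hN : IsFinitary q N) :
    ∃ P : Polynomial K, ∀ t, pfAt r ω (fun v => v + t • N v) = P.eval t := by
  choose P hP using fun a b : Fin (2 * (r + 1)) => exists_polynomial_wedge ω hN
    (isStd_basisSeq.pairSeq (enumSeq (K := K) (2 * r) a) (enumSeq (2 * r) b))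
  refine ⟨pfaffian (r + 1) P, fun t => ?_⟩
  exact (pfaffian_congr fun a b _ => hP a b t).trans
    (map_pfaffian (Polynomial.evalRingHom t) _).symm

theorem exists_polynomial_pfDualAt (s : ℕ) (ω : DualWedge K) {q : ℕ × ℕ}
    {N : VInf K →ₗ[K] VInf K} (hN : IsFinitary q N) :
    ∃ P : Polynomial K, ∀ t, pfDualAt s ω (fun v => v + t • N v) = P.eval t := by
  have : ∀ a b : Fin (2 * (s + 1)), ∃ P : Polynomial K, a < b → ∀ t,
      wedge ω (fun k => enumSeq 2 (skip a b k) + t • N (enumSeq 2 (skip a b k))) = P.eval t := by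
    intro a b
    by_cases h : a < b
    · obtain ⟨P, hP⟩ := exists_polynomial_wedge ω hN (isStd_enumSeq_skip h)
      exact ⟨P, fun _ => hP⟩
    · exact ⟨0, fun h' => absurd h' h⟩
  choose P hP using this
  refine ⟨pfaffian (s + 1) fun a b => Polynomial.C ((-1) ^ ((a : ℕ) + b + 1)) * P a b,
    fun t => ?_⟩
  refine Eq.trans (pfaffian_congr fun a b h => ?_) (map_pfaffian (Polynomial.evalRingHom t) _).symm
  simp only [Polynomial.coe_evalRingHom, Polynomial.eval_mul, Polynomial.eval_C]
  rw [hP a b h t]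

/-- If the two Pfaffians are nonzero at two points of an orbit, then they are simultaneously
nonzero at some point of the orbit. -/
theorem exists_common_translate [Infinite K] {r s : ℕ} {ω : DualWedge K} {g₁ g₂ : GInf K}
    (h₁ : eval K (Pf K r) (g₁ • ω) ≠ 0) (h₂ : eval K (PfDual K s) (g₂ • ω) ≠ 0) :
    ∃ g : GInf K, eval K (Pf K r) (g • ω) ≠ 0 ∧ eval K (PfDual K s) (g • ω) ≠ 0 := by
  classical
  let ω' := g₁ • ω
  let h : GInf K := g₁ * g₂⁻¹
  have hω : h⁻¹ • ω' = g₂ • ω := by simp [h, ω', mul_smul]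
  obtain ⟨P0, hP0⟩ := exists_GSub_ge h
  -- The line `1 + t N` joins the identity, where the first Pfaffian of `ω'` is nonzero, to `h`,
  -- where the dual one is nonzero.
  let N : VInf K →ₗ[K] VInf K := ((h : VInf K ≃ₗ[K] VInf K) : VInf K →ₗ[K] VInf K) - 1
  have hN1 : ∀ v, N v = (h : VInf K ≃ₗ[K] VInf K) v - v := fun v => rfl
  have hN : IsFinitary (P0, P0) N := by
    have hbasis : ∀ i ∉ range (P0, P0), N (basisVec K i) = 0 := fun i hi => by
      rw [hN1, (hP0 P0 le_rfl).2 i hi, sub_self]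
    refine ⟨fun v => ?_, hbasis⟩
    induction v using Finsupp.induction_linear with
    | zero => rw [map_zero]; exact Submodule.zero_mem _
    | add u v hu hv => rw [map_add]; exact Submodule.add_mem _ hu hv
    | single i c =>
      have : (Finsupp.single i c : VInf K) = c • basisVec K i := by simp [basisVec]
      rw [this, map_smul]
      refine Submodule.smul_mem _ _ ?_
      by_cases hi : i ∈ range (P0, P0)
      · rw [hN1]
        refine Submodule.sub_mem _ ?_ (basisVec_mem hi)
        rw [← (hP0 P0 le_rfl).1]
        exact Submodule.mem_map_of_mem (basisVec_mem hi)
      · rw [hbasis i hi]; exact Submodule.zero_mem _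
  obtain ⟨P, hP⟩ := exists_polynomial_pfAt r ω' hN
  obtain ⟨Q, hQ⟩ := exists_polynomial_pfDualAt s ω' hN
  obtain ⟨S, hS, hg⟩ := exists_group_element hN
  have hPne : P ≠ 0 := by
    rintro rfl
    have := hP 0
    simp only [zero_smul, add_zero, Polynomial.eval_zero] at this
    exact h₁ (by rw [eval_Pf]; exact this)
  have hQne : Q ≠ 0 := by
    rintro rfl
    have := hQ 1
    simp only [one_smul, Polynomial.eval_zero, hN1, add_sub_cancel] at this
    rw [← hω, eval_PfDual_smul] at h₂
    exact h₂ this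
  -- It suffices to avoid the finitely many `t` with `1 + t N` not invertible and the zeros of the
  -- two nonzero polynomials.
  obtain ⟨t, ht⟩ := ((hS.union (P * Q).roots.toFinset.finite_toSet)).exists_notMem
  simp only [Set.mem_union, not_or, Finset.mem_coe, Multiset.mem_toFinset,
    Polynomial.mem_roots (mul_ne_zero hPne hQne), Polynomial.IsRoot.def,
    Polynomial.eval_mul, mul_eq_zero] at ht
  obtain ⟨g, hgt⟩ := hg t ht.1
  have hgt' : ((g : VInf K ≃ₗ[K] VInf K) : VInf K → VInf K) = fun v => v + t • N v := funext hgt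
  refine ⟨g⁻¹ * g₁, ?_, ?_⟩
  · rw [mul_smul, eval_Pf_smul, hgt', hP]; exact ht.2.1
  · rw [mul_smul, eval_PfDual_smul, hgt', hQ]; exact ht.2.2

/-- The Pfaffian at `1 + t N` is a polynomial in `t` that vanishes whenever `1 + t N` is invertible,
hence for all but finitely many `t`. It therefore vanishes at `t = 1`, even if `1 + N` is singular;
this allows arbitrary vectors in the relations. -/
theorem pfAt_eq_zero [Infinite K] {r s : ℕ} {ω : DualWedge K} (hω : ω ∈ pfaffianVariety K r s)
    {q : ℕ × ℕ} {N : VInf K →ₗ[K] VInf K} (hN : IsFinitary q N) :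
    pfAt r ω (fun v => v + N v) = 0 ∧ pfDualAt s ω (fun v => v + N v) = 0 := by
  obtain ⟨P, hP⟩ := exists_polynomial_pfAt r ω hN
  obtain ⟨Q, hQ⟩ := exists_polynomial_pfDualAt s ω hN
  obtain ⟨S, hS, hg⟩ := exists_group_element hN
  have h : ∀ t ∉ S, P.eval t = 0 ∧ Q.eval t = 0 := by
    intro t ht
    obtain ⟨g, hgt⟩ := hg t ht
    have hgt' : ((g : VInf K ≃ₗ[K] VInf K) : VInf K → VInf K) = fun v => v + t • N v := funext hgt
    have := hω g⁻¹
    rw [eval_Pf_smul, eval_PfDual_smul, hgt', hP, hQ] at this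
    exact this
  have h1 := hP 1
  have h2 := hQ 1
  rw [polynomial_eval_eq_zero hS fun t ht => (h t ht).1] at h1
  rw [polynomial_eval_eq_zero hS fun t ht => (h t ht).2] at h2
  simp only [one_smul] at h1 h2
  exact ⟨h1, h2⟩

/-- The position of an index in the enumeration `-n, …, -1, 1, 2, …`. -/
def enumPos (n : ℕ) (i : Idx) : ℕ := if i.1 < 0 then (i.1 + n).toNat else (i.1 + n - 1).toNat

theorem enumPos_enum (n a : ℕ) : enumPos n (enum n a) = a := by
  unfold enumPos enum
  split_ifs with h1 h2 h2 <;> simp only at h2 ⊢ <;> omega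

theorem enum_injective (n : ℕ) : Function.Injective (enum n) :=
  Function.LeftInverse.injective (enumPos_enum n)

theorem enum_enumPos {n : ℕ} {i : Idx} (h : -(n : ℤ) ≤ i.1) : enum n (enumPos n i) = i := by
  have := i.2
  unfold enumPos enum
  split_ifs <;> apply Subtype.ext <;> simp only <;> omega

theorem neg_le_enum (n a : ℕ) : -(n : ℤ) ≤ (enum n a).1 := by
  unfold enum
  split_ifs <;> simp only <;> omega

/-- Almost standard sequences of vectors are images of the standard basis under endomorphisms
that differ from the identity by a finitary one. -/
theorem exists_finitary (n : ℕ) {U : ℕ → VInf K} {L : ℕ}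
    (hU : ∀ k, L ≤ k → U (k + n) = basisSeq k) :
    ∃ q, ∃ N : VInf K →ₗ[K] VInf K, IsFinitary q N ∧ ∀ a, enumSeq n a + N (enumSeq n a) = U a := by
  classical
  choose l hl using fun a => exists_mem_VSub (U a)
  -- Large enough for `V_{p,p}` to contain all indices at which `U` may be nonstandard, together
  -- with the values of `U` there.
  let p := max (max L n) ((Finset.range (L + n)).sup l)
  let f : Idx → VInf K := fun i =>
    if -(n : ℤ) ≤ i.1 then U (enumPos n i) - basisVec K i else 0
  let N : VInf K →ₗ[K] VInf K := Finsupp.linearCombination K f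
  have hN : ∀ i, N (basisVec K i) = f i := fun i => by simp [N, basisVec]
  have hzero : ∀ i : Idx, -(n : ℤ) ≤ i.1 → L + n ≤ enumPos n i → f i = 0 := by
    intro i hi hL
    simp only [f, if_pos hi]
    obtain ⟨k, hk⟩ := Nat.exists_eq_add_of_le' hL
    have h1 := enum_enumPos hi
    rw [hk, ← add_assoc] at h1 ⊢
    rw [hU _ (by omega), ← h1, enum_add, basisSeq, sub_self]
  have hmem : ∀ i, f i ∈ VSub K (p, p) := by
    intro i
    by_cases hi : -(n : ℤ) ≤ i.1
    · by_cases hL : enumPos n i < L + n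
      · simp only [f, if_pos hi]
        have h1 : l (enumPos n i) ≤ (Finset.range (L + n)).sup l :=
          Finset.le_sup (Finset.mem_range.2 hL)
        have h2 : l (enumPos n i) ≤ p := by omega
        refine Submodule.sub_mem _ (VSub_mono K (Prod.mk_le_mk.2 ⟨h2, h2⟩) (hl _))
          (basisVec_mem ?_)
        have h3 : n ≤ p ∧ L ≤ p := by omega
        unfold enumPos at hL
        constructor
        · simp only; omega
        · simp only
          split_ifs at hL <;> omega
      · rw [hzero i hi (by omega)]; exact Submodule.zero_mem _
    · simp only [f, if_neg hi]; exact Submodule.zero_mem _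
  refine ⟨(p, p), N, ⟨fun v => ?_, fun i hi => ?_⟩, fun a => ?_⟩
  · rw [Finsupp.linearCombination_apply]
    exact Submodule.sum_mem _ fun i _ => Submodule.smul_mem _ _ (hmem i)
  · rw [hN]
    by_cases hi' : -(n : ℤ) ≤ i.1
    · refine hzero i hi' ?_
      have h3 : n ≤ p ∧ L ≤ p := by omega
      have h4 : (p : ℤ) < i.1 := by
        by_contra hcon
        exact hi ⟨by simp only; omega, by simp only; omega⟩
      unfold enumPos
      rw [if_neg (by omega)]
      omega
    · simp only [f, if_neg hi']
  · rw [enumSeq, hN]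
    simp only [f, if_pos (neg_le_enum n a), enumPos_enum]
    abel

/-- The Pfaffian relations for arbitrary vectors. -/
theorem pfaffian_wedge_eq_zero [Infinite K] {r s : ℕ} {ω : DualWedge K}
    (hω : ω ∈ pfaffianVariety K r s) {U : ℕ → VInf K} {L : ℕ}
    (hU : ∀ k, L ≤ k → U (k + 2 * r) = basisSeq k) :
    pfaffian (r + 1) (fun a b : Fin (2 * (r + 1)) =>
      wedge ω (pairSeq (U a) (U b) fun k => U (k + 2 * r))) = 0 := by
  obtain ⟨q, N, hN, hNU⟩ := exists_finitary (2 * r) hU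
  rw [← (pfAt_eq_zero hω hN).1]
  refine pfaffian_congr fun a b _ => ?_
  congr 1
  ext1 k
  simp only [pairSeq]
  split_ifs
  · rw [hNU]
  · rw [hNU]
  · rw [← enumSeq_add (2 * r), hNU]

/-- The dual Pfaffian relations for arbitrary vectors. -/
theorem pfaffian_wedge_skip_eq_zero [Infinite K] {r s : ℕ} {ω : DualWedge K}
    (hω : ω ∈ pfaffianVariety K r s) {U : ℕ → VInf K} {L : ℕ}
    (hU : ∀ k, L ≤ k → U (k + 2) = basisSeq k) :
    pfaffian (s + 1) (fun a b : Fin (2 * (s + 1)) =>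
      (-1) ^ ((a : ℕ) + b + 1) * wedge ω fun k => U (skip a b k)) = 0 := by
  obtain ⟨q, N, hN, hNU⟩ := exists_finitary 2 hU
  rw [← (pfAt_eq_zero hω hN).2]
  refine pfaffian_congr fun a b _ => ?_
  congr 2
  ext1 k
  exact (hNU _).symm

end PfaffianRelations

end InfWedge
end

noncomputable section

namespace InfWedge

/-! ### Reduction to coordinates with few distant indices -/

universe u

section PfaffianInduction

open Polynomial

theorem coeff_sum_powerset {R : Type*} [CommRing R] (S : Finset ℕ) (f : Finset ℕ → R) (d : ℕ) :
    (∑ T ∈ S.powerset, X ^ T.card * C (f T) : R[X]).coeff d =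
      ∑ T ∈ S.powerset, if T.card = d then f T else 0 := by
  rw [finsetSum_coeff]
  refine Finset.sum_congr rfl fun T _ => ?_
  rw [coeff_mul_C, coeff_X_pow]
  by_cases h : T.card = d
  · simp [h]
  · simp [h, Ne.symm h]

/-- Solving Pfaffian relations for the leading coefficients of the last entries. -/
theorem mem_of_pfaffian_relations {k : Type*} {R : Type u} [CommRing k] [CommRing R] [Algebra k R]
    (O : Subalgebra k R) {m : ℕ} (D : Finset ℕ)
    (A : Finset ℕ → Matrix (Fin (2 * (m + 1))) (Fin (2 * (m + 1))) R[X]) (f : Finset ℕ → R)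
    (hA : ∀ S ⊆ D, pfaffian (m + 1) (A S) = 0)
    (hO : ∀ S ⊆ D, ∀ a b : Fin (2 * (m + 1)), a < b →
      ¬ ((a : ℕ) = 2 * m ∧ (b : ℕ) = 2 * m + 1) → A S a b ∈ coeffsIn O)
    (hlast : ∀ S ⊆ D, A S ⟨2 * m, by omega⟩ ⟨2 * m + 1, by omega⟩ =
      ∑ T ∈ S.powerset, X ^ T.card * C (f T))
    (hdiv : ∀ S ⊆ D, ∀ y, y * (pfaffian m (block (A S))).coeff 0 ∈ O → y ∈ O) :
    ∀ S ⊆ D, f S ∈ O := by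
  intro S
  induction S using Finset.strongInduction with
  | H S ih =>
    intro hS
    refine hdiv S hS _ ?_
    -- The top coefficient of the last entry comes from the single subset `T = S`.
    have h1 : (A S ⟨2 * m, by omega⟩ ⟨2 * m + 1, by omega⟩).coeff S.card = f S := by
      rw [hlast S hS, coeff_sum_powerset, Finset.sum_eq_single S]
      · rw [if_pos rfl]
      · intro T hT hne
        rw [Finset.mem_powerset] at hT
        exact if_neg fun h => hne (Finset.eq_of_subset_of_card_le hT h.ge)
      · intro h
        exact absurd (Finset.mem_powerset_self S) h
    rw [← h1]
    refine coeff_last_mul_mem O (A S) (hA S hS) (hO S hS) _ fun e he => ?_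
    -- The coefficients of lower degree are sums of `f T` over proper subsets `T` of `S`, which are
    -- known by induction.
    rw [hlast S hS, coeff_sum_powerset]
    refine O.sum_mem fun T hT => ?_
    rw [Finset.mem_powerset] at hT
    split_ifs with h
    · refine ih T (hT.ssubset_of_ne ?_) (hT.trans hS)
      rintro rfl
      omega
    · exact O.zero_mem

end PfaffianInduction

/-! ### Coordinates along lines and alignment of index sequences. -/

section Coordinates

variable {K : Type u} [Field K] (X : Set (DualWedge K))

/-- A coordinate, as a function on a set of points. -/
def coordOn (I : ℕ → Idx) : X → K := fun ω => coord I ω.1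

open Polynomial in
/-- The polynomial describing a wedge product along a line. -/
def linePoly (S : Finset ℕ) (v w : ℕ → Idx) : (X → K)[X] :=
  ∑ T ∈ S.powerset, Polynomial.X ^ T.card * C (coordOn X fun k => if k ∈ T then v k else w k)

variable {X}

theorem eval_linePoly (ω : X) (t : K) (S : Finset ℕ) (v : ℕ → Idx) {w : ℕ → Idx}
    (hw : IsStdIdx w) :
    ((linePoly X S v w).map (Pi.evalRingHom (fun _ => K) ω)).eval t =
      wedge ω.1 fun k => if k ∈ S then basisVec K (w k) + t • basisVec K (v k)
        else basisVec K (w k) := by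
  rw [wedge_expand ω.1 S (fun k => basisVec K (v k)) t hw.isStd, linePoly, Polynomial.map_sum,
    Polynomial.eval_finsetSum]
  refine Finset.sum_congr rfl fun T _ => ?_
  rw [Polynomial.map_mul, Polynomial.map_pow, Polynomial.map_X, Polynomial.map_C,
    Polynomial.eval_mul, Polynomial.eval_pow, Polynomial.eval_X, Polynomial.eval_C]
  exact congrArg (fun w => t ^ T.card * wedge ω.1 w)
    (funext fun k => apply_ite (basisVec K) _ _ _)

theorem coeff_zero_linePoly (S : Finset ℕ) (v w : ℕ → Idx) :
    (linePoly X S v w).coeff 0 = coordOn X w := by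
  rw [linePoly, coeff_sum_powerset, Finset.sum_eq_single ∅]
  · simp
  · intro T _ hT
    exact if_neg fun h => hT (Finset.card_eq_zero.1 h)
  · intro h
    exact absurd (Finset.empty_mem_powerset S) h

theorem linePoly_mem (O : Subalgebra K (X → K)) {S : Finset ℕ} {v w : ℕ → Idx}
    (h : ∀ T ⊆ S, coordOn X (fun k => if k ∈ T then v k else w k) ∈ O) :
    linePoly X S v w ∈ coeffsIn O := by
  intro d
  rw [linePoly, coeff_sum_powerset]
  refine O.sum_mem fun T hT => ?_
  split_ifs
  · exact h T (Finset.mem_powerset.1 hT)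
  · exact O.zero_mem

/-- A polynomial with coefficients in a ring of functions is zero if all its values are, since `K`
is infinite. This turns the relations at individual points and parameters into an identity whose
coefficients can be compared. -/
theorem pfaffian_eq_zero_of_eval [Infinite K] {m : ℕ}
    (A : Matrix (Fin (2 * m)) (Fin (2 * m)) (Polynomial (X → K)))
    (h : ∀ (ω : X) (t : K), pfaffian m (fun a b =>
      ((A a b).map (Pi.evalRingHom (fun _ => K) ω)).eval t) = 0) : pfaffian m A = 0 := by
  have h1 : ∀ ω : X, (pfaffian m A).map (Pi.evalRingHom (fun _ => K) ω) = 0 := by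
    intro ω
    refine Polynomial.eq_zero_of_infinite_isRoot _ ?_
    convert Set.infinite_univ (α := K) using 1
    refine Set.eq_univ_of_forall fun t => ?_
    refine Eq.trans ?_ (h ω t)
    exact map_pfaffian ((Polynomial.evalRingHom t).comp
      (Polynomial.mapRingHom (Pi.evalRingHom (fun _ => K) ω))) A
  ext d ω
  have := congrArg (fun p => Polynomial.coeff p d) (h1 ω)
  simpa using this

theorem coeff_pfaffian_zero {R : Type u} [CommRing R] {m : ℕ}
    (A : Matrix (Fin (2 * m)) (Fin (2 * m)) (Polynomial R)) :
    (pfaffian m A).coeff 0 = pfaffian m fun a b => (A a b).coeff 0 :=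
  map_pfaffian (Polynomial.constantCoeff) A

theorem pfaffian_apply {m : ℕ} (A : Matrix (Fin (2 * m)) (Fin (2 * m)) (X → K)) (ω : X) :
    pfaffian m A ω = pfaffian m fun a b => A a b ω :=
  map_pfaffian (Pi.evalRingHom (fun _ => K) ω) A

/-- Two sequences of distinct indices can be aligned: a rearrangement of `I` agrees with `U` at
all positions at which `U` takes a value that `I` takes, too. -/
theorem exists_aligned {U I : ℕ → Idx} (hU : U.Injective) (hI : I.Injective) (hU' : IsStdIdx U)
    (hI' : IsStdIdx I) : ∃ J : ℕ → Idx, IsStdIdx J ∧ J.Injective ∧ Set.range J = Set.range I ∧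
      (∀ k, U k ∈ Set.range I → J k = U k) ∧
      ∃ ε : ℤˣ, ∀ ω : DualWedge K, coord J ω = ε • coord I ω := by
  classical
  obtain ⟨p1, h1⟩ := hU'
  obtain ⟨p2, h2⟩ := hI'
  obtain ⟨p, hp1, hp2⟩ : ∃ p, p1 ≤ p ∧ p2 ≤ p := ⟨max p1 p2, le_max_left _ _, le_max_right _ _⟩
  -- A value shared by `U k` and `I` occurs in `I` before `p`: beyond `p` both sequences are
  -- standard, and `U` would repeat a value.
  have hex : ∀ k : Fin p, U k ∈ Set.range I → ∃ j : Fin p, I j = U k := by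
    rintro k ⟨j, hj⟩
    by_cases hjp : j < p
    · exact ⟨⟨j, hjp⟩, hj⟩
    · have : U j = U k := by rw [← hj, h1 j (by omega), h2 j (by omega)]
      have := hU this
      omega
  let f : Fin p → Fin p := fun k => if h : U k ∈ Set.range I then (hex k h).choose else k
  have hf : ∀ k : Fin p, U k ∈ Set.range I → I (f k) = U k := fun k h => by
    simp only [f, dif_pos h]
    exact (hex k h).choose_spec
  let A : Finset (Fin p) := Finset.univ.filter fun k => U k ∈ Set.range I
  have hA : ∀ k, k ∈ A → U k ∈ Set.range I := fun k hk => (Finset.mem_filter.1 hk).2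
  -- The partial injection that matches common values extends to a permutation of the first `p`
  -- positions.
  obtain ⟨σ, hσ⟩ := Finset.exists_equiv_extend_of_card_eq (α := Fin p) (t := Finset.univ) (by simp)
    (s := A) (f := f) (by simp) (by
      intro a ha b hb hab
      have h3 := hf a (hA a ha)
      rw [hab, hf b (hA b hb)] at h3
      exact Fin.ext (hU h3).symm)
  let σ' : Equiv.Perm (Fin p) := σ.trans (Equiv.subtypeUnivEquiv (by simp))
  have hσ' : ∀ k ∈ A, σ' k = f k := hσ
  let J : ℕ → Idx := fun k => if hk : k < p then I (σ' ⟨k, hk⟩) else I k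
  refine ⟨J, ⟨p, fun k hk => ?_⟩, ?_, ?_, ?_, Equiv.Perm.sign σ', fun ω => ?_⟩
  · exact (dif_neg (by omega)).trans (h2 k (by omega))
  · intro a b hab
    simp only [J] at hab
    split_ifs at hab with ha hb hb
    · exact Fin.mk.inj_iff.1 (σ'.injective (Fin.ext (hI hab)))
    · have := hI hab
      omega
    · have := hI hab
      omega
    · exact hI hab
  · ext i
    constructor
    · rintro ⟨k, rfl⟩
      simp only [J]
      split_ifs
      exacts [⟨_, rfl⟩, ⟨_, rfl⟩]
    · rintro ⟨k, rfl⟩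
      by_cases hk : k < p
      · refine ⟨σ'.symm ⟨k, hk⟩, ?_⟩
        simp only [J, Fin.is_lt, dite_true, Fin.eta, Equiv.apply_symm_apply]
      · exact ⟨k, dif_neg hk⟩
  · intro k hk
    by_cases hkp : k < p
    · have : σ' ⟨k, hkp⟩ = f ⟨k, hkp⟩ := hσ' _ (Finset.mem_filter.2 ⟨Finset.mem_univ _, hk⟩)
      exact (dif_pos hkp).trans ((congrArg (fun j : Fin p => I j) this).trans (hf _ hk))
    · exact (dif_neg hkp).trans ((h2 k (by omega)).trans (h1 k (by omega)).symm)
  · have := wedge_comp_perm ω (IsStdIdx.isStd (K := K) ⟨p2, h2⟩) σ'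
    rw [coord, coord, ← this]
    congr 1
    ext1 k
    simp only [J]
    split_ifs <;> rfl

theorem coord_eq_zero {I : ℕ → Idx} (hI : IsStdIdx I) (h : ¬ I.Injective) (ω : DualWedge K) :
    coord I ω = 0 := by
  simp only [Function.Injective, not_forall] at h
  obtain ⟨a, b, hab, hne⟩ := h
  exact wedge_eq_zero ω hI.isStd hne (congrArg (basisVec K) hab)

/-- The indices below `-N` that occur in a sequence. -/
def distantNeg (N : ℕ) (I : ℕ → Idx) : Set Idx := {i | i.1 < -(N : ℤ) ∧ i ∈ Set.range I}

/-- The numbers `k ≥ N` such that the index `k + 1` does not occur in a sequence. -/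
def distantGaps (N : ℕ) (I : ℕ → Idx) : Set ℕ := {k | N ≤ k ∧ posIdx k ∉ Set.range I}

theorem posIdx_pos (k : ℕ) : 0 < (posIdx k).1 := by simp only [posIdx]; omega

theorem finite_distantNeg (N : ℕ) {I : ℕ → Idx} (hI : IsStdIdx I) : (distantNeg N I).Finite := by
  obtain ⟨p, hp⟩ := hI
  refine ((Set.finite_Iio p).image I).subset ?_
  rintro i ⟨hi, k, rfl⟩
  refine ⟨k, ?_, rfl⟩
  by_contra hk
  rw [Set.mem_Iio, not_lt] at hk
  rw [hp k hk] at hi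
  have := posIdx_pos k
  omega

theorem finite_distantGaps (N : ℕ) {I : ℕ → Idx} (hI : IsStdIdx I) : (distantGaps N I).Finite := by
  obtain ⟨p, hp⟩ := hI
  refine (Set.finite_Iio p).subset ?_
  rintro k ⟨-, hk⟩
  by_contra h
  rw [Set.mem_Iio, not_lt] at h
  exact hk ⟨k, hp k h⟩

end Coordinates

end InfWedge
end

noncomputable section

namespace InfWedge

universe u

/-! ### Elimination of pairs of distant negative indices. -/

section Reduction

variable {K : Type u} [Field K] {X : Set (DualWedge K)}

/-- Division by nowhere vanishing elements is possible in the algebra of functions. -/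
def DivisionClosed (O : Subalgebra K (X → K)) : Prop :=
  ∀ P ∈ O, (∀ ω, P ω ≠ 0) → ∀ y, y * P ∈ O → y ∈ O

/-- Eliminating a pair of distant negative indices by the Pfaffian relations. -/
theorem mem_of_distantNeg [Infinite K] {r s N : ℕ} (hN : 2 * r ≤ N ∧ 2 ≤ N)
    (hX : X ⊆ (pfaffianVariety K (r + 1) s : Set (DualWedge K)))
    (hX' : ∀ ω ∈ X, eval K (Pf K r) ω ≠ 0) {O : Subalgebra K (X → K)} (hO : DivisionClosed O)
    {I : ℕ → Idx} (hI : IsStdIdx I) (hinj : I.Injective)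
    (h : ∀ J : ℕ → Idx, IsStdIdx J → distantNeg N J ⊂ distantNeg N I →
      distantGaps N J ⊆ distantGaps N I → coordOn X J ∈ O)
    {i j : Idx} (hi : i ∈ distantNeg N I) (hj : j ∈ distantNeg N I) (hij : i ≠ j) :
    coordOn X I ∈ O := by
  classical
  -- The sequence `i, j, 3, 4, …`, the last entry of the Pfaffian matrix with the standard tail.
  -- Aligning `I` with it puts `i` and `j` first and makes the remaining deviations visible position
  -- by position.
  let B : ℕ → Idx := pairSeq i j posIdx
  have hB2 : ∀ k, 2 ≤ k → B k = posIdx k := fun k hk => by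
    simp only [B, pairSeq]
    rw [if_neg (by omega), if_neg (by omega)]
  have hB : IsStdIdx B := ⟨2, hB2⟩
  have hBinj : B.Injective := by
    have hi' := hi.1
    have hj' := hj.1
    intro a b hab
    have ha := posIdx_pos a
    have hb := posIdx_pos b
    simp only [B, pairSeq] at hab
    split_ifs at hab with h1 h2 h3 h4 h5 h6 h7 h8
    all_goals first
      | omega
      | exact absurd hab hij
      | exact absurd hab.symm hij
      | exact posIdx_injective hab
      | (subst hab; omega)
  obtain ⟨I', hI', hinj', hrange, halign, ε, hε⟩ := exists_aligned (K := K) hBinj hinj hB hI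
  have hneg : distantNeg N I' = distantNeg N I := by simp only [distantNeg, hrange]
  have hgaps : distantGaps N I' = distantGaps N I := by simp only [distantGaps, hrange]
  rw [← hneg, ← hgaps] at h
  rw [← hneg] at hi hj
  have hI0 : I' 0 = i := halign 0 (by rw [← hrange]; exact hi.2)
  have hI1 : I' 1 = j := halign 1 (by rw [← hrange]; exact hj.2)
  suffices hmem : coordOn X I' ∈ O by
    have : coordOn X I = ε • coordOn X I' := by
      ext ω
      change coord I ω.1 = ε • coord I' ω.1
      rw [hε, smul_smul, Int.units_mul_self, one_smul]
    rw [this, Units.smul_def]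
    exact O.zsmul_mem hmem _
  obtain ⟨p, hp⟩ := hI'
  -- The positions in which the tail of `I'` is not standard. By alignment, the standard index of
  -- such a position does not occur in `I'` at all.
  let D : Finset ℕ := (Finset.range p).filter fun k => 2 ≤ k ∧ posIdx k ≠ I' k
  have hD : ∀ k ∈ D, 2 ≤ k ∧ posIdx k ∉ Set.range I' := by
    intro k hk
    have hk' := (Finset.mem_filter.1 hk).2
    refine ⟨hk'.1, fun hmem => hk'.2 ?_⟩
    rw [← hB2 k hk'.1, halign k]
    rw [hB2 k hk'.1, ← hrange]
    exact hmem
  -- The rows of the matrix: those of `Pf K r`, followed by `i` and `j`. The upper left block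
  -- therefore has the constant coefficient `Pf K r`.
  let u : ℕ → Idx := fun a => if a < 2 * (r + 1) then enum (2 * r) a else if a = 2 * (r + 1) then i else j
  have hu : ∀ a, (u a).1 < -(N : ℤ) → (a = 2 * (r + 1) ∧ u a = i) ∨ (2 * (r + 1) < a ∧ u a = j) := by
    intro a ha
    simp only [u] at ha ⊢
    split_ifs at ha ⊢ with h1 h2
    · have h4 := neg_le_enum (2 * r) a
      push_cast at h4
      omega
    · exact Or.inl ⟨h2, rfl⟩
    · exact Or.inr ⟨by omega, rfl⟩
  have hw : ∀ a b, IsStdIdx (pairSeq (u a) (u b) posIdx) := fun a b =>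
    ⟨2, fun k hk => by simp only [pairSeq]; rw [if_neg (by omega), if_neg (by omega)]⟩
  -- The tail vectors at positions `k ∈ S` move along the lines from the standard vector in
  -- direction `I' k`. The coefficients of the entries replace subsets `T` of `S` in the tail, and
  -- for the last entry and `T = D` this gives the wanted coordinate.
  let A : Finset ℕ → Matrix (Fin (2 * (r + 1 + 1))) (Fin (2 * (r + 1 + 1))) (Polynomial (X → K)) :=
    fun S a b => linePoly X S I' (pairSeq (u a) (u b) posIdx)
  let f : Finset ℕ → X → K := fun T => coordOn X fun k => if k ∈ T then I' k else B k
  have hfD : f D = coordOn X I' := by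
    refine congrArg (coordOn X) (funext fun k => ?_)
    by_cases hk : k ∈ D
    · exact if_pos hk
    · refine (if_neg hk).trans ?_
      by_cases hk2 : 2 ≤ k
      · rw [hB2 k hk2]
        by_contra hne
        refine hk (Finset.mem_filter.2 ⟨Finset.mem_range.2 ?_, hk2, hne⟩)
        by_contra hkp
        exact hne (hp k (by omega)).symm
      · have : k = 0 ∨ k = 1 := by omega
        rcases this with rfl | rfl
        · exact hI0.symm
        · exact hI1.symm
  -- All other entries lack the row `i` or the row `j`, while tail replacements add only indices of
  -- `I'` other than these. So a distant negative index is lost. No new distant gap arises, because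
  -- a replaced standard index is already missing from `I'`.
  have hentries : ∀ S ⊆ D, ∀ a b : Fin (2 * (r + 1 + 1)), a < b →
      ¬ ((a : ℕ) = 2 * (r + 1) ∧ (b : ℕ) = 2 * (r + 1) + 1) → A S a b ∈ coeffsIn O := by
    intro S hS a b hab hlast
    refine linePoly_mem O fun T hT => ?_
    have hTD := hT.trans hS
    have hstd : IsStdIdx fun k => if k ∈ T then I' k else pairSeq (u a) (u b) posIdx k := by
      refine ⟨p + 2, fun k hk => ?_⟩
      simp only [pairSeq]
      rw [if_neg (c := k = 0) (by omega), if_neg (c := k = 1) (by omega), hp k (by omega), ite_self]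
    have hab' : (a : ℕ) < b := hab
    have hb' := b.2
    refine h _ hstd (Set.ssubset_iff_exists.2 ⟨?_, ?_⟩) ?_
    · rintro x ⟨hx, k, rfl⟩
      refine ⟨hx, ?_⟩
      by_cases hk : k ∈ T
      · simp only [hk, if_true]; exact ⟨k, rfl⟩
      · simp only [hk, if_false, pairSeq] at hx ⊢
        have hpos := posIdx_pos k
        split_ifs at hx ⊢ with h1 h2
        · rcases hu a hx with h3 | h3
          · rw [h3.2]; exact hi.2
          · rw [h3.2]; exact hj.2
        · rcases hu b hx with h3 | h3
          · rw [h3.2]; exact hi.2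
          · rw [h3.2]; exact hj.2
        · omega
    · have hz : ∀ z, z.1 < -(N : ℤ) → (z = i ∨ z = j) → u b ≠ z → z ∉ Set.range fun k =>
          if k ∈ T then I' k else pairSeq (u a) (u b) posIdx k := by
        rintro z hz1 hz2 hz3 ⟨k, hk⟩
        by_cases hkT : k ∈ T
        · simp only [hkT, if_true] at hk
          have hk2 := (hD k (hTD hkT)).1
          rcases hz2 with hz2 | hz2
          · have := hinj' (hk.trans (hz2.trans hI0.symm))
            omega
          · have := hinj' (hk.trans (hz2.trans hI1.symm))
            omega
        · simp only [hkT, if_false, pairSeq] at hk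
          have hpos := posIdx_pos k
          split_ifs at hk
          · rw [← hk] at hz1
            rcases hu a hz1 with h3 | h3 <;> omega
          · exact hz3 hk
          · rw [hk] at hpos
            omega
      by_cases hbm : (b : ℕ) = 2 * (r + 1)
      · refine ⟨j, hj, fun hh => hz j hj.1 (Or.inr rfl) ?_ hh.2⟩
        intro hub
        rcases hu b (hub ▸ hj.1) with h3 | h3
        · exact hij (h3.2.symm.trans hub)
        · omega
      · refine ⟨i, hi, fun hh => hz i hi.1 (Or.inl rfl) ?_ hh.2⟩
        intro hub
        rcases hu b (hub ▸ hi.1) with h3 | h3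
        · omega
        · exact hij (hub.symm.trans h3.2)
    · rintro k ⟨hk, hk'⟩
      refine ⟨hk, (hD k ?_).2⟩
      by_contra hkD
      refine hk' ⟨k, ?_⟩
      have hkT : k ∉ T := fun hh => hkD (hTD hh)
      simp only [hkT, if_false, pairSeq]
      rw [if_neg (by omega), if_neg (by omega)]
  rw [← hfD]
  refine mem_of_pfaffian_relations O D A f ?_ hentries ?_ ?_ D (Finset.Subset.refl _)
  · intro S hS
    refine pfaffian_eq_zero_of_eval _ fun ω t => ?_
    -- The vectors to which the Pfaffian relation applies: the rows of the matrix, then the moving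
    -- tail. The two overlapping positions `0, 1` of the tail are overwritten in every entry.
    let U : ℕ → VInf K := fun n =>
      if n < 2 * (r + 1 + 1) then basisVec K (u n)
      else if n - 2 * (r + 1) ∈ S then
        basisVec K (posIdx (n - 2 * (r + 1))) + t • basisVec K (I' (n - 2 * (r + 1)))
      else basisVec K (posIdx (n - 2 * (r + 1)))
    have hU : ∀ k, p + 2 ≤ k → U (k + 2 * (r + 1)) = basisSeq k := by
      intro k hk
      simp only [U]
      rw [if_neg (by omega), Nat.add_sub_cancel, if_neg, basisSeq]
      intro hkS
      have := Finset.mem_range.1 (Finset.mem_filter.1 (hS hkS)).1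
      omega
    refine Eq.trans (pfaffian_congr fun a b _ => ?_) (pfaffian_wedge_eq_zero (hX ω.2) hU)
    refine (eval_linePoly ω t S I' (hw a b)).trans (congrArg (wedge ω.1) (funext fun k => ?_))
    simp only [pairSeq, U, Nat.add_sub_cancel, a.2, b.2, if_true]
    by_cases hk : 2 ≤ k
    · rw [if_neg (c := k = 0) (by omega), if_neg (c := k = 1) (by omega),
        if_neg (c := k = 0) (by omega), if_neg (c := k = 1) (by omega), if_neg (c := k + _ < _) (by omega)]
    · have hkS : k ∉ S := fun hh => hk (hD k (hS hh)).1
      rw [if_neg hkS]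
      have : k = 0 ∨ k = 1 := by omega
      rcases this with rfl | rfl <;> simp
  · intro S _
    have h1 : u (2 * (r + 1)) = i := by simp [u]
    have h2 : u (2 * (r + 1) + 1) = j := by simp [u]
    simp only [A, h1, h2]
    rfl
  · intro S hS y hy
    -- The constant coefficient of the block Pfaffian is a polynomial in coordinates already known,
    -- and equals `Pf K r`, which vanishes nowhere on `X`.
    refine hO _ ?_ ?_ y hy
    · refine pfaffian_mem (coeffsIn O) (fun a b hab => hentries S hS _ _ ?_ ?_) 0
      · exact hab
      · rintro ⟨h1, -⟩
        have := a.2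
        simp only [Fin.val_castLE] at h1
        omega
    · intro ω hω
      refine hX' ω.1 ω.2 ?_
      rw [eval_Pf, ← hω, coeff_pfaffian_zero]
      refine Eq.trans ?_ (pfaffian_apply _ ω).symm
      refine pfaffian_congr fun a b _ => ?_
      have h3 : ∀ c : Fin (2 * (r + 1)), u c = enum (2 * r) c := fun c => if_pos c.2
      refine Eq.trans ?_ (congrFun (coeff_zero_linePoly S I' (pairSeq (u a) (u b) posIdx)) ω).symm
      rw [h3, h3]
      refine congrArg (wedge ω.1) (funext fun k => ?_)
      simp only [id, pairSeq]
      split_ifs <;> rfl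

end Reduction

end InfWedge
end

noncomputable section

namespace InfWedge

universe u

/-! ### Elimination of pairs of distant gaps, and the resulting generation statement. -/

section Reduction

variable {K : Type u} [Field K] {X : Set (DualWedge K)}

theorem IsStd.comp_swap {w : ℕ → VInf K} (h : IsStd w) (i j : ℕ) : IsStd (w ∘ Equiv.swap i j) := by
  obtain ⟨p, hp⟩ := h
  refine ⟨max p (max i j + 1), fun k hk => ?_⟩
  rw [Function.comp_apply, Equiv.swap_apply_of_ne_of_ne (by omega) (by omega), hp k (by omega)]

theorem neg_one_pow_eq_one (R : Type*) [CommRing R] (n : ℕ) : (-1 : R) ^ (n + (n + 1) + 1) = 1 :=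
  Even.neg_one_pow ⟨n + 1, by ring⟩

/-- Eliminating a pair of distant gaps by the dual Pfaffian relations. -/
theorem mem_of_distantGaps [Infinite K] {r s N : ℕ} (hN : 2 * (s + 1) ≤ N)
    (hX : X ⊆ (pfaffianVariety K r (s + 1) : Set (DualWedge K)))
    (hX' : ∀ ω ∈ X, eval K (PfDual K s) ω ≠ 0) {O : Subalgebra K (X → K)} (hO : DivisionClosed O)
    {I : ℕ → Idx} (hI : IsStdIdx I) (hinj : I.Injective)
    (h : ∀ J : ℕ → Idx, IsStdIdx J → distantNeg N J ⊆ distantNeg N I →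
      distantGaps N J ⊂ distantGaps N I → coordOn X J ∈ O)
    {i j : ℕ} (hi : i ∈ distantGaps N I) (hj : j ∈ distantGaps N I) (hij : i ≠ j) :
    coordOn X I ∈ O := by
  classical
  -- In the enumeration `-2, -1, 1, 2, …` the indices `i + 1` and `j + 1` stand at positions `i + 2`
  -- and `j + 2`. The permutation moves them to the two last rows of the dual Pfaffian matrix.
  obtain ⟨π, hπ⟩ : ∃ π : Equiv.Perm ℕ,
      π = Equiv.swap (2 * (s + 1)) (i + 2) * Equiv.swap (2 * (s + 1) + 1) (j + 2) := ⟨_, rfl⟩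
  have hi1 := hi.1
  have hj1 := hj.1
  have hπ1 : π (2 * (s + 1)) = i + 2 := by
    rw [hπ, Equiv.Perm.mul_apply, Equiv.swap_apply_of_ne_of_ne (a := 2 * (s + 1) + 1)
      (b := j + 2) (by omega) (by omega), Equiv.swap_apply_left]
  have hπ2 : π (2 * (s + 1) + 1) = j + 2 := by
    rw [hπ, Equiv.Perm.mul_apply, Equiv.swap_apply_left,
      Equiv.swap_apply_of_ne_of_ne (by omega) (by omega)]
  have hπ0 : ∀ n, n ≠ 2 * (s + 1) → n ≠ 2 * (s + 1) + 1 → n ≠ i + 2 → n ≠ j + 2 → π n = n := by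
    intro n h1 h2 h3 h4
    rw [hπ, Equiv.Perm.mul_apply, Equiv.swap_apply_of_ne_of_ne h2 h4,
      Equiv.swap_apply_of_ne_of_ne h1 h3]
  let V : ℕ → Idx := fun n => enum 2 (π n)
  have hV1 : V (2 * (s + 1)) = posIdx i := by simp only [V, hπ1, enum_add]
  have hV2 : V (2 * (s + 1) + 1) = posIdx j := by simp only [V, hπ2, enum_add]
  have hVinj : V.Injective := (enum_injective 2).comp π.injective
  have hVtail : ∀ k, i + j + 2 * (s + 1) < k → V (k + 2) = posIdx k := by
    intro k hk
    simp only [V]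
    rw [hπ0 _ (by omega) (by omega) (by omega) (by omega), enum_add]
  have hVskip : ∀ {a b : ℕ}, a < b → b ≤ 2 * (s + 1) + 1 → ∀ k, i + j + 2 * (s + 1) < k →
      V (skip a b k) = posIdx k := by
    intro a b hab hb k hk
    rw [skip_of_le hab (by omega), hVtail k hk]
  -- The rows left over in the last entry; its base sequence `B` omits exactly the gaps `i + 1` and
  -- `j + 1` among the enumerated indices.
  let κ : ℕ → ℕ := skip (2 * (s + 1)) (2 * (s + 1) + 1)
  have hκ : StrictMono κ := skip_strictMono _ _
  have hκne : ∀ k, κ k ≠ 2 * (s + 1) ∧ κ k ≠ 2 * (s + 1) + 1 := skip_ne (by omega)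
  let B : ℕ → Idx := fun k => V (κ k)
  have hBinj : B.Injective := hVinj.comp hκ.injective
  have hBtail : ∀ k, i + j + 2 * (s + 1) < k → B k = posIdx k := hVskip (by omega) le_rfl
  obtain ⟨I', hI', hinj', hrange, halign, ε, hε⟩ :=
    exists_aligned (K := K) hBinj hinj ⟨_, fun k hk => hBtail k (Nat.lt_of_succ_le hk)⟩ hI
  have hneg : distantNeg N I' = distantNeg N I := by simp only [distantNeg, hrange]
  have hgaps : distantGaps N I' = distantGaps N I := by simp only [distantGaps, hrange]
  rw [← hneg, ← hgaps] at h
  rw [← hgaps] at hi hj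
  suffices hmem : coordOn X I' ∈ O by
    have : coordOn X I = ε • coordOn X I' := by
      ext ω
      change coord I ω.1 = ε • coord I' ω.1
      rw [hε, smul_smul, Int.units_mul_self, one_smul]
    rw [this, Units.smul_def]
    exact O.zsmul_mem hmem _
  obtain ⟨p0, hp0⟩ := hI'
  obtain ⟨p, hp, hp'⟩ : ∃ p, (∀ k, p ≤ k → I' k = posIdx k) ∧ i + j + 2 * (s + 1) < p :=
    ⟨p0 + i + j + 2 * (s + 1) + 1, fun k hk => hp0 k (by omega), by omega⟩
  let D : Finset ℕ := (Finset.range p).filter fun k => B k ≠ I' k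
  have hD : ∀ k ∈ D, B k ∉ Set.range I' := by
    intro k hk hmem
    refine (Finset.mem_filter.1 hk).2 (halign k ?_).symm
    rwa [← hrange]
  -- The directions of the lines, indexed by rows so that row `κ k` moves towards `I' k`. The values
  -- in the two last rows are never used, but lie in the range of `I'`.
  let E : ℕ → Idx := fun n => if n < 2 * (s + 1) then I' n else I' (n - 2)
  have hEκ : ∀ k, E (κ k) = I' k := by
    intro k
    simp only [E, κ, skip]
    split_ifs
    all_goals first
      | rfl
      | omega
  have hEr : ∀ n, E n ∈ Set.range I' := by
    intro n
    simp only [E]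
    split_ifs
    exacts [⟨_, rfl⟩, ⟨_, rfl⟩]
  -- Translates the moving rows `κ '' S` into positions of the sequence in which rows `a` and `b`
  -- are skipped.
  let pre : Finset ℕ → ℕ → ℕ → Finset ℕ := fun S a b =>
    (S.image κ).preimage (skip a b) (skip_strictMono a b).injective.injOn
  have hpre : ∀ S a b k, k ∈ pre S a b ↔ ∃ l ∈ S, κ l = skip a b k := fun S a b k => by
    simp only [pre, Finset.mem_preimage, Finset.mem_image]
  have hpre' : ∀ S, pre S (2 * (s + 1)) (2 * (s + 1) + 1) = S := by
    intro S
    ext k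
    rw [hpre]
    exact ⟨fun ⟨l, hl, hlk⟩ => hκ.injective hlk ▸ hl, fun hk => ⟨k, hk, rfl⟩⟩
  let A : Finset ℕ → Matrix (Fin (2 * (s + 1 + 1))) (Fin (2 * (s + 1 + 1))) (Polynomial (X → K)) :=
    fun S a b => (-1) ^ ((a : ℕ) + b + 1) *
      linePoly X (pre S a b) (fun k => E (skip a b k)) (fun k => V (skip a b k))
  let f : Finset ℕ → X → K := fun T => coordOn X fun k => if k ∈ T then I' k else B k
  have hfD : f D = coordOn X I' := by
    refine congrArg (coordOn X) (funext fun k => ?_)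
    by_cases hk : k ∈ D
    · exact if_pos hk
    · refine (if_neg hk).trans ?_
      by_contra hne
      refine hk (Finset.mem_filter.2 ⟨Finset.mem_range.2 ?_, hne⟩)
      by_contra hkp
      exact hne ((hBtail k (by omega)).trans (hp k (by omega)).symm)
  have hentries : ∀ S ⊆ D, ∀ a b : Fin (2 * (s + 1 + 1)), a < b →
      ¬ ((a : ℕ) = 2 * (s + 1) ∧ (b : ℕ) = 2 * (s + 1) + 1) → A S a b ∈ coeffsIn O := by
    intro S hS a b hab hlast
    refine (coeffsIn O).mul_mem ((coeffsIn O).pow_mem ((coeffsIn O).neg_mem (coeffsIn O).one_mem) _)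
      (linePoly_mem O fun T hT => ?_)
    have hab' : (a : ℕ) < b := hab
    have hb' := b.2
    have hval : ∀ n : ℕ, n ≠ (a : ℕ) → n ≠ (b : ℕ) → n ∉ Set.range (fun l : S => κ l) → V n ∈ Set.range fun k =>
        if k ∈ T then E (skip a b k) else V (skip a b k) := by
      intro n hna hnb hn
      obtain ⟨k, hk, -⟩ := exists_skip hab' hna hnb
      refine ⟨k, ?_⟩
      have hkT : k ∉ T := fun hh => by
        obtain ⟨l, hl, hlk⟩ := (hpre S a b k).1 (hT hh)
        exact hn ⟨⟨l, hl⟩, hlk.trans hk⟩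
      simp only [hkT, if_false, hk]
    refine h _ ⟨p + 1, fun k hk => ?_⟩ ?_ (Set.ssubset_iff_exists.2 ⟨?_, ?_⟩)
    · have hkT : k ∉ T := fun hh => by
        obtain ⟨l, hl, hlk⟩ := (hpre S a b k).1 (hT hh)
        have h1 := Finset.mem_range.1 (Finset.mem_filter.1 (hS hl)).1
        rw [skip_of_le hab' (by omega)] at hlk
        simp only [κ, skip] at hlk
        split_ifs at hlk <;> omega
      simp only [hkT, if_false]
      exact hVskip hab' (by omega) k (by omega)
    · rintro x ⟨hx, k, rfl⟩
      refine ⟨hx, ?_⟩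
      simp only at hx ⊢
      split_ifs at hx ⊢
      · exact hEr _
      · have := neg_le_enum 2 (π (skip a b k))
        simp only [V] at hx
        omega
    · rintro k ⟨hk, hk'⟩
      -- A distant gap `k` of the new sequence is traced to its row `n`. If that row is one of the
      -- two last ones or was replaced, then `k` was a gap of `I'`; an earlier row is not distant,
      -- and any other row still occurs.
      refine ⟨hk, ?_⟩
      have hn : V (π.symm (k + 2)) = posIdx k := by
        simp only [V, Equiv.apply_symm_apply, enum_add]
      obtain ⟨n, hn'⟩ : ∃ n, π.symm (k + 2) = n := ⟨_, rfl⟩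
      rw [hn'] at hn
      have hnπ : π n = k + 2 := by rw [← hn', Equiv.apply_symm_apply]
      by_cases hn1 : n = 2 * (s + 1)
      · rw [hn1, hV1] at hn
        rw [← posIdx_injective hn]
        exact hi.2
      by_cases hn2 : n = 2 * (s + 1) + 1
      · rw [hn2, hV2] at hn
        rw [← posIdx_injective hn]
        exact hj.2
      by_cases hn3 : n < 2 * (s + 1)
      · rw [hπ0 n (by omega) (by omega) (by omega) (by omega)] at hnπ
        omega
      by_cases hn4 : n ∈ Set.range fun l : S => κ l
      · obtain ⟨⟨l, hl⟩, hln⟩ := hn4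
        have := hD l (hS hl)
        simp only at hln
        simp only [B, hln, hn] at this
        exact this
      · refine absurd ?_ hk'
        rw [← hn]
        exact hval n (by omega) (by omega) hn4
    -- Unless exactly the two last rows are skipped, one of them is present and not replaced, so `i`
    -- or `j` ceases to be a gap.
    · have hκr : ∀ l : S, κ l ≠ 2 * (s + 1) ∧ κ l ≠ 2 * (s + 1) + 1 := fun l => hκne l
      by_cases hbm : (b : ℕ) = 2 * (s + 1)
      · refine ⟨j, hj, fun hh => hh.2 ?_⟩
        rw [← hV2]
        exact hval _ (by omega) (by omega) fun ⟨l, hl⟩ => (hκr l).2 hl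
      · refine ⟨i, hi, fun hh => hh.2 ?_⟩
        rw [← hV1]
        exact hval _ (by omega) (by omega) fun ⟨l, hl⟩ => (hκr l).1 hl
  rw [← hfD]
  refine mem_of_pfaffian_relations O D A f ?_ hentries ?_ ?_ D (Finset.Subset.refl _)
  · intro S hS
    refine pfaffian_eq_zero_of_eval _ fun ω t => ?_
    let U : ℕ → VInf K := fun n =>
      if n ∈ S.image κ then basisVec K (V n) + t • basisVec K (E n) else basisVec K (V n)
    have hU : ∀ k, p + 1 ≤ k → U (k + 2) = basisSeq k := by
      intro k hk
      simp only [U]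
      rw [if_neg, hVtail k (by omega), basisSeq]
      intro hkS
      obtain ⟨l, hl, hlk⟩ := Finset.mem_image.1 hkS
      have h1 := Finset.mem_range.1 (Finset.mem_filter.1 (hS hl)).1
      simp only [κ, skip] at hlk
      split_ifs at hlk <;> omega
    refine Eq.trans (pfaffian_congr fun a b hab => ?_) (pfaffian_wedge_skip_eq_zero (hX ω.2) hU)
    have hw : IsStdIdx fun k => V (skip a b k) := by
      refine ⟨i + j + 2 * (s + 1) + 1, fun k hk => hVskip hab ?_ k (by omega)⟩
      have := b.2
      omega
    simp only [A]
    rw [Polynomial.map_mul, Polynomial.eval_mul]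
    refine congrArg₂ (· * ·) (by simp) ((eval_linePoly ω t _ _ hw).trans
      (congrArg (wedge ω.1) (funext fun k => ?_)))
    simp only [U, pre, Finset.mem_preimage]
  · intro S _
    -- The last entry carries the sign `+1`, so it is the line polynomial itself.
    have h1 : (-1 : Polynomial (X → K)) ^ (2 * (s + 1) + (2 * (s + 1) + 1) + 1) = 1 :=
      neg_one_pow_eq_one (Polynomial (X → K)) (2 * (s + 1))
    refine (congrArg (· * linePoly X (pre S (2 * (s + 1)) (2 * (s + 1) + 1)) (fun k => E (κ k))
      fun k => V (κ k)) h1).trans ((one_mul _).trans ?_)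
    rw [hpre', linePoly]
    refine Finset.sum_congr rfl fun T _ => ?_
    refine congrArg (fun w => Polynomial.X ^ T.card * Polynomial.C (coordOn X w))
      (funext fun k => ?_)
    exact congrArg (fun e => if k ∈ T then e else B k) (hEκ k)
  · intro S hS y hy
    refine hO _ ?_ ?_ y hy
    · refine pfaffian_mem (coeffsIn O) (fun a b hab => hentries S hS _ _ ?_ ?_) 0
      · exact hab
      · rintro ⟨h1, -⟩
        have := a.2
        simp only [Fin.val_castLE] at h1
        omega
    · intro ω hω
      refine hX' ω.1 ω.2 ?_
      rw [eval_PfDual, ← hω, coeff_pfaffian_zero]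
      refine Eq.trans ?_ (pfaffian_apply _ ω).symm
      refine pfaffian_congr fun a b hab => ?_
      have hb := b.2
      have hab' : (a : ℕ) < b := hab
      have h1 : (linePoly X (pre S a b) (fun k => E (skip a b k)) fun k => V (skip a b k)).coeff 0 ω
          = wedge ω.1 fun k => basisVec K (V (skip a b k)) :=
        congrFun (coeff_zero_linePoly _ _ _) ω
      -- Within the block, the permutation `π` amounts to two transpositions of tail positions.
      -- Their signs cancel, and the standard dual Pfaffian appears.
      have h2 : (wedge ω.1 fun k => basisVec K (V (skip a b k))) =
          wedge ω.1 fun k => enumSeq 2 (skip a b k) := by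
        have hstd : IsStd fun k => enumSeq (K := K) 2 (skip a b k) := isStd_enumSeq_skip hab
        have h3 := wedge_swap ω.1 (hstd.comp_swap (2 * s) i) (show 2 * s + 1 ≠ j by omega)
        rw [wedge_swap ω.1 hstd (show 2 * s ≠ i by omega), neg_neg] at h3
        rw [← h3]
        refine congrArg (wedge ω.1) (funext fun k => ?_)
        simp only [Function.comp_apply, (skip_strictMono a b).injective.map_swap]
        rw [skip_of_le hab' (k := 2 * s) (by omega), skip_of_le hab' (k := 2 * s + 1) (by omega),
          skip_of_le hab' (k := i) (by omega), skip_of_le hab' (k := j) (by omega)]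
        simp only [V, hπ]
        rfl
      have h4 : ∀ (n : ℕ) (P : Polynomial (X → K)),
          ((-1) ^ n * P).coeff 0 ω = (-1) ^ n * P.coeff 0 ω := by
        intro n P
        rw [Polynomial.mul_coeff_zero, ← Polynomial.constantCoeff_apply, map_pow, map_neg, map_one]
        rfl
      exact (congrArg ((-1) ^ ((a : ℕ) + b + 1) * ·) (h2.symm.trans h1.symm)).trans (h4 _ _).symm

/-- All coordinates are determined by those with at most one distant negative index and at most
one distant gap. -/
theorem coordOn_mem [Infinite K] {r s N : ℕ} (hN : 2 * r ≤ N ∧ 2 * (s + 1) ≤ N)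
    (hX : X ⊆ (pfaffianVariety K (r + 1) (s + 1) : Set (DualWedge K)))
    (h1 : ∀ ω ∈ X, eval K (Pf K r) ω ≠ 0) (h2 : ∀ ω ∈ X, eval K (PfDual K s) ω ≠ 0)
    {O : Subalgebra K (X → K)} (hO : DivisionClosed O)
    (h : ∀ J : ℕ → Idx, IsStdIdx J → J.Injective → (distantNeg N J).Subsingleton →
      (distantGaps N J).Subsingleton → coordOn X J ∈ O) {I : ℕ → Idx} (hI : IsStdIdx I) :
    coordOn X I ∈ O := by
  -- Each elimination lowers one of the two numbers without raising the other, so their sum is the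
  -- induction parameter.
  obtain ⟨n, hn⟩ : ∃ n, (distantNeg N I).ncard + (distantGaps N I).ncard = n := ⟨_, rfl⟩
  induction n using Nat.strong_induction_on generalizing I with
  | _ n ih =>
    subst hn
    by_cases hinj : I.Injective
    swap
    · have : coordOn X I = 0 := funext fun ω => coord_eq_zero hI hinj ω.1
      rw [this]
      exact O.zero_mem
    by_cases ha : (distantNeg N I).Subsingleton
    · by_cases hb : (distantGaps N I).Subsingleton
      · exact h I hI hinj ha hb
      · rw [Set.not_subsingleton_iff] at hb
        obtain ⟨i, hi, j, hj, hij⟩ := hb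
        refine mem_of_distantGaps hN.2 hX h2 hO hI hinj (fun J hJ hJ1 hJ2 => ?_) hi hj hij
        refine ih _ ?_ hJ rfl
        have e1 := Set.ncard_le_ncard hJ1 (finite_distantNeg N hI)
        have e2 := Set.ncard_lt_ncard hJ2 (finite_distantGaps N hI)
        omega
    · rw [Set.not_subsingleton_iff] at ha
      obtain ⟨i, hi, j, hj, hij⟩ := ha
      refine mem_of_distantNeg ⟨hN.1, by omega⟩ hX h1 hO hI hinj (fun J hJ hJ1 hJ2 => ?_) hi hj hij
      refine ih _ ?_ hJ rfl
      have e1 := Set.ncard_lt_ncard hJ1 (finite_distantNeg N hI)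
      have e2 := Set.ncard_le_ncard hJ2 (finite_distantGaps N hI)
      omega

end Reduction

end InfWedge
end

noncomputable section

namespace InfWedge

universe u

/-! ### Transvections -/

section Transvections

variable {K : Type u} [Field K]

/-- The inverse of `g` sends `x_i` to `x_i + t x_j` and fixes all other basis vectors. -/
def IsTransvection (g : GInf K) (i j : Idx) (t : K) : Prop :=
  (∀ k, k ≠ i → ((g⁻¹ : GInf K) : VInf K ≃ₗ[K] VInf K) (basisVec K k) = basisVec K k) ∧
    ((g⁻¹ : GInf K) : VInf K ≃ₗ[K] VInf K) (basisVec K i) = basisVec K i + t • basisVec K j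

theorem exists_isTransvection {i j : Idx} (hij : i ≠ j) (t : K) :
    ∃ g : GInf K, IsTransvection g i j t := by
  let M : K → VInf K →ₗ[K] VInf K := fun c =>
    LinearMap.id + (Finsupp.lapply i).smulRight (c • basisVec K j)
  have hM : ∀ c v, M c v = v + v i • c • basisVec K j := fun c v => rfl
  have hMM : ∀ c v, M c (M (-c) v) = v := by
    intro c v
    have h0 : basisVec K j i = 0 := Finsupp.single_eq_of_ne hij
    have h1 : M (-c) v i = v i := by
      rw [hM, Finsupp.add_apply, Finsupp.smul_apply, Finsupp.smul_apply, h0, smul_zero, smul_zero,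
        add_zero]
    rw [hM c, h1, hM, neg_smul, smul_neg, neg_add_cancel_right]
  let e : VInf K ≃ₗ[K] VInf K := LinearEquiv.ofLinearMap (M t) (M (-t))
    (LinearMap.ext fun v => hMM t v)
    (LinearMap.ext fun v => by simpa using hMM (-t) v)
  have he : ∀ v, e v = v + v i • t • basisVec K j := fun v => hM t v
  have hfix : ∀ k, k ≠ i → e (basisVec K k) = basisVec K k := by
    intro k hk
    rw [he, basisVec, Finsupp.single_eq_of_ne (Ne.symm hk), zero_smul, add_zero]
  let p := max i.1.natAbs j.1.natAbs
  have hi : i ∈ range (p, p) := ⟨by simp only; omega, by simp only; omega⟩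
  have hj : j ∈ range (p, p) := ⟨by simp only; omega, by simp only; omega⟩
  have hMV : ∀ c v, v ∈ VSub K (p, p) → M c v ∈ VSub K (p, p) := fun c v hv =>
    Submodule.add_mem _ hv (Submodule.smul_mem _ _ (Submodule.smul_mem _ _ (basisVec_mem hj)))
  have hG : e ∈ GInf K := by
    refine ⟨(p, p), le_antisymm ?_ ?_, fun k hk => hfix k ?_⟩
    · rintro _ ⟨v, hv, rfl⟩
      exact hMV t v hv
    · intro v hv
      exact ⟨M (-t) v, hMV _ v hv, hMM t v⟩
    · rintro rfl
      exact hk hi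
  refine ⟨(⟨e, hG⟩ : GInf K)⁻¹, ?_⟩
  rw [IsTransvection, inv_inv]
  refine ⟨hfix, ?_⟩
  change e (basisVec K i) = _
  rw [he, basisVec, Finsupp.single_eq_same, one_smul]

variable {g : GInf K} {i j : Idx} {t : K}

theorem IsTransvection.coord_of_notMem (hg : IsTransvection g i j t) {I : ℕ → Idx}
    (hI : IsStdIdx I) (h : ∀ k, I k ≠ i) (ω : DualWedge K) : coord I (g • ω) = coord I ω := by
  rw [coord, wedge_smul g ω hI.isStd]
  exact congrArg (wedge ω) (funext fun k => hg.1 _ (h k))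

theorem IsTransvection.coord_of_mem (hg : IsTransvection g i j t) {I : ℕ → Idx}
    (hI : IsStdIdx I) {p : ℕ} (hp : I p = i) (h : ∀ k, k ≠ p → I k ≠ i) (ω : DualWedge K) :
    coord I (g • ω) = coord I ω + t * coord (Function.update I p j) ω := by
  have h1 := wedge_update_add_smul ω hI.isStd p (basisVec K i) (basisVec K j) t
  have h2 : Function.update (fun k => basisVec K (I k)) p (basisVec K i) =
      fun k => basisVec K (I k) := by
    rw [Function.update_eq_iff]
    exact ⟨by rw [hp], fun _ _ => rfl⟩
  have h3 : Function.update (fun k => basisVec K (I k)) p (basisVec K j) =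
      fun k => basisVec K (Function.update I p j k) := by
    ext1 k
    by_cases hk : k = p
    · subst hk; simp
    · simp [hk]
  rw [h2, h3] at h1
  rw [coord, wedge_smul g ω hI.isStd]
  refine Eq.trans (congrArg (wedge ω) (funext fun k => ?_)) h1
  by_cases hk : k = p
  · subst hk
    rw [Function.update_self, hp, hg.2]
  · rw [Function.update_of_ne hk, hg.1 _ (h k hk)]

theorem IsStdIdx.update {I : ℕ → Idx} (hI : IsStdIdx I) (p : ℕ) (i : Idx) :
    IsStdIdx (Function.update I p i) := by
  obtain ⟨q, hq⟩ := hI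
  refine ⟨max q (p + 1), fun k hk => ?_⟩
  rw [Function.update_of_ne (by omega), hq k (by omega)]

end Transvections

/-! ### The tuple of matrices of coordinates with few distant indices -/

section NearTuple

variable {K : Type u} [Field K] {N : ℕ}

/-- The indices between `-N` and `N`. -/
abbrev Near (N : ℕ) : Type := {i : Idx // i ∈ range (N, N)}

instance : Finite (Near N) := (finite_range_idx (N, N)).to_subtype

/-- The distant negative indices. -/
def farNeg (N a : ℕ) : Idx := ⟨-(N : ℤ) - 1 - a, by omega⟩

theorem farNeg_lt (N a : ℕ) : (farNeg N a).1 < -(N : ℤ) := by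
  simp only [farNeg]; omega

theorem farNeg_injective (N : ℕ) : Function.Injective (farNeg N) := by
  intro a b h
  have := congrArg Subtype.val h
  simp only [farNeg] at this
  omega

/-- The sequence `J_0, …, J_{N-1}, N + 1, N + 2, …`, in which the entry at position `N + b` is
replaced by `J_N` if `k = some b`. -/
def holeSeq (J : Fin (N + 1) → Idx) (k : Option ℕ) (n : ℕ) : Idx :=
  if h : n < N then J ⟨n, by omega⟩ else if k = some (n - N) then J (Fin.last N) else posIdx n

theorem isStdIdx_holeSeq (J : Fin (N + 1) → Idx) (k : Option ℕ) : IsStdIdx (holeSeq J k) := by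
  refine ⟨N + k.getD 0 + 1, fun n hn => ?_⟩
  unfold holeSeq
  rw [dif_neg (by omega), if_neg]
  rintro rfl
  simp only [Option.getD_some] at hn
  omega

theorem holeSeq_add (J : Fin (N + 1) → Idx) {k : Option ℕ} {b : ℕ} (h : k ≠ some b) :
    holeSeq J k (N + b) = posIdx (N + b) := by
  unfold holeSeq
  rw [dif_neg (by omega), if_neg]
  rwa [Nat.add_sub_cancel_left]

theorem holeSeq_eq (J : Fin (N + 1) → Idx) (k : Option ℕ) (n : ℕ) :
    (∃ l, holeSeq J k n = J l) ∨ (N ≤ n ∧ k ≠ some (n - N) ∧ holeSeq J k n = posIdx n) := by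
  unfold holeSeq
  split_ifs with h1 h2
  · exact Or.inl ⟨_, rfl⟩
  · exact Or.inl ⟨_, rfl⟩
  · exact Or.inr ⟨by omega, h2, rfl⟩

/-- The entries of a tuple occupy one position in the associated sequence. -/
theorem exists_slot {l : Fin (N + 1)} {k : Option ℕ} (h : (l : ℕ) < N ∨ k.isSome) :
    ∃ p, ∀ (J : Fin (N + 1) → Idx) u,
      holeSeq (Function.update J l u) k = Function.update (holeSeq J k) p u := by
  by_cases hl : (l : ℕ) < N
  · refine ⟨l, fun J u => funext fun n => ?_⟩
    unfold holeSeq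
    by_cases hn : n = l
    · subst hn; simp [hl]
    · have h1 : Fin.last N ≠ l := fun e => by
        rw [← e, Fin.val_last] at hl
        omega
      have h2 : ∀ h : n < N + 1, (⟨n, h⟩ : Fin (N + 1)) ≠ l := fun h e => hn (congrArg Fin.val e)
      simp only [Function.update_of_ne hn, Function.update_of_ne h1, Function.update_of_ne (h2 _)]
  · obtain ⟨b, rfl⟩ := Option.isSome_iff_exists.1 (h.resolve_left hl)
    have hl' : l = Fin.last N := Fin.ext (by have := l.2; rw [Fin.val_last]; omega)
    subst hl'
    refine ⟨N + b, fun J u => funext fun n => ?_⟩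
    unfold holeSeq
    by_cases hn : n = N + b
    · subst hn; simp
    · rw [Function.update_of_ne hn]
      have h2 : ∀ h : n < N + 1, n < N → (⟨n, h⟩ : Fin (N + 1)) ≠ Fin.last N := fun h h' e => by
        have := congrArg Fin.val e
        simp only [Fin.val_last] at this
        omega
      split_ifs with h1 h3
      · rw [Function.update_of_ne (h2 _ h1)]
      · have h4 := Option.some.inj h3
        omega
      · rfl

variable (N) in
/-- The matrices, rows, columns, and constants consisting of the coordinates of a point that have
at most one distant negative index and at most one distant gap. -/
def nearTuple (ω : DualWedge K) : TupleSpace K (Fin (N + 1) × (Fin (N + 1) → Near N))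
    (Fin N × (Fin (N + 1) → Near N)) (Fin (N + 1) → Near N) (Fin (N + 1) → Near N) :=
  (fun x => Finsupp.linearCombination K fun a => Finsupp.linearCombination K fun b =>
      coord (holeSeq (Function.update (fun l => (x.2 l).1) x.1 (farNeg N a)) (some b)) ω,
    fun x => Finsupp.linearCombination K fun a =>
      coord (holeSeq (Function.update (fun l => (x.2 l).1) x.1.castSucc (farNeg N a)) none) ω,
    fun x => Finsupp.linearCombination K fun b =>
      coord (holeSeq (fun l => (x l).1) (some b)) ω,
    fun x => coord (holeSeq (fun l => (x l).1) none) ω)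

theorem linearCombination_std {W : Type*} [AddCommGroup W] [Module K W] (f : ℕ → W) (a : ℕ) :
    Finsupp.linearCombination K f (std a) = f a := by
  simp [std]

theorem nearTuple_mat (ω : DualWedge K) (x : Fin (N + 1) × (Fin (N + 1) → Near N)) (a b : ℕ) :
    (nearTuple N ω).1 x (std a) (std b) =
      coord (holeSeq (Function.update (fun l => (x.2 l).1) x.1 (farNeg N a)) (some b)) ω := by
  refine (LinearMap.congr_fun (linearCombination_std _ a) (std b)).trans ?_
  exact linearCombination_std _ b

theorem nearTuple_row (ω : DualWedge K) (x : Fin N × (Fin (N + 1) → Near N)) (a : ℕ) :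
    (nearTuple N ω).2.1 x (std a) =
      coord (holeSeq (Function.update (fun l => (x.2 l).1) x.1.castSucc (farNeg N a)) none) ω :=
  linearCombination_std _ a

theorem nearTuple_col (ω : DualWedge K) (x : Fin (N + 1) → Near N) (b : ℕ) :
    (nearTuple N ω).2.2.1 x (std b) = coord (holeSeq (fun l => (x l).1) (some b)) ω :=
  linearCombination_std _ b

theorem nearTuple_const (ω : DualWedge K) (x : Fin (N + 1) → Near N) :
    (nearTuple N ω).2.2.2 x = coord (holeSeq (fun l => (x l).1) none) ω := rfl

theorem neg_le_holeSeq (J : Fin (N + 1) → Near N) (k : Option ℕ) (n : ℕ) :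
    -(N : ℤ) ≤ (holeSeq (fun l => (J l).1) k n).1 := by
  rcases holeSeq_eq (fun l => (J l).1) k n with ⟨l, h⟩ | ⟨-, -, h⟩
  · rw [h]; exact (J l).2.1
  · rw [h]
    have := posIdx_pos n
    omega

/-- The single slot of `l` is the only position that holds a distant negative index, so
multilinearity produces one extra term. -/
theorem coord_smul_farNeg {g : GInf K} {a a' : ℕ} {t : K}
    (hg : IsTransvection g (farNeg N a) (farNeg N a') t) (J : Fin (N + 1) → Near N)
    {l : Fin (N + 1)} {k : Option ℕ} (h : (l : ℕ) < N ∨ k.isSome) (ω : DualWedge K) (c : ℕ) :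
    coord (holeSeq (Function.update (fun l => (J l).1) l (farNeg N c)) k) (g • ω) =
      coord (holeSeq (Function.update (fun l => (J l).1) l (farNeg N c)) k) ω + if c = a then
        t * coord (holeSeq (Function.update (fun l => (J l).1) l (farNeg N a')) k) ω else 0 := by
  obtain ⟨p, hp⟩ := exists_slot h
  simp only [hp]
  have hstd := (isStdIdx_holeSeq (fun l => (J l).1) k).update p (farNeg N c)
  have hne : ∀ n, n ≠ p → Function.update (holeSeq (fun l => (J l).1) k) p (farNeg N c) n
      ≠ farNeg N a := by
    intro n hn e
    rw [Function.update_of_ne hn] at e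
    have h1 := neg_le_holeSeq J k n
    have h2 := farNeg_lt N a
    rw [e] at h1
    omega
  by_cases hc : c = a
  · subst hc
    rw [if_pos rfl, hg.coord_of_mem hstd (p := p) (Function.update_self ..) hne,
      Function.update_idem]
  · rw [if_neg hc, add_zero]
    refine hg.coord_of_notMem hstd (fun n => ?_) ω
    by_cases hn : n = p
    · subst hn
      rw [Function.update_self]
      exact fun e => hc (farNeg_injective N e)
    · exact hne n hn

theorem coord_smul_farNeg_of_near {g : GInf K} {a a' : ℕ} {t : K}
    (hg : IsTransvection g (farNeg N a) (farNeg N a') t) (J : Fin (N + 1) → Near N)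
    (k : Option ℕ) (ω : DualWedge K) :
    coord (holeSeq (fun l => (J l).1) k) (g • ω) = coord (holeSeq (fun l => (J l).1) k) ω := by
  refine hg.coord_of_notMem (isStdIdx_holeSeq _ _) (fun n e => ?_) ω
  have h1 := neg_le_holeSeq J k n
  have h2 := farNeg_lt N a
  rw [e] at h1
  omega

theorem apply_shear_std {W : Type*} [AddCommGroup W] [Module K W] (L : Vec K →ₗ[K] W)
    (a a' c : ℕ) (t : K) :
    L (shear a (t • std a') (std c)) = L (std c) + if c = a then t • L (std a') else 0 := by
  by_cases h : c = a
  · subst h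
    rw [shear_std_self, map_add, map_smul, if_pos rfl]
  · rw [shear_std_of_ne h, if_neg h, add_zero]

theorem nearTuple_smul_farNeg {g : GInf K} {a a' : ℕ} {t : K}
    (hg : IsTransvection g (farNeg N a) (farNeg N a') t) (ω : DualWedge K) :
    nearTuple N (g • ω) = tupleAct (shear a (t • std a')) 1 (nearTuple N ω) := by
  refine Prod.ext (funext fun x => ?_) (Prod.ext (funext fun x => ?_)
    (Prod.ext (funext fun x => ?_) (funext fun x => ?_)))
  · refine tuple_ext_std fun c => tuple_ext_std fun b => ?_
    change _ = (nearTuple N ω).1 x (shear a (t • std a') (std c)) (std b)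
    rw [apply_shear_std, nearTuple_mat, coord_smul_farNeg hg _ (Or.inr rfl), LinearMap.add_apply,
      nearTuple_mat]
    congr 1
    split_ifs
    · rw [LinearMap.smul_apply, nearTuple_mat, smul_eq_mul]
    · rfl
  · refine tuple_ext_std fun c => ?_
    change _ = (nearTuple N ω).2.1 x (shear a (t • std a') (std c))
    rw [apply_shear_std, nearTuple_row, coord_smul_farNeg hg _ (Or.inl x.1.2), nearTuple_row,
      nearTuple_row, smul_eq_mul]
  · refine tuple_ext_std fun c => ?_
    change _ = (nearTuple N ω).2.2.1 x (std c)
    rw [nearTuple_col, nearTuple_col, coord_smul_farNeg_of_near hg]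
  · change _ = (nearTuple N ω).2.2.2 x
    rw [nearTuple_const, nearTuple_const, coord_smul_farNeg_of_near hg]

/-- With a gap at `q`, replacing the index `N + p + 1` by `N + q + 1` moves the gap to `p`, up to
the transposition of two positions. This sign cancels the one in `-t`. With another gap or none, the
replacement repeats an index and contributes zero; with the gap at `p` there is nothing to replace.
-/
theorem coord_smul_farPos {g : GInf K} {p q : ℕ} (hpq : p ≠ q) {t : K}
    (hg : IsTransvection g (posIdx (N + p)) (posIdx (N + q)) (-t)) (J : Fin (N + 1) → Idx)
    (hJ : ∀ l, (J l).1 ≤ N) (k : Option ℕ) (ω : DualWedge K) :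
    coord (holeSeq J k) (g • ω) = coord (holeSeq J k) ω +
      if k = some q then t * coord (holeSeq J (some p)) ω else 0 := by
  have hval : ∀ k n, holeSeq J k n = posIdx (N + p) → n = N + p ∧ k ≠ some p := by
    intro k n hn
    rcases holeSeq_eq J k n with ⟨l, h⟩ | ⟨h1, h2, h⟩
    · have h3 := hJ l
      rw [← h, hn] at h3
      simp only [posIdx] at h3
      omega
    · have := posIdx_injective (h.symm.trans hn)
      subst this
      rw [Nat.add_sub_cancel_left] at h2
      exact ⟨rfl, h2⟩
  by_cases hk : k = some p
  · rw [if_neg (by rw [hk]; exact fun e => hpq (Option.some.inj e)), add_zero]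
    exact hg.coord_of_notMem (isStdIdx_holeSeq _ _) (fun n e => (hval k n e).2 hk) ω
  · rw [hg.coord_of_mem (isStdIdx_holeSeq _ _) (holeSeq_add J hk)
      (fun n hn e => hn (hval k n e).1)]
    congr 1
    split_ifs with hq
    · subst hq
      have h1 : (fun n => basisVec K (holeSeq J (some p) n)) =
          (fun n => basisVec K (Function.update (holeSeq J (some q)) (N + p) (posIdx (N + q)) n)) ∘
            Equiv.swap (N + p) (N + q) := by
        ext1 n
        rw [Function.comp_apply]
        congr 1
        by_cases h2 : n = N + p
        · subst h2
          rw [Equiv.swap_apply_left, Function.update_of_ne (by omega)]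
          simp [holeSeq]
        · by_cases h3 : n = N + q
          · subst h3
            rw [Equiv.swap_apply_right, Function.update_self,
              holeSeq_add J (fun e => hpq (Option.some.inj e))]
          · rw [Equiv.swap_apply_of_ne_of_ne h2 h3, Function.update_of_ne h2]
            unfold holeSeq
            split_ifs with h4 h5 h6 h6
            · rfl
            · rfl
            · have := Option.some.inj h5
              omega
            · have := Option.some.inj h6
              omega
            · rfl
      have h2 := wedge_swap ω ((isStdIdx_holeSeq J (some q)).update (N + p) (posIdx (N + q))).isStd
        (show N + p ≠ N + q by omega)
      rw [← h1] at h2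
      rw [coord, coord, h2]
      ring
    · have : coord (Function.update (holeSeq J k) (N + p) (posIdx (N + q))) ω = 0 := by
        refine coord_eq_zero ((isStdIdx_holeSeq J k).update _ _) (fun hinj => ?_) ω
        have := hinj (a₁ := N + p) (a₂ := N + q) (by
          rw [Function.update_self, Function.update_of_ne (by omega), holeSeq_add J hq])
        omega
      rw [this, mul_zero]

theorem nearTuple_smul_farPos {g : GInf K} {p q : ℕ} (hpq : p ≠ q) {t : K}
    (hg : IsTransvection g (posIdx (N + p)) (posIdx (N + q)) (-t)) (ω : DualWedge K) :
    nearTuple N (g • ω) = tupleAct 1 (shear q (t • std p)) (nearTuple N ω) := by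
  have hJ : ∀ (J : Fin (N + 1) → Near N) l, (J l).1.1 ≤ (N : ℤ) := fun J l => (J l).2.2
  have hJ' : ∀ (J : Fin (N + 1) → Near N) (l' : Fin (N + 1)) a l,
      (Function.update (fun l => (J l).1) l' (farNeg N a) l).1 ≤ (N : ℤ) := by
    intro J l' a l
    by_cases h : l = l'
    · subst h
      rw [Function.update_self]
      have := farNeg_lt N a
      omega
    · rw [Function.update_of_ne h]
      exact (J l).2.2
  refine Prod.ext (funext fun x => ?_) (Prod.ext (funext fun x => ?_)
    (Prod.ext (funext fun x => ?_) (funext fun x => ?_)))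
  · refine tuple_ext_std fun c => tuple_ext_std fun b => ?_
    change _ = (nearTuple N ω).1 x (std c) (shear q (t • std p) (std b))
    rw [apply_shear_std, nearTuple_mat, coord_smul_farPos hpq hg _ (hJ' _ _ _), nearTuple_mat,
      nearTuple_mat, smul_eq_mul]
    simp only [Option.some.injEq]
  · refine tuple_ext_std fun c => ?_
    change _ = (nearTuple N ω).2.1 x (std c)
    rw [nearTuple_row, nearTuple_row, coord_smul_farPos hpq hg _ (hJ' _ _ _)]
    simp
  · refine tuple_ext_std fun b => ?_
    change _ = (nearTuple N ω).2.2.1 x (shear q (t • std p) (std b))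
    rw [apply_shear_std, nearTuple_col, coord_smul_farPos hpq hg _ (hJ _), nearTuple_col,
      nearTuple_col, smul_eq_mul]
    simp only [Option.some.injEq]
  · change _ = (nearTuple N ω).2.2.2 x
    rw [nearTuple_const, nearTuple_const, coord_smul_farPos hpq hg _ (hJ _)]
    simp

end NearTuple

end InfWedge
end

noncomputable section

namespace InfWedge

universe u

/-! ### Noetherianity of the principal open piece -/

section Fractions

variable {K : Type u} [Field K] {X T : Type*}

/-- The functions that are fractions of functions from `O` composed with `ψ`. -/
def fractions (O : Subalgebra K (T → K)) (ψ : X → T) : Subalgebra K (X → K) where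
  carrier := {F | ∃ f ∈ O, ∃ g ∈ O, (∀ ω, g (ψ ω) ≠ 0) ∧ ∀ ω, g (ψ ω) * F ω = f (ψ ω)}
  mul_mem' := by
    rintro F F' ⟨f, hf, g, hg, h, e⟩ ⟨f', hf', g', hg', h', e'⟩
    refine ⟨f * f', O.mul_mem hf hf', g * g', O.mul_mem hg hg', fun ω => mul_ne_zero (h ω) (h' ω),
      fun ω => ?_⟩
    simp only [Pi.mul_apply, ← e, ← e']
    ring
  add_mem' := by
    rintro F F' ⟨f, hf, g, hg, h, e⟩ ⟨f', hf', g', hg', h', e'⟩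
    refine ⟨f * g' + g * f', O.add_mem (O.mul_mem hf hg') (O.mul_mem hg hf'), g * g',
      O.mul_mem hg hg', fun ω => mul_ne_zero (h ω) (h' ω), fun ω => ?_⟩
    simp only [Pi.mul_apply, Pi.add_apply, ← e, ← e']
    ring
  algebraMap_mem' := fun c => ⟨algebraMap K _ c, O.algebraMap_mem c, 1, O.one_mem,
    fun _ => one_ne_zero, fun _ => one_mul _⟩

theorem mem_fractions (O : Subalgebra K (T → K)) (ψ : X → T) {f : T → K} (hf : f ∈ O) {F : X → K}
    (h : ∀ ω, F ω = f (ψ ω)) : F ∈ fractions O ψ :=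
  ⟨f, hf, 1, O.one_mem, fun _ => one_ne_zero, fun ω => (one_mul _).trans (h ω)⟩

theorem mem_fractions_of_mul (O : Subalgebra K (T → K)) (ψ : X → T) {P : X → K}
    (hP : P ∈ fractions O ψ) (hP' : ∀ ω, P ω ≠ 0) {y : X → K} (hy : y * P ∈ fractions O ψ) :
    y ∈ fractions O ψ := by
  obtain ⟨f, hf, g, hg, h, e⟩ := hP
  obtain ⟨f', hf', g', hg', h', e'⟩ := hy
  refine ⟨g * f', O.mul_mem hg hf', f * g', O.mul_mem hf hg', fun ω => ?_, fun ω => ?_⟩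
  · rw [Pi.mul_apply, ← e]
    exact mul_ne_zero (mul_ne_zero (h ω) (hP' ω)) (h' ω)
  · have := e' ω
    simp only [Pi.mul_apply] at this ⊢
    rw [← e, ← this]
    ring

end Fractions

/-! ### The chart as a set described by tuples of matrices. -/

section Chart

variable {K : Type u} [Field K] {N : ℕ}

theorem comp_shear_left_mem {ι β α γ : Type} (a a' : ℕ) (t : K)
    {f : TupleSpace K ι β α γ → K} (hf : f ∈ tuplePoly K ι β α γ) :
    f ∘ tupleAct (shear a (t • std a')) 1 ∈ tuplePoly K ι β α γ := by
  refine comp_mem_of_adjoin _ (forall_tupleCoords ?_ ?_ ?_ ?_) f hf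
  · intro x c b
    change (fun m : TupleSpace K ι β α γ => m.1 x (shear a (t • std a') (std c)) (std b)) ∈ _
    by_cases h : c = a
    · subst h
      simp only [shear_std_self, map_add, map_smul, LinearMap.add_apply, LinearMap.smul_apply]
      exact Subalgebra.add_mem _ (coord_mat_mem x c b) (Subalgebra.smul_mem _ (coord_mat_mem x a' b) t)
    · simp only [shear_std_of_ne h]
      exact coord_mat_mem x c b
  · intro x c
    change (fun m : TupleSpace K ι β α γ => m.2.1 x (shear a (t • std a') (std c))) ∈ _
    by_cases h : c = a
    · subst h
      simp only [shear_std_self, map_add, map_smul]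
      exact Subalgebra.add_mem _ (coord_row_mem x c) (Subalgebra.smul_mem _ (coord_row_mem x a') t)
    · simp only [shear_std_of_ne h]
      exact coord_row_mem x c
  · exact fun x c => coord_col_mem x c
  · exact fun x => coord_const_mem x

theorem comp_shear_right_mem {ι β α γ : Type} (a a' : ℕ) (t : K)
    {f : TupleSpace K ι β α γ → K} (hf : f ∈ tuplePoly K ι β α γ) :
    f ∘ tupleAct 1 (shear a (t • std a')) ∈ tuplePoly K ι β α γ := by
  refine comp_mem_of_adjoin _ (forall_tupleCoords ?_ ?_ ?_ ?_) f hf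
  · intro x b c
    change (fun m : TupleSpace K ι β α γ => m.1 x (std b) (shear a (t • std a') (std c))) ∈ _
    by_cases h : c = a
    · subst h
      simp only [shear_std_self, map_add, map_smul]
      exact Subalgebra.add_mem _ (coord_mat_mem x b c) (Subalgebra.smul_mem _ (coord_mat_mem x b a') t)
    · simp only [shear_std_of_ne h]
      exact coord_mat_mem x b c
  · exact fun x c => coord_row_mem x c
  · intro x c
    change (fun m : TupleSpace K ι β α γ => m.2.2.1 x (shear a (t • std a') (std c))) ∈ _
    by_cases h : c = a
    · subst h
      simp only [shear_std_self, map_add, map_smul]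
      exact Subalgebra.add_mem _ (coord_col_mem x c) (Subalgebra.smul_mem _ (coord_col_mem x a') t)
    · simp only [shear_std_of_ne h]
      exact coord_col_mem x c
  · exact fun x => coord_const_mem x

theorem posIdx_zero_mem (hN : 1 ≤ N) : posIdx 0 ∈ range (N, N) := posIdx_mem hN

theorem exists_const_eq_coord (hN : 1 ≤ N) {I : ℕ → Idx} (h1 : ∀ n < N, I n ∈ range (N, N))
    (h2 : ∀ n, N ≤ n → I n = posIdx n) :
    ∃ x, ∀ ω : DualWedge K, coord I ω = (nearTuple N ω).2.2.2 x := by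
  refine ⟨fun l => if h : (l : ℕ) < N then ⟨I l, h1 l h⟩ else ⟨posIdx 0, posIdx_zero_mem hN⟩,
    fun ω => ?_⟩
  rw [nearTuple_const]
  refine congrArg (fun J => coord J ω) (funext fun n => ?_)
  by_cases hn : n < N
  · simp [holeSeq, hn]
  · simp [holeSeq, hn, h2 n (by omega)]

theorem enum_le (n a : ℕ) : (enum n a).1 ≤ (a : ℤ) - n + 1 := by
  unfold enum
  split_ifs <;> simp only <;> omega

/-- The entries of the Pfaffian involve only near indices before a standard tail, so they are among
the constants of the tuple. Transvections between distant indices fix these constants and hence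
preserve the chart. -/
theorem eval_Pf_congr {r : ℕ} (hN : 2 * r + 2 ≤ N) {ω ω' : DualWedge K}
    (h : (nearTuple N ω).2.2.2 = (nearTuple N ω').2.2.2) : eval K (Pf K r) ω = eval K (Pf K r) ω' := by
  rw [eval_Pf, eval_Pf]
  refine pfaffian_congr fun a b _ => ?_
  have h0 : ∀ ω : DualWedge K,
      (wedge ω fun k => id (pairSeq (enumSeq (2 * r) a) (enumSeq (2 * r) b) basisSeq k)) =
        coord (pairSeq (enum (2 * r) a) (enum (2 * r) b) posIdx) ω := by
    intro ω
    refine congrArg (wedge ω) (funext fun k => ?_)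
    simp only [id, pairSeq]
    split_ifs <;> rfl
  have henum : ∀ c : Fin (2 * (r + 1)), enum (2 * r) c ∈ range (N, N) := by
    intro c
    have h1 := neg_le_enum (2 * r) c
    have h2 := enum_le (2 * r) c
    have h3 := c.2
    constructor
    · simp only; push_cast at h1; omega
    · simp only; push_cast at h2; omega
  obtain ⟨x, hx⟩ := exists_const_eq_coord (K := K) (N := N)
    (I := pairSeq (enum (2 * r) a) (enum (2 * r) b) posIdx) (by omega) (fun n hn => by
      simp only [pairSeq]
      split_ifs
      · exact henum a
      · exact henum b
      · exact posIdx_mem hn) (fun n hn => by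
      simp only [pairSeq]
      rw [if_neg (by omega), if_neg (by omega)])
  rw [h0, h0, hx, hx, h]

theorem eval_PfDual_congr {s : ℕ} (hN : 2 * s + 2 ≤ N) {ω ω' : DualWedge K}
    (h : (nearTuple N ω).2.2.2 = (nearTuple N ω').2.2.2) :
    eval K (PfDual K s) ω = eval K (PfDual K s) ω' := by
  rw [eval_PfDual, eval_PfDual]
  refine pfaffian_congr fun a b hab => ?_
  have hab' : (a : ℕ) < b := hab
  have hb := b.2
  obtain ⟨x, hx⟩ := exists_const_eq_coord (K := K) (N := N)
    (I := fun k => enum 2 (skip a b k)) (by omega) (fun n hn => by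
      have h1 := neg_le_enum 2 (skip a b n)
      have h2 := enum_le 2 (skip a b n)
      have h3 : skip a b n ≤ n + 2 := by
        unfold skip
        split_ifs <;> omega
      constructor
      · simp only; push_cast at h1; omega
      · simp only; push_cast at h2; omega) (fun n hn => by
      rw [skip_of_le hab' (by omega), enum_add])
  exact congrArg ((-1) ^ ((a : ℕ) + b + 1) * ·) ((hx ω).trans ((congrFun h x).trans (hx ω').symm))

theorem exists_farNeg {i : Idx} (h : i.1 < -(N : ℤ)) : ∃ a, i = farNeg N a := by
  refine ⟨(-(N : ℤ) - 1 - i.1).toNat, Subtype.ext ?_⟩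
  simp only [farNeg]
  omega

theorem exists_posIdx {i : Idx} (h : (N : ℤ) < i.1) : ∃ m, N ≤ m ∧ i = posIdx m := by
  refine ⟨(i.1 - 1).toNat, by omega, Subtype.ext ?_⟩
  simp only [posIdx]
  omega

/-- The coordinates with at most one distant negative index and at most one distant gap are,
up to sign, the entries of the tuple of matrices. -/
theorem exists_poly_eq_coord (hN : 1 ≤ N) {I : ℕ → Idx} (hI : IsStdIdx I) (hinj : I.Injective)
    (hneg : (distantNeg N I).Subsingleton) (hgaps : (distantGaps N I).Subsingleton) :
    ∃ f ∈ tuplePoly K _ _ _ _, ∀ ω : DualWedge K, coord I ω = f (nearTuple N ω) := by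
  obtain ⟨I', hI', hinj', hrange, halign, ε, hε⟩ :=
    exists_aligned (K := K) posIdx_injective hinj ⟨0, fun _ _ => rfl⟩ hI
  have hneg' : (distantNeg N I').Subsingleton := by rwa [distantNeg, hrange]
  have hgaps' : (distantGaps N I').Subsingleton := by rwa [distantGaps, hrange]
  have halign' : ∀ k, posIdx k ∈ Set.range I' → I' k = posIdx k := fun k hk =>
    halign k (hrange ▸ hk)
  suffices h : ∃ f ∈ tuplePoly K _ _ _ _, ∀ ω : DualWedge K, coord I' ω = f (nearTuple N ω) by
    obtain ⟨f, hf, h⟩ := h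
    refine ⟨ε • f, ?_, fun ω => ?_⟩
    · rw [Units.smul_def]
      exact Subalgebra.zsmul_mem _ hf _
    · rw [Pi.smul_apply, ← h, hε, smul_smul, Int.units_mul_self, one_smul]
  -- After alignment with `1, 2, …`, a position `≥ N` is nonstandard only at the unique distant gap,
  -- if there is one.
  obtain ⟨k, hk1, hk2⟩ : ∃ k : Option ℕ, (∀ b, k = some b → posIdx (N + b) ∉ Set.range I') ∧
      ∀ n, N ≤ n → k ≠ some (n - N) → I' n = posIdx n := by
    by_cases h : ∃ k, k ∈ distantGaps N I'
    · obtain ⟨n, hn⟩ := h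
      refine ⟨some (n - N), fun b hb => ?_, fun m hm hne => halign' m ?_⟩
      · have hn1 := hn.1
        have := Option.some.inj hb
        rw [show N + b = n by omega]
        exact hn.2
      · by_contra hcon
        exact hne (congrArg (fun n => some (n - N)) (hgaps' hn ⟨hm, hcon⟩))
    · refine ⟨none, by simp, fun m hm _ => halign' m ?_⟩
      by_contra hcon
      exact h ⟨m, hm, hcon⟩
  let p : Fin (N + 1) → ℕ := fun l => if (l : ℕ) < N then l else N + k.getD 0
  have hp : p.Injective := by
    intro a b hab
    have ha := a.2
    have hb := b.2
    simp only [p] at hab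
    apply Fin.ext
    split_ifs at hab <;> omega
  -- The entries in the first `N` positions and at the gap. If there is no gap, the last slot is
  -- unused and is filled with a near index.
  let y : Fin (N + 1) → Idx := fun l => if (l : ℕ) < N ∨ k.isSome then I' (p l) else posIdx 0
  have hy : holeSeq y k = I' := by
    ext1 n
    unfold holeSeq
    split_ifs with h1 h2
    · simp [y, p, h1]
    · subst h2
      simp only [y, p, Option.isSome_some, or_true, if_true, Fin.val_last, lt_irrefl, if_false,
        Option.getD_some]
      congr 1
      omega
    · exact (hk2 n (by omega) h2).symm
  -- A larger value would be a standard index `m + 1` with `m ≥ N`. By alignment it stands at its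
  -- own position `m`, which would have to be the gap, whose index does not occur.
  have hle : ∀ l, (y l).1 ≤ (N : ℤ) := by
    intro l
    by_contra hcon
    simp only [y] at hcon
    split_ifs at hcon with h1
    · obtain ⟨m, hm, he⟩ := exists_posIdx (not_le.1 hcon)
      have h2 := hinj' ((halign' m ⟨_, he⟩).trans he.symm)
      by_cases h3 : (l : ℕ) < N
      · simp only [p, h3, if_true] at h2
        omega
      · obtain ⟨b, hb⟩ := Option.isSome_iff_exists.1 (h1.resolve_left h3)
        refine hk1 b hb ⟨_, he.trans ?_⟩
        rw [h2]
        simp [p, h3, hb]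
    · have := (posIdx_zero_mem hN).2
      simp only at this
      omega
  have hslot : ∀ l, (y l).1 < -(N : ℤ) → (l : ℕ) < N ∨ k.isSome := by
    intro l hl
    by_contra hcon
    simp only [y, hcon, if_false] at hl
    have := posIdx_pos 0
    omega
  by_cases hfar : ∃ l, (y l).1 < -(N : ℤ)
  · obtain ⟨l, hl⟩ := hfar
    obtain ⟨a, ha⟩ := exists_farNeg hl
    have hother : ∀ l', l' ≠ l → y l' ∈ range (N, N) := by
      intro l' hne
      refine ⟨?_, hle l'⟩
      by_contra hcon
      have hl' : (y l').1 < -(N : ℤ) := not_le.1 hcon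
      have h1 : y l = I' (p l) := if_pos (hslot l hl)
      have h2 : y l' = I' (p l') := if_pos (hslot l' hl')
      rw [h1] at hl
      rw [h2] at hl'
      exact hne (hp (hinj' (hneg' ⟨hl', _, rfl⟩ ⟨hl, _, rfl⟩)))
    let x : Fin (N + 1) → Near N := fun l' => if h : l' = l then ⟨posIdx 0, posIdx_zero_mem hN⟩
      else ⟨y l', hother l' h⟩
    have hx : Function.update (fun l => (x l).1) l (farNeg N a) = y := by
      ext1 l'
      by_cases h : l' = l
      · subst h
        rw [Function.update_self, ha]
      · simp [x, h]
    cases k with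
    | none =>
      have hlN : (l : ℕ) < N := (hslot l hl).resolve_right (by simp)
      refine ⟨_, coord_row_mem (⟨l, hlN⟩, x) a, fun ω => ?_⟩
      rw [nearTuple_row]
      have : (⟨l, hlN⟩ : Fin N).castSucc = l := rfl
      simp only [this, hx, hy]
    | some b =>
      refine ⟨_, coord_mat_mem (l, x) a b, fun ω => ?_⟩
      rw [nearTuple_mat]
      simp only [hx, hy]
  · have hnear : ∀ l, y l ∈ range (N, N) := fun l =>
      ⟨not_lt.1 fun h => hfar ⟨l, h⟩, hle l⟩
    let x : Fin (N + 1) → Near N := fun l => ⟨y l, hnear l⟩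
    cases k with
    | none =>
      refine ⟨_, coord_const_mem x, fun ω => ?_⟩
      rw [nearTuple_const, ← hy]
    | some b =>
      refine ⟨_, coord_col_mem x b, fun ω => ?_⟩
      rw [nearTuple_col, ← hy]

variable (K)

/-- Evaluation of polynomials, as a homomorphism to the algebra of functions. -/
def evalHom : CoordRing K →ₐ[K] (DualWedge K → K) :=
  AlgHom.pi fun ω => SymmetricAlgebra.lift (linForm ω)

/-- The closed sets that are stable under the group. -/
def StableClosed (Z : Set (DualWedge K)) : Prop :=
  IsZClosed (evalHom K).range Z ∧ ∀ g : GInf K, ∀ ω ∈ Z, g • ω ∈ Z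

/-- The points of a Pfaffian variety at which the smaller Pfaffians do not vanish. -/
def chart (r s : ℕ) : Set (DualWedge K) :=
  {ω | ω ∈ pfaffianVariety K (r + 1) (s + 1) ∧ eval K (Pf K r) ω ≠ 0 ∧ eval K (PfDual K s) ω ≠ 0}

variable {K}

theorem smul_mem_chart {r s : ℕ} (hr : 2 * r + 2 ≤ N) (hs : 2 * s + 2 ≤ N) {ω : DualWedge K}
    (hω : ω ∈ chart K r s) {g : GInf K}
    (hg : (nearTuple N (g • ω)).2.2.2 = (nearTuple N ω).2.2.2) : g • ω ∈ chart K r s :=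
  ⟨(pfaffianVariety K (r + 1) (s + 1)).smul_mem g hω.1, by
    rw [eval_Pf_congr hr hg]; exact hω.2.1, by
    rw [eval_PfDual_congr hs hg]; exact hω.2.2⟩

/-- `coordOn_mem` reduces to coordinates that are entries of the tuple, since fractions with nowhere
vanishing denominators permit division by the two Pfaffians. -/
theorem coord_mem_fractions [Infinite K] {r s : ℕ} (hr : 2 * r + 2 ≤ N) (hs : 2 * s + 2 ≤ N)
    {I : ℕ → Idx} (hI : IsStdIdx I) : coordOn (chart K r s) I ∈
      fractions (tuplePoly K _ _ _ _) fun ω : chart K r s => nearTuple N ω.1 := by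
  refine coordOn_mem (N := N) ⟨by omega, by omega⟩ (fun ω hω => hω.1) (fun ω hω => hω.2.1)
    (fun ω hω => hω.2.2) (fun P hP hP' y hy => mem_fractions_of_mul _ _ hP hP' hy)
    (fun J hJ hinj h1 h2 => ?_) hI
  obtain ⟨f, hf, h⟩ := exists_poly_eq_coord (K := K) (N := N) (by omega) hJ hinj h1 h2
  exact mem_fractions _ _ hf fun ω => h ω.1

theorem eval_mem_fractions [Infinite K] {r s : ℕ} (hr : 2 * r + 2 ≤ N) (hs : 2 * s + 2 ≤ N)
    (f : CoordRing K) : (fun ω : chart K r s => eval K f ω.1) ∈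
      fractions (tuplePoly K _ _ _ _) fun ω : chart K r s => nearTuple N ω.1 := by
  refine comp_mem_of_adjoin (fun ω : chart K r s => ω.1) ?_ _ (eval_mem_adjoin f)
  rintro _ ⟨I, hI, rfl⟩
  exact coord_mem_fractions hr hs hI

/-- Stable closed sets are compared on the chart with the closures `C` of their images under
`nearTuple`. These are stable under elementary operations, as the operations come from group
elements that preserve the chart. -/
theorem noethOn_chart [Infinite K] (r s : ℕ) : NoethOn (StableClosed K) (chart K r s) := by
  classical
  obtain ⟨N, hr, hs⟩ : ∃ N, 2 * r + 2 ≤ N ∧ 2 * s + 2 ≤ N :=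
    ⟨2 * r + 2 * s + 2, by omega, by omega⟩
  have : Fintype (Near N) := Fintype.ofFinite _
  refine (noethOn_tupleClosed (K := K) _ (Fin (N + 1) × (Fin (N + 1) → Near N))
    (Fin N × (Fin (N + 1) → Near N)) (Fin (N + 1) → Near N) (Fin (N + 1) → Near N) rfl).of_map
    TupleClosed.iInter (nearTuple N) (fun _ _ => Set.mem_univ _) fun Z hZ => ?_
  let C : Set (TupleSpace K (Fin (N + 1) × (Fin (N + 1) → Near N))
    (Fin N × (Fin (N + 1) → Near N)) (Fin (N + 1) → Near N) (Fin (N + 1) → Near N)) :=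
    {m | ∀ f ∈ tuplePoly K _ _ _ _, (∀ ω ∈ Z ∩ chart K r s, f (nearTuple N ω) = 0) → f m = 0}
  refine ⟨C, tupleClosed_of_elementary ?_ ?_ ?_, fun ω hω => ⟨fun h => ?_, fun h => ?_⟩⟩
  · intro m hm
    simp only [C, Set.mem_ofPred_eq, not_forall] at hm
    obtain ⟨f, hf, h0, h1⟩ := hm
    exact ⟨f, hf, fun m' hm' => hm' f hf h0, h1⟩
  · intro a a' ha t m hm f hf h0
    obtain ⟨g, hg⟩ := exists_isTransvection (K := K) (fun e => ha (farNeg_injective N e)) t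
    refine hm _ (comp_shear_left_mem a a' t hf) fun ω hω => ?_
    rw [Function.comp_apply, ← nearTuple_smul_farNeg hg]
    refine h0 _ ⟨hZ.2 g ω hω.1, smul_mem_chart hr hs hω.2 ?_⟩
    rw [nearTuple_smul_farNeg hg]
    rfl
  · intro q p hqp t m hm f hf h0
    obtain ⟨g, hg⟩ := exists_isTransvection (K := K) (i := posIdx (N + p)) (j := posIdx (N + q))
      (fun e => hqp (by have := posIdx_injective e; omega)) (-t)
    refine hm _ (comp_shear_right_mem q p t hf) fun ω hω => ?_
    rw [Function.comp_apply, ← nearTuple_smul_farPos hqp.symm hg]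
    refine h0 _ ⟨hZ.2 g ω hω.1, smul_mem_chart hr hs hω.2 ?_⟩
    rw [nearTuple_smul_farPos hqp.symm hg]
    rfl
  · exact fun f _ h0 => h0 ω ⟨h, hω⟩
  -- An equation of `Z` becomes, after clearing its denominator, a polynomial in the tuple that
  -- vanishes on `Z ∩ chart K r s`, hence on `C`. So `C` recovers `Z` on the chart.
  · by_contra hcon
    obtain ⟨_, ⟨F, rfl⟩, h0, h1⟩ := hZ.1 ω hcon
    obtain ⟨f, hf, g, -, hg, hfg⟩ := eval_mem_fractions (N := N) hr hs F
    have h2 : f (nearTuple N ω) = 0 := h f hf fun ω' hω' => by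
      refine (hfg ⟨ω', hω'.2⟩).symm.trans ?_
      exact (congrArg (g (nearTuple N ω') * ·) (h0 ω' hω'.1)).trans (mul_zero _)
    exact mul_ne_zero (hg ⟨ω, hω⟩) h1 ((hfg ⟨ω, hω⟩).trans h2)

end Chart

end InfWedge
end

noncomputable section

namespace InfWedge

universe u

/-! ### Noetherianity of the Pfaffian varieties -/

section Main

variable {K : Type u} [Field K]

theorem pfaffian_one {R : Type u} [CommRing R] (A : Matrix (Fin (2 * (0 + 1))) (Fin (2 * (0 + 1))) R) :
    pfaffian (0 + 1) A = A ⟨0, by omega⟩ ⟨1, by omega⟩ := by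
  unfold pfaffian
  rw [Finset.sum_eq_single 1]
  · simp
  · intro σ hσ hne
    refine absurd (Equiv.ext fun a => ?_) hne
    have h1 : σ ⟨0, by omega⟩ < σ ⟨1, by omega⟩ := (Finset.mem_filter.1 hσ).2.1 0
    have h2 := (σ ⟨1, by omega⟩).2
    have h3 : (σ ⟨0, by omega⟩ : ℕ) < σ ⟨1, by omega⟩ := h1
    apply Fin.ext
    rcases (show (a : ℕ) = 0 ∨ (a : ℕ) = 1 by omega) with h | h
    · have h4 : σ a = σ ⟨0, by omega⟩ := congrArg σ (Fin.ext h)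
      rw [h4, Equiv.Perm.one_apply, h]
      omega
    · have h4 : σ a = σ ⟨1, by omega⟩ := congrArg σ (Fin.ext h)
      rw [h4, Equiv.Perm.one_apply, h]
      omega
  · intro h
    refine absurd (Finset.mem_filter.2 ⟨Finset.mem_univ _, fun i => ?_, fun i j hij => ?_⟩) h
    · rw [Fin.lt_def]
      simp
    · rw [Fin.lt_def] at hij
      omega

theorem wedge_eq_zero_of_mem_left [Infinite K] {s : ℕ} {ω : DualWedge K}
    (hω : ω ∈ pfaffianVariety K 0 s) {w : ℕ → VInf K} (hw : IsStd w) : wedge ω w = 0 := by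
  obtain ⟨p, hp⟩ := hw
  have h := pfaffian_wedge_eq_zero hω (U := w) (L := p) hp
  refine Eq.trans (congrArg (wedge ω) (funext fun k => ?_)) ((pfaffian_one _).symm.trans h)
  simp only [pairSeq]
  split_ifs with h1 h2
  · rw [h1]
  · rw [h2]
  · rfl

theorem wedge_eq_zero_of_mem_right [Infinite K] {r : ℕ} {ω : DualWedge K}
    (hω : ω ∈ pfaffianVariety K r 0) {w : ℕ → VInf K} (hw : IsStd w) : wedge ω w = 0 := by
  obtain ⟨p, hp⟩ := hw
  -- The only entry skips rows `0` and `1`, so shifting `w` by two leaves exactly `w`; the first two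
  -- vectors are irrelevant.
  have h := pfaffian_wedge_skip_eq_zero hω (U := fun k => w (k - 2)) (L := p)
    (fun k hk => by rw [Nat.add_sub_cancel, hp k hk])
  have h1 := (pfaffian_one _).symm.trans h
  simp only [zero_add, Nat.reduceAdd, even_two, Even.neg_pow, one_pow, one_mul] at h1
  exact h1

theorem subsingleton_of_wedge_eq_zero {S : Set (DualWedge K)}
    (h : ∀ ω ∈ S, ∀ w : ℕ → VInf K, IsStd w → wedge ω w = 0) : S.Subsingleton := by
  intro ω hω ω' hω'
  have key : ∀ f ∈ Submodule.span K (coord (K := K) '' {I | IsStdIdx I}), f ω = f ω' := by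
    intro f hf
    induction hf using Submodule.span_induction with
    | mem f hf =>
      obtain ⟨I, hI, rfl⟩ := hf
      exact (h ω hω _ (IsStdIdx.isStd hI)).trans (h ω' hω' _ (IsStdIdx.isStd hI)).symm
    | zero => rfl
    | add f g _ _ hf hg => rw [Pi.add_apply, Pi.add_apply, hf, hg]
    | smul c f _ hf => rw [Pi.smul_apply, Pi.smul_apply, hf]
  exact LinearMap.ext (f := linForm ω) (g := linForm ω') fun z => key _ (linForm_mem_span z)

theorem NoethOn.of_subsingleton {X : Type*} {CC : Set X → Prop} {S : Set X}
    (hS : S.Subsingleton) : NoethOn CC S := by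
  intro Z hZ _
  by_cases h : ∃ N, Z N ∩ S = ∅
  · obtain ⟨N, hN⟩ := h
    refine ⟨N, fun k hk => ?_⟩
    rw [hN, Set.eq_empty_iff_forall_notMem]
    rintro x ⟨hx, hxS⟩
    exact Set.eq_empty_iff_forall_notMem.1 hN x ⟨hZ hk hx, hxS⟩
  · have h' : ∀ k, Z k ∩ S = S := by
      intro k
      refine Set.inter_eq_right.2 fun x hx => ?_
      obtain ⟨y, hy, hyS⟩ := Set.nonempty_iff_ne_empty.2 fun e => h ⟨k, e⟩
      exact hS hyS hx ▸ hy
    exact ⟨0, fun k _ => (h' k).trans (h' 0).symm⟩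

/-- A stable set contains a point if and only if it contains any given translate of it, so chains on
the saturation are controlled by their traces on `S`. -/
theorem NoethOn.orbit {S : Set (DualWedge K)} (h : NoethOn (StableClosed K) S) :
    NoethOn (StableClosed K) {ω | ∃ g : GInf K, g • ω ∈ S} := by
  intro Z hZ hC
  obtain ⟨N, hN⟩ := h Z hZ hC
  refine ⟨N, fun k hk => Set.Subset.antisymm (Set.inter_subset_inter_left _ (hZ hk)) ?_⟩
  rintro ω ⟨hω, g, hg⟩
  refine ⟨?_, g, hg⟩
  have h1 : g • ω ∈ Z k ∩ S := by
    rw [hN k hk]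
    exact ⟨(hC N).2 g ω hω, hg⟩
  have h2 := (hC k).2 g⁻¹ _ h1.1
  rwa [inv_smul_smul] at h2

theorem noethOn_pfaffianVariety [Infinite K] (r s : ℕ) :
    NoethOn (StableClosed K) (pfaffianVariety K r s : Set (DualWedge K)) := by
  induction r generalizing s with
  | zero => exact .of_subsingleton (subsingleton_of_wedge_eq_zero fun ω hω w hw =>
      wedge_eq_zero_of_mem_left hω hw)
  | succ r ihr =>
    induction s with
    | zero => exact .of_subsingleton (subsingleton_of_wedge_eq_zero fun ω hω w hw =>
        wedge_eq_zero_of_mem_right hω hw)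
    | succ s ihs =>
      -- A point whose orbit satisfies one of the smaller Pfaffian equations lies in a smaller
      -- variety. Otherwise some translate lies in the chart.
      refine (((ihr (s + 1)).union ihs).union (noethOn_chart r s).orbit).mono fun ω hω => ?_
      by_cases h1 : ∀ g : GInf K, eval K (Pf K r) (g • ω) = 0
      · exact Or.inl (Or.inl fun g => ⟨h1 g, (hω g).2⟩)
      by_cases h2 : ∀ g : GInf K, eval K (PfDual K s) (g • ω) = 0
      · exact Or.inl (Or.inr fun g => ⟨(hω g).1, h2 g⟩)
      push Not at h1 h2
      obtain ⟨g₁, h1⟩ := h1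
      obtain ⟨g₂, h2⟩ := h2
      obtain ⟨g, hg1, hg2⟩ := exists_common_translate h1 h2
      exact Or.inr ⟨g, (pfaffianVariety K (r + 1) (s + 1)).smul_mem g hω, hg1, hg2⟩

theorem stableClosed_iff {Z : Set (DualWedge K)} : StableClosed K Z ↔
    IsClosed Z ∧ ∀ g : GInf K, ∀ ω ∈ Z, g • ω ∈ Z := by
  refine and_congr_left fun _ => ?_
  rw [isClosed_iff]
  constructor
  · intro h
    refine ⟨{f | ∀ ω ∈ Z, eval K f ω = 0}, Set.Subset.antisymm (fun ω hω f hf => hf ω hω)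
      fun ω hω => ?_⟩
    by_contra hcon
    obtain ⟨_, ⟨f, rfl⟩, h0, h1⟩ := h ω hcon
    exact h1 (hω f h0)
  · rintro ⟨S, rfl⟩ ω hω
    simp only [zeroLocus, Set.mem_ofPred_eq, not_forall] at hω
    obtain ⟨f, hf, h1⟩ := hω
    exact ⟨_, ⟨f, rfl⟩, fun ω' h' => h' f hf, h1⟩

theorem isEquivariantlyNoetherian_pfaffianVariety [Infinite K] (r s : ℕ) :
    IsEquivariantlyNoetherian (GInf K) (pfaffianVariety K r s) := by
  intro Z hZ hcl hst
  -- A relatively closed set is the trace of its closure in the ambient space, and the closure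
  -- inherits stability.
  have hpre : ∀ k, Z k = Subtype.val ⁻¹' closure (Subtype.val '' Z k) := fun k =>
    (hcl k).closure_eq.symm.trans
      (Topology.IsInducing.subtypeVal.closure_eq_preimage_closure_image (Z k))
  obtain ⟨N, hN⟩ := noethOn_pfaffianVariety (K := K) r s (fun k => closure (Subtype.val '' Z k))
    (fun k l hkl => closure_mono (Set.image_mono (hZ hkl))) (fun k => stableClosed_iff.2
      ⟨isClosed_closure, fun g ω hω => by
        refine map_mem_closure (continuous_const_smul g) hω ?_
        rintro _ ⟨y, hy, rfl⟩
        exact ⟨g • y, hst k g y hy, rfl⟩⟩)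
  refine ⟨N, fun k hk => ?_⟩
  rw [hpre k, hpre N]
  ext y
  have := Set.ext_iff.1 (hN k hk) y.1
  exact ⟨fun h => (this.1 ⟨h, y.2⟩).1, fun h => (this.2 ⟨h, y.2⟩).1⟩

/-- The common zero set of the orbits of a set of polynomials. -/
def orbitZeros (F : Set (CoordRing K)) : Set (DualWedge K) :=
  {ω | ∀ f ∈ F, ∀ g : GInf K, eval K f (g • ω) = 0}

theorem stableClosed_orbitZeros (F : Set (CoordRing K)) : StableClosed K (orbitZeros F) := by
  refine stableClosed_iff.2 ⟨?_, fun h ω hω f hf g => ?_⟩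
  · have : orbitZeros F = ⋂ g : GInf K, (g • ·) ⁻¹' zeroLocus K F := by
      ext ω
      simp only [orbitZeros, zeroLocus, Set.mem_ofPred_eq, Set.mem_iInter, Set.mem_preimage]
      exact ⟨fun h g f hf => h f hf g, fun h f hf g => h g f hf⟩
    rw [this]
    exact isClosed_iInter fun g =>
      ((isClosed_iff K _).2 ⟨F, rfl⟩).preimage (continuous_const_smul g)
  · rw [← mul_smul]
    exact hω f hf (g * h)

/-- Otherwise one could keep adding equations of `Z`, each cutting out a strictly smaller set.
Starting with the two Pfaffians keeps all these sets inside the variety, where such a chain must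
stop. -/
theorem exists_finite_orbitZeros [Infinite K] {r s : ℕ} {Z : Set (DualWedge K)}
    (hZ : StableClosed K Z) (hY : Z ⊆ (pfaffianVariety K r s : Set (DualWedge K))) :
    ∃ F : Set (CoordRing K), F.Finite ∧ Z = orbitZeros F := by
  by_contra hcon
  push Not at hcon
  let T := {F : Set (CoordRing K) // F.Finite ∧ ({Pf K r, PfDual K s} : Set (CoordRing K)) ⊆ F ∧
    ∀ f ∈ F, ∀ ω ∈ Z, eval K f ω = 0}
  have hsub : ∀ F : T, Z ⊆ orbitZeros F.1 := fun F ω hω f hf g => F.2.2.2 f hf _ (hZ.2 g ω hω)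
  have hstep : ∀ F : T, ∃ F' : T, F.1 ⊆ F'.1 ∧ ∃ ω ∈ orbitZeros F.1, ω ∉ orbitZeros F'.1 := by
    intro F
    obtain ⟨ω, hω, hωZ⟩ := Set.not_subset.1 fun h =>
      hcon F.1 F.2.1 (Set.Subset.antisymm (hsub F) h)
    obtain ⟨_, ⟨f, rfl⟩, h0, h1⟩ := hZ.1 ω hωZ
    refine ⟨⟨insert f F.1, F.2.1.insert f, F.2.2.1.trans (Set.subset_insert _ _), ?_⟩,
      Set.subset_insert _ _, ω, hω, fun h => h1 ?_⟩
    · rintro f' (rfl | hf')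
      · exact h0
      · exact F.2.2.2 f' hf'
    · have := h f (Set.mem_insert _ _) 1
      rwa [one_smul] at this
  choose next hnext hlt using hstep
  let F0 : T := ⟨{Pf K r, PfDual K s}, (Set.finite_singleton _).insert _, Set.Subset.rfl, by
    rintro f (rfl | rfl) ω hω
    · have := (hY hω 1).1
      rwa [one_smul] at this
    · have := (hY hω 1).2
      rwa [one_smul] at this⟩
  let F : ℕ → T := fun n => n.rec F0 fun _ => next
  have hmono : Monotone fun n => (F n).1 := monotone_nat_of_le_succ fun n => hnext (F n)
  obtain ⟨n, hn⟩ := noethOn_pfaffianVariety (K := K) r s (fun n => orbitZeros (F n).1)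
    (fun k l hkl ω hω f hf => hω f (hmono hkl hf)) fun n => stableClosed_orbitZeros _
  obtain ⟨ω, h1, h2⟩ := hlt (F n)
  have hωY : ω ∈ (pfaffianVariety K r s : Set (DualWedge K)) := fun g =>
    ⟨h1 _ ((F n).2.2.1 (Or.inl rfl)) g, h1 _ ((F n).2.2.1 (Or.inr rfl)) g⟩
  have h3 : ω ∈ orbitZeros (F (n + 1)).1 ∩ (pfaffianVariety K r s : Set (DualWedge K)) := by
    rw [hn (n + 1) (Nat.le_succ n)]
    exact ⟨h1, hωY⟩
  exact h2 h3.1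

end Main

end InfWedge
end

theorem theorem6p1 (K : Type*) [Field K] [Infinite K] (r s : ℕ) :
    InfWedge.IsEquivariantlyNoetherian (InfWedge.GInf K) (InfWedge.pfaffianVariety K r s) ∧
    ∀ Z : Set (InfWedge.DualWedge K), IsClosed Z →
      (∀ g : InfWedge.GInf K, ∀ ω ∈ Z, g • ω ∈ Z) →
      Z ⊆ (InfWedge.pfaffianVariety K r s : Set (InfWedge.DualWedge K)) →
      ∃ F : Set (InfWedge.CoordRing K), F.Finite ∧
        Z = {ω | ∀ f ∈ F, ∀ g : InfWedge.GInf K, InfWedge.eval K f (g • ω) = 0} :=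
  ⟨InfWedge.isEquivariantlyNoetherian_pfaffianVariety r s, fun _ hZ hst hY =>
    InfWedge.exists_finite_orbitZeros (InfWedge.stableClosed_iff.2 ⟨hZ, hst⟩) hY⟩
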